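/- **Setting.** Let $q>0$, $q\ne 1$, let $\alpha,\beta,\delta\in\mathbb R$, let $(M_n)$ be natural numbers, and put $\mathbf q_n=q^{1/n}$, $\gamma_n=q^{-(M_n+1)/n}$. Assume $\gamma_n\to\gamma$ with $L:=-\log_q\gamma>1$. With $(x;\mathbf q)_k=\prod_{i=0}^{k-1}(1-x\mathbf q^i)$ and $(x_1,\dots,x_r;\mathbf q)_k=\prod_i (x_i;\mathbf q)_k$, and writing $\mathbf q=\mathbf q_n$, let $$\nu_n(y)=\mathbf q^{-y}+\delta\gamma_n\mathbf q^{y+1},\qquad w_n(y)=\frac{(\alpha\mathbf q,\beta\delta\mathbf q,\gamma_n\mathbf q,\gamma_n\delta\mathbf q;\mathbf q)_y\,(1-\gamma_n\delta\mathbf q^{2y+1})}{(\mathbf q,\alpha^{-1}\gamma_n\delta\mathbf q,\beta^{-1}\gamma_n\mathbf q,\delta\mathbf q;\mathbf q)_y\,(\alpha\beta\mathbf q)^y\,(1-\gamma_n\delta\mathbf q)},$$ where $(\alpha^{-1}\gamma_n\delta\mathbf q,\beta^{-1}\gamma_n\mathbf q;\mathbf q)_y(\alpha\beta\mathbf q)^y$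 is read as $\mathbf q^y\prod_{k=1}^y(\alpha-\gamma_n\delta\mathbf q^k)(\beta-\gamma_n\mathbf q^k)$, so that $\alpha=0$ or $\beta=0$ is allowed. Assume that for all large $n$ the weight is well defined and positive, $w_n(y)>0$, for $y=0,\dots,M_n$, and that $\nu_n$ is strictly monotone on $\{0,\dots,M_n\}$. The $q$-Racah ensemble of size $n$ is the probability law on $(y_1,\dots,y_n)\in\{0,\dots,M_n\}^n$ proportional to $\prod_{i<j}(\nu_n(y_i)-\nu_n(y_j))^2\prod_j w_n(y_j)$; the rescaled points are $x_j=y_j/n$. Let $$A_j=\frac{(1-\gamma_n\mathbf q^{j+1})(1-\alpha\mathbf q^{j+1})(1-\alpha\beta\mathbf q^{j+1})(1-\delta\beta\mathbf q^{j+1})}{(1-\alpha\beta\mathbf q^{2j+1})(1-\alpha\beta\mathbf q^{2j+2})},\qquad C_j=\frac{\mathbf q(1-\mathbf q^j)(1-\beta\mathbf q^j)(\delta-\alpha\mathbf q^j)(\gamma_n-\alpha\beta\mathbf q^j)}{(1-\alpha\beta\mathbf q^{2j})(1-\alpha\beta\mathbf q^{2j+1})}$$ be the coefficients in the recurrence of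 the $q$-Racah polynomials, and put $$A(\xi)=\frac{(1-\gamma q^{\xi})(1-\alpha q^{\xi})(1-\alpha\beta q^{\xi})(1-\delta\beta q^{\xi})}{(1-\alpha\beta q^{2\xi})^2},\qquad C(\xi)=\frac{(1-q^{\xi})(1-\beta q^{\xi})(\delta-\alpha q^{\xi})(\gamma-\alpha\beta q^{\xi})}{(1-\alpha\beta q^{2\xi})^2},$$ $$a(\xi)=\sqrt{A(\xi)C(\xi)},\quad b(\xi)=1+\gamma\delta-A(\xi)-C(\xi),\quad \mu(x)=q^{-x}+\gamma\delta q^{x},\quad y(\xi)=q^{-\xi}+\alpha\beta q^{\xi},$$ $$\rho(x)=\frac{|\mu'(x)|}{\pi}\int_{I(x)}\frac{d\xi}{\sqrt{4a(\xi)^2-(\mu(x)-b(\xi))^2}},\qquad I(x)=\{\xi\in(0,1):\ b(\xi)-2a(\xi)\le\mu(x)\le b(\xi)+2a(\xi)\}.$$ **Theorem.** Assume that $\alpha\beta\le 0$ or $\log_q(\alpha\beta)<2\log_q\gamma$. Let $\varepsilon=-1$ if $q<1$ and $\alpha\beta\le0$, and $\varepsilon=1$ otherwise. 1. $\nu_n(nx)\to\mu(x)$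 for every $x\in\mathbb R$; and for $\xi\in[0,L]$ and natural numbers $j_n$ with $j_n/n\to\xi$, one has $\sqrt{A_{j_n}C_{j_n+1}}\to a(\xi)$ and $1+\delta\gamma_n\mathbf q_n-A_{j_n}-C_{j_n}\to b(\xi)$. 2. For every $x\in[0,L]$ with $\mu'(x)\neq0$, the equation $4a(\xi)^2-(\mu(x)-b(\xi))^2=0$ has in $[0,L]$ exactly the solutions $\xi_-(x)\le\xi_+(x)$ (two real solutions, which coincide for at most finitely many such $x$), and if $\xi_-(x)<\xi_+(x)$ then $$\rho(x)=\begin{cases}1,&\xi_-(x)<\xi_+(x)\le1,\\[2pt] \dfrac1\pi\arccos\left(\varepsilon\,\dfrac{2y(1)-y(\xi_-(x))-y(\xi_+(x))}{|y(\xi_-(x))-y(\xi_+(x))|}\right),&\xi_-(x)<1<\xi_+(x),\\[2pt] 0,&1\le\xi_-(x)<\xi_+(x).\end{cases}$$ 3. $\rho$ is the limiting density of the rescaled ensembles: if, on some probability space, $(y_1,\dots,y_n)$ has the law of the $q$-Racah ensemble of size $n$ for all large $n$ (with any joint law for different $n$), then for every $f:\mathbb R\to\mathbb R$ that is Riemann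 integrable on $[0,R]$ for some $R>L$ (that is, bounded and almost everywhere continuous there), almost surely $$\frac1n\sum_{j=1}^n f(y_j/n)\longrightarrow\int_0^L f(x)\rho(x)\,dx\qquad(n\to\infty).$$ -/

import Mathlib

open Filter Topology MeasureTheory ProbabilityTheory

namespace QRacah

noncomputable section

/-! ### The `q`-Racah ensemble (base `p`, real parameters) -/

/-- The `q`-Pochhammer symbol `(a; p)_k = (1 - a)(1 - a p) ⋯ (1 - a p^(k-1))`. -/
def qPoch (a p : ℝ) (k : ℕ) : ℝ := ∏ i ∈ Finset.range k, (1 - a * p ^ i)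

/-- `ν(y) = p^(-y) + δ γ p^(y+1)`, for real `y`. -/
def nu (p γ δ y : ℝ) : ℝ := p ^ (-y) + δ * γ * p ^ (y + 1)

/-- The `q`-Racah weight. The factors `(α⁻¹γδp; p)_y (β⁻¹γp; p)_y (αβp)^y` of the usual denominator
are multiplied out to `p^y ∏_{k=1}^y (α - γδp^k)(β - γp^k)`, which makes sense also when `α = 0` or
`β = 0`; see `weight_eq` for the usual form. -/
def weight (p α β γ δ : ℝ) (y : ℕ) : ℝ :=
  (qPoch (α * p) p y * qPoch (β * δ * p) p y * qPoch (γ * p) p y * qPoch (γ * δ * p) p y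
      * (1 - γ * δ * p ^ (2 * y + 1))) /
    (qPoch p p y * qPoch (δ * p) p y
      * (p ^ y * ∏ k ∈ Finset.range y, ((α - γ * δ * p ^ (k + 1)) * (β - γ * p ^ (k + 1))))
      * (1 - γ * δ * p))

/-- For nonzero `α` and `β` the weight is given by the usual formula. -/
theorem weight_eq (p α β γ δ : ℝ) (hα : α ≠ 0) (hβ : β ≠ 0) (y : ℕ) :
    weight p α β γ δ y =
      (qPoch (α * p) p y * qPoch (β * δ * p) p y * qPoch (γ * p) p y * qPoch (γ * δ * p) p y
          * (1 - γ * δ * p ^ (2 * y + 1))) /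
        (qPoch p p y * qPoch (α⁻¹ * γ * δ * p) p y * qPoch (β⁻¹ * γ * p) p y * qPoch (δ * p) p y
          * (α * β * p) ^ y * (1 - γ * δ * p)) := by
  have key : p ^ y * ∏ k ∈ Finset.range y, ((α - γ * δ * p ^ (k + 1)) * (β - γ * p ^ (k + 1)))
      = qPoch (α⁻¹ * γ * δ * p) p y * qPoch (β⁻¹ * γ * p) p y * (α * β * p) ^ y := by
    have h : ∀ k ∈ Finset.range y, (α - γ * δ * p ^ (k + 1)) * (β - γ * p ^ (k + 1))
        = ((1 - α⁻¹ * γ * δ * p * p ^ k) * (1 - β⁻¹ * γ * p * p ^ k)) * (α * β) := by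
      intro k _
      field_simp
      ring
    rw [Finset.prod_congr rfl h, Finset.prod_mul_distrib, Finset.prod_mul_distrib,
      Finset.prod_const, Finset.card_range, mul_pow (α * β) p y]
    unfold qPoch
    ring
  unfold weight
  rw [key]
  congr 1
  ring

/-- The unnormalized joint density `∏_{i<j} (ν(y_i) - ν(y_j))² ∏_j w(y_j)` of `n` points in
`{0, …, M}`. -/
def jointWeight (n M : ℕ) (p α β γ δ : ℝ) (y : Fin n → Fin (M + 1)) : ℝ :=
  (∏ i : Fin n, ∏ j ∈ Finset.Ioi i,
      (nu p γ δ ((y i : ℕ) : ℝ) - nu p γ δ ((y j : ℕ) : ℝ)) ^ 2)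
    * ∏ j : Fin n, weight p α β γ δ (y j : ℕ)

/-- The `q`-Racah ensemble of size `n`: the law on `n`-tuples of points of `{0, …, M}` whose
probabilities are proportional to `jointWeight`. -/
def ensemble (n M : ℕ) (p α β γ δ : ℝ) : Measure (Fin n → Fin (M + 1)) :=
  ∑ y : Fin n → Fin (M + 1),
    ENNReal.ofReal (jointWeight n M p α β γ δ y / ∑ z, jointWeight n M p α β γ δ z)
      • Measure.dirac y

/-- The coefficient `A_j` in the recurrence of the `q`-Racah polynomials. -/
def recA (p α β γ δ : ℝ) (j : ℕ) : ℝ :=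
  (1 - γ * p ^ (j + 1)) * (1 - α * p ^ (j + 1)) * (1 - α * β * p ^ (j + 1))
      * (1 - δ * β * p ^ (j + 1)) /
    ((1 - α * β * p ^ (2 * j + 1)) * (1 - α * β * p ^ (2 * j + 2)))

/-- The coefficient `C_j` in the recurrence of the `q`-Racah polynomials. -/
def recC (p α β γ δ : ℝ) (j : ℕ) : ℝ :=
  p * (1 - p ^ j) * (1 - β * p ^ j) * (δ - α * p ^ j) * (γ - α * β * p ^ j) /
    ((1 - α * β * p ^ (2 * j)) * (1 - α * β * p ^ (2 * j + 1)))

/-- The off-diagonal recurrence coefficient `√(A_j C_{j+1})` of the normalized polynomials. -/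
def recOff (p α β γ δ : ℝ) (j : ℕ) : ℝ :=
  Real.sqrt (recA p α β γ δ j * recC p α β γ δ (j + 1))

/-- The diagonal recurrence coefficient `1 + δγp - A_j - C_j`. -/
def recDiag (p α β γ δ : ℝ) (j : ℕ) : ℝ :=
  1 + δ * γ * p - recA p α β γ δ j - recC p α β γ δ j

/-! ### The scaling and the limiting objects -/

/-- The base `q^(1/n)` of the `n`-th ensemble. -/
def base (q : ℝ) (n : ℕ) : ℝ := q ^ (1 / (n : ℝ))

/-- `γ_n = q^(-(M_n + 1)/n)`. -/
def gammaSeq (q : ℝ) (M : ℕ → ℕ) (n : ℕ) : ℝ := q ^ (-(((M n : ℝ) + 1) / (n : ℝ)))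

/-- `μ(x) = q^(-x) + γ δ q^x`. -/
def mu (q γ δ x : ℝ) : ℝ := q ^ (-x) + γ * δ * q ^ x

/-- `A(ξ)`, the limit of `A_j` as `j / n → ξ`. -/
def limA (q α β γ δ ξ : ℝ) : ℝ :=
  (1 - γ * q ^ ξ) * (1 - α * q ^ ξ) * (1 - α * β * q ^ ξ) * (1 - δ * β * q ^ ξ) /
    (1 - α * β * q ^ (2 * ξ)) ^ 2

/-- `C(ξ)`, the limit of `C_j` as `j / n → ξ`. -/
def limC (q α β γ δ ξ : ℝ) : ℝ :=
  (1 - q ^ ξ) * (1 - β * q ^ ξ) * (δ - α * q ^ ξ) * (γ - α * β * q ^ ξ) /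
    (1 - α * β * q ^ (2 * ξ)) ^ 2

/-- `a(ξ) = √(A(ξ) C(ξ))`. -/
def limOff (q α β γ δ ξ : ℝ) : ℝ := Real.sqrt (limA q α β γ δ ξ * limC q α β γ δ ξ)

/-- `b(ξ) = 1 + δγ - A(ξ) - C(ξ)`. -/
def limDiag (q α β γ δ ξ : ℝ) : ℝ := 1 + δ * γ - limA q α β γ δ ξ - limC q α β γ δ ξ

/-- `y(ξ) = q^(-ξ) + αβ q^ξ`. -/
def yFun (q α β ξ : ℝ) : ℝ := q ^ (-ξ) + α * β * q ^ ξ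

/-- The set of `ξ ∈ (0, 1)` with `b(ξ) - 2a(ξ) ≤ μ(x) ≤ b(ξ) + 2a(ξ)`. -/
def bulkSet (q α β γ δ x : ℝ) : Set ℝ :=
  {ξ | ξ ∈ Set.Ioo (0 : ℝ) 1 ∧
    limDiag q α β γ δ ξ - 2 * limOff q α β γ δ ξ ≤ mu q γ δ x ∧
    mu q γ δ x ≤ limDiag q α β γ δ ξ + 2 * limOff q α β γ δ ξ}

/-- The density `ρ(x) = (|μ'(x)| / π) ∫_{I(x)} dξ / √(4a(ξ)² - (μ(x) - b(ξ))²)`. The modulus takes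
care of decreasing `μ`. -/
def density (q α β γ δ x : ℝ) : ℝ :=
  |deriv (mu q γ δ) x| / Real.pi *
    ∫ ξ in bulkSet q α β γ δ x,
      1 / Real.sqrt (4 * limOff q α β γ δ ξ ^ 2 - (mu q γ δ x - limDiag q α β γ δ ξ) ^ 2)

/-- The sign `-1` if `q < 1` and `αβ ≤ 0` (when `y` is increasing), and `1` otherwise (when `y` is
decreasing on the relevant interval). -/
def ySign (q α β : ℝ) : ℝ := if q < 1 ∧ α * β ≤ 0 then -1 else 1

end

end QRacah

/-!
The `q`-Racah weight satisfies a detailed balance condition (`weight_mul_diffUp`), so it makes the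
`q`-Racah difference operator symmetric. That operator is bidiagonal on the Newton polynomials of
the nodes `ν(0), ν(1), …`, and its eigenpolynomials are therefore orthogonal. Their expansions give
the recurrence coefficients `A_j` and `C_j`, and since the leading minors of the orthogonal matrix
of normalized functions produce the Vandermonde determinant, the ensemble is determinantal.

*Limit of the moments.* The mean of `∑ ν(y_j)^m` is the sum of the first `n` diagonal entries of the
`m`-th power of the Jacobi matrix. Near the index `ξ n` that matrix looks like the one with constant
coefficients `a(ξ)` and `b(ξ)`, whose diagonal entries are moments of the arcsine law on
`[b(ξ) - 2a(ξ), b(ξ) + 2a(ξ)]` (`tendsto_moment`). The mean moments of the empirical measure thus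
tend to those of a mixture of arcsine laws over `ξ ∈ (0, 1)`, which is the image under `μ` of the
measure with density `ρ` (`integral_mu_mul_density`). This image determines the measure, as `μ` is
injective on `[0, L]`: a zero of `μ'` inside would make `ν_n` change its direction
(`mu_factor_ne`).

*Almost sure convergence.* A power `ν^m` couples only the last `m` of the first `n` orthonormal
functions to the remaining ones, so the variances of the sums `∑ ν(y_j)^m` stay bounded
(`integral_sq_sub_le`). Those of the averages are summable in `n`, which gives almost sure
convergence whatever the joint law. Polynomials in `μ` are dense among the continuous functions on
`[0, L]`, and Riemann integrable functions lie between Lipschitz functions whose integrals differ by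
little.

*The explicit density.* The discriminant `4a(ξ)² - (μ(x) - b(ξ))²` equals, up to the square of an
explicit nonzero factor, the discriminant of the difference operator at `x`, which is quadratic in
`y(ξ)` (`disc_duality`). Its two roots lie in `y([0, L])` because its vertex is a limit of averages
of eigenvalues of the difference operator and its values at both ends are nonpositive
(`exists_roots`). With the roots factored out, the integrand of the density is the derivative of the
arccosine in the theorem.
-/

namespace QRacah

noncomputable section

/-! ### The `q`-Racah difference operator -/

open Polynomial

theorem nu_natCast {p : ℝ} (hp : 0 < p) (γ δ : ℝ) (y : ℕ) :
    nu p γ δ (y : ℝ) = (p ^ y)⁻¹ + δ * γ * p ^ (y + 1) := by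
  unfold nu
  rw [Real.rpow_neg hp.le, Real.rpow_natCast]
  norm_cast

/-- The coefficient of `f (y + 1) - f y` in the `q`-Racah difference operator. -/
def diffUp (p α β γ δ : ℝ) (y : ℕ) : ℝ :=
  (1 - α * p ^ (y + 1)) * (1 - β * δ * p ^ (y + 1)) * (1 - γ * p ^ (y + 1))
      * (1 - γ * δ * p ^ (y + 1)) /
    ((1 - γ * δ * p ^ (2 * y + 1)) * (1 - γ * δ * p ^ (2 * y + 2)))

/-- The coefficient of `f (y - 1) - f y` in the `q`-Racah difference operator. It vanishes at
`y = 0`, also when the denominator does. -/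
def diffDown (p α β γ δ : ℝ) (y : ℕ) : ℝ :=
  p * (1 - p ^ y) * (1 - δ * p ^ y) * (β - γ * p ^ y) * (α - γ * δ * p ^ y) /
    ((1 - γ * δ * p ^ (2 * y)) * (1 - γ * δ * p ^ (2 * y + 1)))

/-- The `q`-Racah difference operator on functions of the lattice variable `y`. -/
def diffOp (p α β γ δ : ℝ) (f : ℕ → ℝ) (y : ℕ) : ℝ :=
  diffUp p α β γ δ y * (f (y + 1) - f y) + diffDown p α β γ δ y * (f (y - 1) - f y)

/-- The Newton polynomial `∏_{i<k} (X - ν(i))`. -/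
def newton (p γ δ : ℝ) (k : ℕ) : ℝ[X] := ∏ i ∈ Finset.range k, (X - C (nu p γ δ (i : ℝ)))

/-- The eigenvalue of the difference operator on polynomials of degree `j` in `ν`. -/
def eigval (p α β : ℝ) (j : ℕ) : ℝ := (p ^ j)⁻¹ - 1 + α * β * (p ^ (j + 1) - p)

/-- The coefficient of `newton (k - 1)` in the image of `newton k` under the difference
operator. -/
def lowerCoeff (p α β γ δ : ℝ) (k : ℕ) : ℝ :=
  (1 - α * p ^ k) * (1 - β * δ * p ^ k) * (1 - γ * p ^ k) * (1 - p ^ k) * p / p ^ (2 * k)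

theorem newton_succ (p γ δ : ℝ) (k : ℕ) :
    newton p γ δ (k + 1) = newton p γ δ k * (X - C (nu p γ δ (k : ℝ))) := by
  simp [newton, Finset.prod_range_succ]

theorem eval_newton_succ (p γ δ s : ℝ) (k : ℕ) :
    (newton p γ δ (k + 1)).eval s = (newton p γ δ k).eval s * (s - nu p γ δ (k : ℝ)) := by
  simp [newton_succ]

theorem newton_monic (p γ δ : ℝ) (k : ℕ) : (newton p γ δ k).Monic :=
  monic_prod_of_monic _ _ fun _ _ => monic_X_sub_C _

theorem newton_natDegree (p γ δ : ℝ) (k : ℕ) : (newton p γ δ k).natDegree = k := by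
  unfold newton
  rw [natDegree_prod_of_monic _ _ fun _ _ => monic_X_sub_C _]
  simp

theorem newton_degree (p γ δ : ℝ) (k : ℕ) : (newton p γ δ k).degree = k := by
  rw [degree_eq_natDegree (newton_monic p γ δ k).ne_zero, newton_natDegree]

/-- A step up in `y` shifts the factors of a Newton polynomial by one index: `ν(y + 1) - ν(i + 1)` and
`ν(y) - ν(i)` have a factor in common. -/
theorem eval_newton_up {p : ℝ} (hp : 0 < p) (γ δ : ℝ) (y k : ℕ) :
    (1 - γ * δ * p ^ (y + 1)) * (newton p γ δ (k + 1)).eval (nu p γ δ ((y + 1 : ℕ) : ℝ))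
      = (newton p γ δ k).eval (nu p γ δ (y : ℝ)) * ((1 - p ^ (y + 1))
        * (1 - γ * δ * p ^ (y + 1) * p ^ k) * (1 - γ * δ * p ^ (y + 2) * p ^ k)
        / (p ^ y * (p * p ^ k))) := by
  induction k with
  | zero =>
    simp only [newton, zero_add, Finset.prod_range_one, Finset.prod_range_zero, eval_sub, eval_X,
      eval_C, nu_natCast hp]
    have := hp.ne'
    simp
    field_simp
    ring
  | succ k ih =>
    rw [eval_newton_succ, ← mul_assoc, ih, eval_newton_succ]
    simp only [nu_natCast hp]
    have := hp.ne'
    have h1 : p ^ (k + 1) = p * p ^ k := by ring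
    have h2 : p ^ (y + 1) = p * p ^ y := by ring
    have h3 : p ^ (y + 2) = p * p * p ^ y := by ring
    have h4 : p ^ (k + 1 + 1) = p * p * p ^ k := by ring
    simp only [h1, h2, h3, h4]
    have hK : p ^ k ≠ 0 := by positivity
    have hT : p ^ y ≠ 0 := by positivity
    generalize p ^ k = K at *
    generalize p ^ y = T at *
    generalize (newton p γ δ _).eval _ = N
    field_simp
    ring

/-- The counterpart of `eval_newton_up` for a step down. -/
theorem eval_newton_down {p : ℝ} (hp : 0 < p) (γ δ : ℝ) (y k : ℕ) :
    (1 - p ^ (y + 1)) * (newton p γ δ (k + 1)).eval (nu p γ δ (y : ℝ))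
      = (newton p γ δ k).eval (nu p γ δ ((y + 1 : ℕ) : ℝ)) * ((1 - γ * δ * p ^ (y + 1))
        * (p ^ k - p ^ (y + 1)) * (p * p ^ k - p ^ (y + 1))
        / (p ^ (y + 1) * p ^ k)) := by
  induction k with
  | zero =>
    simp only [newton, zero_add, Finset.prod_range_one, Finset.prod_range_zero, eval_sub, eval_X,
      eval_C, nu_natCast hp]
    have := hp.ne'
    simp
    field_simp
    ring
  | succ k ih =>
    rw [eval_newton_succ, ← mul_assoc, ih, eval_newton_succ]
    simp only [nu_natCast hp]
    have := hp.ne'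
    have h1 : p ^ (k + 1) = p * p ^ k := by ring
    have h2 : p ^ (y + 1) = p * p ^ y := by ring
    have h4 : p ^ (k + 1 + 1) = p * p * p ^ k := by ring
    have h5 : p ^ (y + 1 + 1) = p * p * p ^ y := by ring
    simp only [h1, h2, h4, h5]
    have hK : p ^ k ≠ 0 := by positivity
    have hT : p ^ y ≠ 0 := by positivity
    generalize p ^ k = K at *
    generalize p ^ y = T at *
    generalize (newton p γ δ _).eval _ = N
    field_simp
    ring

/-- The alternative in the hypothesis covers the top node, where `γ p^(y+1) = 1` makes `diffUp`
vanish whatever its denominator. -/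
theorem diffUp_mul_eval_newton {p α β γ δ : ℝ} (hp : 0 < p) {y : ℕ}
    (h1 : 1 - γ * δ * p ^ (2 * y + 1) ≠ 0)
    (h2 : 1 - γ * δ * p ^ (2 * y + 2) ≠ 0 ∨ 1 - γ * p ^ (y + 1) = 0) (k : ℕ) :
    diffUp p α β γ δ y * ((newton p γ δ (k + 1)).eval (nu p γ δ ((y + 1 : ℕ) : ℝ))
        - (newton p γ δ (k + 1)).eval (nu p γ δ (y : ℝ)))
      = (newton p γ δ k).eval (nu p γ δ (y : ℝ)) * ((1 - α * p ^ (y + 1))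
        * (1 - β * δ * p ^ (y + 1)) * (1 - γ * p ^ (y + 1)) * (1 - γ * δ * p ^ (y + 1) * p ^ k)
        * (1 - p * p ^ k) / (p ^ y * (p * p ^ k) * (1 - γ * δ * p ^ (2 * y + 1)))) := by
  rcases h2 with h2 | h2
  · have key : (1 - γ * δ * p ^ (y + 1)) *
        ((newton p γ δ (k + 1)).eval (nu p γ δ ((y + 1 : ℕ) : ℝ))
          - (newton p γ δ (k + 1)).eval (nu p γ δ (y : ℝ)))
        = (newton p γ δ k).eval (nu p γ δ (y : ℝ)) * ((1 - γ * δ * p ^ (y + 1) * p ^ k)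
        * (1 - p * p ^ k) * (1 - γ * δ * p ^ (2 * y + 2)) / (p ^ y * (p * p ^ k))) := by
      rw [mul_sub, eval_newton_up hp, eval_newton_succ]
      simp only [nu_natCast hp]
      have := hp.ne'
      field_simp
      ring
    have := hp.ne'
    calc _ = (1 - α * p ^ (y + 1)) * (1 - β * δ * p ^ (y + 1)) * (1 - γ * p ^ (y + 1))
          / ((1 - γ * δ * p ^ (2 * y + 1)) * (1 - γ * δ * p ^ (2 * y + 2)))
          * ((1 - γ * δ * p ^ (y + 1)) *
        ((newton p γ δ (k + 1)).eval (nu p γ δ ((y + 1 : ℕ) : ℝ))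
          - (newton p γ δ (k + 1)).eval (nu p γ δ (y : ℝ)))) := by
          unfold diffUp
          ring
      _ = _ := by
          rw [key]
          generalize 1 - γ * δ * p ^ (2 * y + 1) = u at *
          generalize 1 - γ * δ * p ^ (2 * y + 2) = v at *
          field_simp
  · simp [diffUp, h2]

theorem diffDown_mul_eval_newton {p α β γ δ : ℝ} (hp : 0 < p) {y : ℕ}
    (h1 : 1 - γ * δ * p ^ (2 * y + 1) ≠ 0)
    (h2 : y ≠ 0 → 1 - γ * δ * p ^ (2 * y) ≠ 0) (k : ℕ) :
    diffDown p α β γ δ y * ((newton p γ δ (k + 1)).eval (nu p γ δ ((y - 1 : ℕ) : ℝ))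
        - (newton p γ δ (k + 1)).eval (nu p γ δ (y : ℝ)))
      = (newton p γ δ k).eval (nu p γ δ (y : ℝ)) * (p * (1 - δ * p ^ y) * (β - γ * p ^ y)
        * (α - γ * δ * p ^ y) * (p ^ k - p ^ y) * (p * p ^ k - 1)
        / (p ^ y * p ^ k * (1 - γ * δ * p ^ (2 * y + 1)))) := by
  rcases y with _ | y
  · rcases k with _ | k
    · simp [diffDown]
    · simp [diffDown, newton, Finset.prod_range_succ']
  · have h2 := h2 (by simp)
    have key : (1 - p ^ (y + 1)) *
        ((newton p γ δ (k + 1)).eval (nu p γ δ ((y : ℕ) : ℝ))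
          - (newton p γ δ (k + 1)).eval (nu p γ δ ((y + 1 : ℕ) : ℝ)))
        = (newton p γ δ k).eval (nu p γ δ ((y + 1 : ℕ) : ℝ)) * ((p ^ k - p ^ (y + 1))
        * (p * p ^ k - 1) * (1 - γ * δ * p ^ (2 * (y + 1))) / (p ^ (y + 1) * p ^ k)) := by
      rw [mul_sub, eval_newton_down hp, eval_newton_succ]
      simp only [nu_natCast hp]
      have := hp.ne'
      field_simp
      ring
    have := hp.ne'
    rw [Nat.add_sub_cancel]
    calc _ = p * (1 - δ * p ^ (y + 1)) * (β - γ * p ^ (y + 1)) * (α - γ * δ * p ^ (y + 1))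
          / ((1 - γ * δ * p ^ (2 * (y + 1))) * (1 - γ * δ * p ^ (2 * (y + 1) + 1)))
          * ((1 - p ^ (y + 1)) *
        ((newton p γ δ (k + 1)).eval (nu p γ δ ((y : ℕ) : ℝ))
          - (newton p γ δ (k + 1)).eval (nu p γ δ ((y + 1 : ℕ) : ℝ)))) := by
          unfold diffDown
          ring
      _ = _ := by
          rw [key]
          generalize 1 - γ * δ * p ^ (2 * (y + 1)) = u at *
          generalize 1 - γ * δ * p ^ (2 * (y + 1) + 1) = v at *
          field_simp

/-- The difference operator is bidiagonal on Newton polynomials. -/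
theorem diffOp_newton_succ {p α β γ δ : ℝ} (hp : 0 < p) {y : ℕ}
    (h1 : 1 - γ * δ * p ^ (2 * y + 1) ≠ 0)
    (h2 : 1 - γ * δ * p ^ (2 * y + 2) ≠ 0 ∨ 1 - γ * p ^ (y + 1) = 0)
    (h3 : y ≠ 0 → 1 - γ * δ * p ^ (2 * y) ≠ 0) (k : ℕ) :
    diffOp p α β γ δ (fun z => (newton p γ δ (k + 1)).eval (nu p γ δ (z : ℝ))) y
      = eigval p α β (k + 1) * (newton p γ δ (k + 1)).eval (nu p γ δ (y : ℝ))
        + lowerCoeff p α β γ δ (k + 1) * (newton p γ δ k).eval (nu p γ δ (y : ℝ)) := by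
  unfold diffOp
  rw [diffUp_mul_eval_newton hp h1 h2, diffDown_mul_eval_newton hp h1 h3, eval_newton_succ]
  generalize eval _ (newton p γ δ k) = N
  simp only [nu_natCast hp, eigval, lowerCoeff]
  have := hp.ne'
  have e1 : p ^ (k + 1) = p * p ^ k := by ring
  have e2 : p ^ (y + 1) = p * p ^ y := by ring
  have e3 : p ^ (2 * y + 1) = p * (p ^ y * p ^ y) := by ring
  have e4 : p ^ (k + 1 + 1) = p * p * p ^ k := by ring
  have e5 : p ^ (2 * (k + 1)) = p * p * (p ^ k * p ^ k) := by ring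
  rw [e3] at h1
  simp only [e1, e2, e3, e4, e5]
  have hK : p ^ k ≠ 0 := by positivity
  have hT : p ^ y ≠ 0 := by positivity
  generalize p ^ k = K at *
  generalize p ^ y = T at *
  obtain ⟨E, hE⟩ : ∃ E, E = 1 - γ * δ * (p * (T * T)) := ⟨_, rfl⟩
  rw [← hE] at h1 ⊢
  field_simp
  rw [hE]
  ring

end

end QRacah

namespace QRacah

noncomputable section

/-! ### Eigenpolynomials and orthogonality -/

open Polynomial

/-- The parameters of a finite `q`-Racah ensemble on `{0, …, M}`: positive weights, distinct nodes
`ν(0), …, ν(M)`, and factors `1 - αβ p^m` of constant sign, which makes the eigenvalues of the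
difference operator monotone. -/
structure Admissible (p α β γ δ : ℝ) (M : ℕ) : Prop where
  pos : 0 < p
  ne_one : p ≠ 1
  top : γ * p ^ (M + 1) = 1
  weight_pos : ∀ y ≤ M, 0 < weight p α β γ δ y
  strict : StrictMonoOn (fun y : ℕ => nu p γ δ (y : ℝ)) (Set.Iic M) ∨
    StrictAntiOn (fun y : ℕ => nu p γ δ (y : ℝ)) (Set.Iic M)
  sign : (∀ m ≤ 2 * M + 1, 0 < 1 - α * β * p ^ m) ∨ (∀ m ≤ 2 * M + 1, 1 - α * β * p ^ m < 0)

/-- The bilinear form of the weight on functions of the lattice variable. -/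
def form (p α β γ δ : ℝ) (M : ℕ) (f g : ℕ → ℝ) : ℝ :=
  ∑ y ∈ Finset.range (M + 1), weight p α β γ δ y * f y * g y

/-- The coefficient of `newton k` in the monic eigenpolynomial of degree `j`. -/
def expCoeff (p α β γ δ : ℝ) (j k : ℕ) : ℝ :=
  ∏ i ∈ Finset.Ico k j, lowerCoeff p α β γ δ (i + 1) / (eigval p α β j - eigval p α β i)

/-- The monic `q`-Racah polynomial of degree `j`, in the variable `ν`. -/
def racah (p α β γ δ : ℝ) (j : ℕ) : ℝ[X] :=
  ∑ k ∈ Finset.range (j + 1), C (expCoeff p α β γ δ j k) * newton p γ δ k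

/-- The values of a polynomial in `ν`, as a function of the lattice variable. -/
def onLattice (p γ δ : ℝ) (P : ℝ[X]) (y : ℕ) : ℝ := P.eval (nu p γ δ (y : ℝ))

/-- The squared norm of the monic `q`-Racah polynomial. -/
def sqNorm (p α β γ δ : ℝ) (M j : ℕ) : ℝ :=
  form p α β γ δ M (onLattice p γ δ (racah p α β γ δ j)) (onLattice p γ δ (racah p α β γ δ j))

theorem qPoch_succ (a p : ℝ) (k : ℕ) : qPoch a p (k + 1) = qPoch a p k * (1 - a * p ^ k) := by
  simp [qPoch, Finset.prod_range_succ]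

theorem eigval_sub {p : ℝ} (hp : 0 < p) (α β : ℝ) (j k : ℕ) :
    eigval p α β j - eigval p α β k
      = (p ^ k - p ^ j) * (1 - α * β * p ^ (j + k + 1)) / (p ^ j * p ^ k) := by
  have := hp.ne'
  unfold eigval
  field_simp
  ring

theorem pow_ne_pow {p : ℝ} (hp : 0 < p) (h1 : p ≠ 1) {j k : ℕ} (hjk : j ≠ k) :
    p ^ j ≠ p ^ k := fun h => hjk (pow_right_injective₀ hp h1 h)

section form

variable (p α β γ δ : ℝ) (M : ℕ)

theorem form_comm (f g : ℕ → ℝ) : form p α β γ δ M f g = form p α β γ δ M g f :=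
  Finset.sum_congr rfl fun _ _ => by ring

theorem form_congr {f f' g : ℕ → ℝ} (h : ∀ y ≤ M, f y = f' y) :
    form p α β γ δ M f g = form p α β γ δ M f' g :=
  Finset.sum_congr rfl fun y hy => by rw [h y (by simpa [Nat.lt_succ_iff] using hy)]

theorem form_add_left (f f' g : ℕ → ℝ) :
    form p α β γ δ M (fun y => f y + f' y) g
      = form p α β γ δ M f g + form p α β γ δ M f' g := by
  unfold form
  rw [← Finset.sum_add_distrib]
  exact Finset.sum_congr rfl fun _ _ => by ring

theorem form_smul_left (c : ℝ) (f g : ℕ → ℝ) :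
    form p α β γ δ M (fun y => c * f y) g = c * form p α β γ δ M f g := by
  unfold form
  rw [Finset.mul_sum]
  exact Finset.sum_congr rfl fun _ _ => by ring

theorem form_sum_left {ι : Type*} (s : Finset ι) (f : ι → ℕ → ℝ) (g : ℕ → ℝ) :
    form p α β γ δ M (fun y => ∑ i ∈ s, f i y) g = ∑ i ∈ s, form p α β γ δ M (f i) g := by
  unfold form
  rw [Finset.sum_comm]
  refine Finset.sum_congr rfl fun y _ => ?_
  rw [Finset.mul_sum, Finset.sum_mul]

end form

namespace Admissible

variable {p α β γ δ : ℝ} {M : ℕ}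

theorem odd_ne (h : Admissible p α β γ δ M) {y : ℕ} (hy : y ≤ M) :
    1 - γ * δ * p ^ (2 * y + 1) ≠ 0 := by
  intro h0
  have := h.weight_pos y hy
  simp [weight, h0] at this

theorem injOn (h : Admissible p α β γ δ M) :
    Set.InjOn (fun y : ℕ => nu p γ δ (y : ℝ)) (Set.Iic M) :=
  h.strict.elim StrictMonoOn.injOn StrictAntiOn.injOn

/-- A zero of this factor would make two neighbouring nodes coincide. -/
theorem even_ne (h : Admissible p α β γ δ M) {y : ℕ} (hy : y < M) :
    1 - γ * δ * p ^ (2 * y + 2) ≠ 0 := by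
  intro h0
  have hp := h.pos.ne'
  have key : nu p γ δ ((y + 1 : ℕ) : ℝ) = nu p γ δ (y : ℝ) := by
    rw [← sub_eq_zero]
    simp only [nu_natCast h.pos]
    have : (p ^ (y + 1))⁻¹ + δ * γ * p ^ (y + 1 + 1) - ((p ^ y)⁻¹ + δ * γ * p ^ (y + 1))
        = (p ^ (y + 1))⁻¹ * (1 - p) * (1 - γ * δ * p ^ (2 * y + 2)) := by
      field_simp
      ring
    rw [this, h0, mul_zero]
  have := h.injOn (show y + 1 ∈ Set.Iic M from hy) (show y ∈ Set.Iic M from hy.le) key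
  omega

/-- Detailed balance: the weight makes the difference operator symmetric. -/
theorem weight_mul_diffUp (h : Admissible p α β γ δ M) {y : ℕ} (hy : y < M) :
    weight p α β γ δ y * diffUp p α β γ δ y
      = weight p α β γ δ (y + 1) * diffDown p α β γ δ (y + 1) := by
  have h1 := (h.weight_pos (y + 1) hy).ne'
  have h2 := h.odd_ne hy.le
  have h3 := h.odd_ne (y := y + 1) hy
  have h4 := h.even_ne hy
  have hp := h.pos.ne'
  have hd := (div_ne_zero_iff.1 h1).2
  simp only [qPoch_succ, Finset.prod_range_succ, mul_ne_zero_iff] at hd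
  obtain ⟨⟨⟨⟨hd1, hd2⟩, hd3, hd4⟩, -, hd5, hd6, hd7⟩, hd8⟩ := hd
  simp only [weight, qPoch_succ, Finset.prod_range_succ, diffUp, diffDown]
  have e1 : α * p * p ^ y = α * p ^ (y + 1) := by ring
  have e2 : β * δ * p * p ^ y = β * δ * p ^ (y + 1) := by ring
  have e3 : γ * p * p ^ y = γ * p ^ (y + 1) := by ring
  have e4 : γ * δ * p * p ^ y = γ * δ * p ^ (y + 1) := by ring
  have e5 : δ * p * p ^ y = δ * p ^ (y + 1) := by ring
  have e6 : p * p ^ y = p ^ (y + 1) := by ring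
  have e7 : 2 * (y + 1) = 2 * y + 2 := by ring
  have e8 : p ^ (y + 1) = p ^ y * p := by ring
  rw [e7] at h3
  rw [e5] at hd4
  rw [e6] at hd2
  rw [e1, e2, e3, e4, e5, e6, e7]
  generalize 1 - γ * δ * p ^ (2 * y + 2 + 1) = z1 at *
  generalize 1 - γ * δ * p ^ (2 * y + 2) = z2 at *
  generalize 1 - γ * δ * p ^ (2 * y + 1) = z3 at *
  generalize 1 - γ * δ * p = z4 at *
  generalize 1 - α * p ^ (y + 1) = z5 at *
  generalize 1 - β * δ * p ^ (y + 1) = z6 at *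
  generalize 1 - γ * p ^ (y + 1) = z7 at *
  generalize 1 - γ * δ * p ^ (y + 1) = z8 at *
  generalize 1 - δ * p ^ (y + 1) = z9 at *
  generalize α - γ * δ * p ^ (y + 1) = z10 at *
  generalize β - γ * p ^ (y + 1) = z11 at *
  generalize 1 - p ^ (y + 1) = z12 at *
  generalize qPoch p p y = z13 at *
  generalize qPoch (δ * p) p y = z14 at *
  generalize ∏ k ∈ Finset.range y, ((α - γ * δ * p ^ (k + 1)) * (β - γ * p ^ (k + 1)))
    = z15 at *
  rw [e8]
  field_simp

theorem eigval_ne (h : Admissible p α β γ δ M) {j k : ℕ} (hj : j ≤ M) (hk : k ≤ M) (hjk : j ≠ k) :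
    eigval p α β j - eigval p α β k ≠ 0 := by
  rw [eigval_sub h.pos]
  have h1 := pow_ne_pow h.pos h.ne_one hjk.symm
  have h2 : 1 - α * β * p ^ (j + k + 1) ≠ 0 := by
    rcases h.sign with h' | h'
    · exact (h' _ (by omega)).ne'
    · exact (h' _ (by omega)).ne
  have hp := h.pos
  exact div_ne_zero (mul_ne_zero (sub_ne_zero.2 h1) h2) (by positivity)

theorem diffUp_top (h : Admissible p α β γ δ M) : diffUp p α β γ δ M = 0 := by
  simp [diffUp, h.top]

/-- Summation by parts; the boundary terms vanish with `diffUp` at `M` and `diffDown` at `0`. -/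
theorem form_diffOp (h : Admissible p α β γ δ M) (f g : ℕ → ℝ) :
    form p α β γ δ M (diffOp p α β γ δ f) g = - ∑ y ∈ Finset.range M,
      weight p α β γ δ y * diffUp p α β γ δ y * ((f (y + 1) - f y) * (g (y + 1) - g y)) := by
  have e1 : form p α β γ δ M (diffOp p α β γ δ f) g
      = ∑ y ∈ Finset.range (M + 1),
          weight p α β γ δ y * diffUp p α β γ δ y * ((f (y + 1) - f y) * g y)
        + ∑ y ∈ Finset.range (M + 1),
          weight p α β γ δ y * diffDown p α β γ δ y * ((f (y - 1) - f y) * g y) := by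
    unfold form diffOp
    rw [← Finset.sum_add_distrib]
    exact Finset.sum_congr rfl fun _ _ => by ring
  rw [e1, Finset.sum_range_succ, Finset.sum_range_succ' _ M, h.diffUp_top,
    show diffDown p α β γ δ 0 = 0 by simp [diffDown]]
  simp only [mul_zero, zero_mul, add_zero]
  rw [← Finset.sum_add_distrib, ← Finset.sum_neg_distrib]
  refine Finset.sum_congr rfl fun y hy => ?_
  rw [← h.weight_mul_diffUp (Finset.mem_range.1 hy), Nat.add_sub_cancel]
  ring

theorem form_diffOp_comm (h : Admissible p α β γ δ M) (f g : ℕ → ℝ) :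
    form p α β γ δ M (diffOp p α β γ δ f) g = form p α β γ δ M f (diffOp p α β γ δ g) := by
  rw [form_comm _ _ _ _ _ _ f, h.form_diffOp, h.form_diffOp]
  simp only [mul_comm (f _ - f _)]

theorem diffOp_newton (h : Admissible p α β γ δ M) (k : ℕ) {y : ℕ} (hy : y ≤ M) :
    diffOp p α β γ δ (onLattice p γ δ (newton p γ δ k)) y
      = eigval p α β k * onLattice p γ δ (newton p γ δ k) y
        + lowerCoeff p α β γ δ k * onLattice p γ δ (newton p γ δ (k - 1)) y := by
  rcases k with _ | k
  · simp [diffOp, onLattice, newton, eigval, lowerCoeff]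
  · refine diffOp_newton_succ h.pos (h.odd_ne hy) ?_ ?_ k
    · rcases hy.lt_or_eq with h' | rfl
      · exact Or.inl (h.even_ne h')
      · exact Or.inr (by rw [h.top, sub_self])
    · intro h0
      obtain ⟨z, rfl⟩ := Nat.exists_eq_succ_of_ne_zero h0
      exact h.even_ne (y := z) (by omega)

theorem diffOp_sum {ι : Type*} (s : Finset ι) (c : ι → ℝ) (f : ι → ℕ → ℝ) (y : ℕ) :
    diffOp p α β γ δ (fun z => ∑ i ∈ s, c i * f i z) y
      = ∑ i ∈ s, c i * diffOp p α β γ δ (f i) y := by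
  simp only [diffOp, ← Finset.sum_sub_distrib, Finset.mul_sum, ← Finset.sum_add_distrib]
  exact Finset.sum_congr rfl fun _ _ => by ring

theorem onLattice_racah (j : ℕ) : onLattice p γ δ (racah p α β γ δ j)
    = fun z => ∑ k ∈ Finset.range (j + 1),
      expCoeff p α β γ δ j k * onLattice p γ δ (newton p γ δ k) z := by
  ext z
  simp [onLattice, racah, eval_finsetSum]

theorem expCoeff_mul (h : Admissible p α β γ δ M) {j k : ℕ} (hj : j ≤ M) (hk : k < j) :
    expCoeff p α β γ δ j k * (eigval p α β j - eigval p α β k)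
      = expCoeff p α β γ δ j (k + 1) * lowerCoeff p α β γ δ (k + 1) := by
  unfold expCoeff
  rw [Finset.prod_eq_prod_Ico_succ_bot hk]
  have := h.eigval_ne hj (hk.le.trans hj) hk.ne'
  field_simp

/-- The `q`-Racah polynomials are the eigenfunctions of the difference operator. -/
theorem diffOp_racah (h : Admissible p α β γ δ M) {j : ℕ} (hj : j ≤ M) {y : ℕ} (hy : y ≤ M) :
    diffOp p α β γ δ (onLattice p γ δ (racah p α β γ δ j)) y
      = eigval p α β j * onLattice p γ δ (racah p α β γ δ j) y := by
  rw [onLattice_racah, diffOp_sum]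
  simp only [h.diffOp_newton _ hy, mul_add, Finset.sum_add_distrib]
  rw [Finset.sum_range_succ' (fun k => expCoeff p α β γ δ j k *
    (lowerCoeff p α β γ δ k * onLattice p γ δ (newton p γ δ (k - 1)) y)),
    Finset.sum_range_succ, Finset.sum_range_succ, mul_add, Finset.mul_sum,
    show lowerCoeff p α β γ δ 0 = 0 by simp [lowerCoeff]]
  simp only [Nat.add_sub_cancel, zero_mul, mul_zero, add_zero]
  rw [add_right_comm, ← Finset.sum_add_distrib]
  congr 1
  · refine Finset.sum_congr rfl fun k hk => ?_
    linear_combination -onLattice p γ δ (newton p γ δ k) y *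
      h.expCoeff_mul hj (Finset.mem_range.1 hk)
  · ring

/-- Eigenfunctions of a symmetric operator with distinct eigenvalues are orthogonal. -/
theorem form_racah_of_ne (h : Admissible p α β γ δ M) {j k : ℕ} (hj : j ≤ M) (hk : k ≤ M)
    (hjk : j ≠ k) : form p α β γ δ M (onLattice p γ δ (racah p α β γ δ j))
      (onLattice p γ δ (racah p α β γ δ k)) = 0 := by
  have h1 := h.form_diffOp_comm (onLattice p γ δ (racah p α β γ δ j))
    (onLattice p γ δ (racah p α β γ δ k))
  rw [form_congr _ _ _ _ _ _ fun y hy => h.diffOp_racah hj hy, form_smul_left,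
    form_comm p α β γ δ M _ (diffOp p α β γ δ _),
    form_congr _ _ _ _ _ _ fun y hy => h.diffOp_racah hk hy, form_smul_left,
    form_comm p α β γ δ M (onLattice p γ δ (racah p α β γ δ k))] at h1
  have h2 := h.eigval_ne hj hk hjk
  have h3 : (eigval p α β j - eigval p α β k) * form p α β γ δ M
      (onLattice p γ δ (racah p α β γ δ j)) (onLattice p γ δ (racah p α β γ δ k)) = 0 := by
    linarith
  exact (mul_eq_zero.1 h3).resolve_left h2

theorem racah_eq_add (j : ℕ) : racah p α β γ δ j = newton p γ δ j
    + ∑ k ∈ Finset.range j, C (expCoeff p α β γ δ j k) * newton p γ δ k := by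
  unfold racah
  rw [Finset.sum_range_succ, add_comm]
  simp [expCoeff]

theorem degree_sum_newton_lt (c : ℕ → ℝ) (j : ℕ) :
    (∑ k ∈ Finset.range j, C (c k) * newton p γ δ k).degree < j := by
  refine (degree_sum_le _ _).trans_lt ?_
  rw [Finset.sup_lt_iff (by simp)]
  intro k hk
  refine ((degree_mul_le _ _).trans (add_le_add_left degree_C_le _)).trans_lt ?_
  rw [newton_degree, zero_add]
  exact_mod_cast Finset.mem_range.1 hk

theorem racah_monic (j : ℕ) : (racah p α β γ δ j).Monic := by
  rw [racah_eq_add]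
  refine (newton_monic p γ δ j).add_of_left ?_
  rw [newton_degree]
  exact degree_sum_newton_lt _ _

theorem racah_natDegree (j : ℕ) : (racah p α β γ δ j).natDegree = j := by
  rw [racah_eq_add, natDegree_add_eq_left_of_degree_lt, newton_natDegree]
  rw [newton_degree]
  exact degree_sum_newton_lt _ _

theorem form_racah_of_degree_lt (h : Admissible p α β γ δ M) {j : ℕ} (hj : j ≤ M) {R : ℝ[X]}
    (hR : R.degree < j) : form p α β γ δ M (onLattice p γ δ R)
      (onLattice p γ δ (racah p α β γ δ j)) = 0 := by
  suffices ∀ d ≤ j, ∀ R : ℝ[X], R.degree < d → form p α β γ δ M (onLattice p γ δ R)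
      (onLattice p γ δ (racah p α β γ δ j)) = 0 from this j le_rfl R hR
  intro d
  induction d with
  | zero =>
    intro _ R hR
    have : R = 0 := by simpa using hR
    simp [this, form, onLattice]
  | succ d ih =>
    intro hd R hR
    have hR' : (R - C (R.coeff d) * racah p α β γ δ d).degree < d := by
      rw [degree_lt_iff_coeff_zero] at hR ⊢
      intro m hm
      rcases hm.eq_or_lt with rfl | hm
      · have := (racah_monic (p := p) (α := α) (β := β) (γ := γ) (δ := δ) d).coeff_natDegree
        rw [racah_natDegree] at this
        simp [this]
      · simp [hR m hm, coeff_eq_zero_of_natDegree_lt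
          (show (racah p α β γ δ d).natDegree < m by rwa [racah_natDegree])]
    have e : onLattice p γ δ R = fun y =>
        onLattice p γ δ (R - C (R.coeff d) * racah p α β γ δ d) y
          + R.coeff d * onLattice p γ δ (racah p α β γ δ d) y := by
      ext y
      simp [onLattice]
    rw [e, form_add_left, ih (by omega) _ hR', form_smul_left,
      h.form_racah_of_ne (by omega) hj (by omega)]
    simp

theorem sqNorm_pos (h : Admissible p α β γ δ M) {j : ℕ} (hj : j ≤ M) :
    0 < sqNorm p α β γ δ M j := by
  unfold sqNorm form
  have h0 : ∀ y ∈ Finset.range (M + 1), 0 ≤ weight p α β γ δ y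
      * onLattice p γ δ (racah p α β γ δ j) y * onLattice p γ δ (racah p α β γ δ j) y := by
    intro y hy
    rw [mul_assoc]
    exact mul_nonneg (h.weight_pos y (by simpa [Nat.lt_succ_iff] using hy)).le (mul_self_nonneg _)
  refine lt_of_le_of_ne (Finset.sum_nonneg h0) fun h1 => ?_
  have h2 := (Finset.sum_eq_zero_iff_of_nonneg h0).1 h1.symm
  refine (racah_monic (p := p) (α := α) (β := β) (γ := γ) (δ := δ) j).ne_zero
    (eq_zero_of_natDegree_lt_card_of_eval_eq_zero _ (f := fun y : Fin (M + 1) =>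
      nu p γ δ ((y : ℕ) : ℝ)) ?_ ?_ ?_)
  · intro x y hxy
    exact Fin.ext (h.injOn (by simpa using Nat.lt_succ_iff.1 x.2)
      (by simpa using Nat.lt_succ_iff.1 y.2) hxy)
  · intro y
    have h3 := h2 y (Finset.mem_range.2 y.2)
    have h4 := (h.weight_pos y (Nat.lt_succ_iff.1 y.2)).ne'
    simpa [h4, onLattice] using h3
  · rw [racah_natDegree]
    simp
    omega

end Admissible

end

end QRacah

namespace QRacah

noncomputable section

/-! ### The three-term recurrence and the orthogonal matrix -/

open Polynomial

theorem eigval_succ_sub {p : ℝ} (hp : 0 < p) (α β : ℝ) (j : ℕ) :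
    eigval p α β (j + 1) - eigval p α β j
      = (1 - p) * (1 - α * β * p ^ (2 * j + 2)) / p ^ (j + 1) := by
  have := hp.ne'
  rw [eigval_sub hp]
  field_simp
  ring

theorem eigval_add_two_sub {p : ℝ} (hp : 0 < p) (α β : ℝ) (j : ℕ) :
    eigval p α β (j + 2) - eigval p α β j
      = (1 - p) * (1 + p) * (1 - α * β * p ^ (2 * j + 3)) / p ^ (j + 2) := by
  have := hp.ne'
  rw [eigval_sub hp]
  field_simp
  ring

theorem expCoeff_succ_self (p α β γ δ : ℝ) (j : ℕ) : expCoeff p α β γ δ (j + 1) j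
    = lowerCoeff p α β γ δ (j + 1) / (eigval p α β (j + 1) - eigval p α β j) := by
  simp [expCoeff]

theorem expCoeff_add_two_self (p α β γ δ : ℝ) (j : ℕ) : expCoeff p α β γ δ (j + 2) j
    = lowerCoeff p α β γ δ (j + 1) / (eigval p α β (j + 2) - eigval p α β j) *
      (lowerCoeff p α β γ δ (j + 2) / (eigval p α β (j + 2) - eigval p α β (j + 1))) := by
  rw [expCoeff, Finset.prod_eq_prod_Ico_succ_bot (by omega)]
  simp

/-- The second coefficients of three consecutive `q`-Racah polynomials determine the diagonal
recurrence coefficient. -/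
theorem recDiag_succ_eq {p α β γ δ : ℝ} (hp : 0 < p) (h1 : p ≠ 1) {j : ℕ}
    (hE2 : 1 - α * β * p ^ (2 * j + 2) ≠ 0) (hE3 : 1 - α * β * p ^ (2 * j + 3) ≠ 0)
    (hE4 : 1 - α * β * p ^ (2 * j + 4) ≠ 0) :
    -expCoeff p α β γ δ (j + 2) (j + 1) + nu p γ δ ((j + 1 : ℕ) : ℝ)
      + expCoeff p α β γ δ (j + 1) j = recDiag p α β γ δ (j + 1) := by
  rw [expCoeff_succ_self p α β γ δ (j + 1), expCoeff_succ_self, eigval_succ_sub hp,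
    eigval_succ_sub hp]
  simp only [nu_natCast hp, lowerCoeff, recDiag, recA, recC]
  have h0 := hp.ne'
  have hq : 1 - p ≠ 0 := sub_ne_zero.2 h1.symm
  rw [show 2 * (j + 1) + 2 = 2 * j + 4 by ring, show 2 * (j + 1) + 1 = 2 * j + 3 by ring,
    show 2 * (j + 1) = 2 * j + 2 by ring, show 2 * (j + 1 + 1) = 2 * j + 4 by ring]
  have e1 : p ^ (j + 1) = p * p ^ j := by ring
  have e2 : p ^ (j + 1 + 1) = p ^ 2 * p ^ j := by ring
  have e3 : p ^ (2 * j + 2) = p ^ 2 * (p ^ j) ^ 2 := by ring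
  have e4 : p ^ (2 * j + 3) = p ^ 3 * (p ^ j) ^ 2 := by ring
  have e5 : p ^ (2 * j + 4) = p ^ 4 * (p ^ j) ^ 2 := by ring
  rw [e3] at hE2
  rw [e4] at hE3
  rw [e5] at hE4
  simp only [e1, e2, e3, e4, e5]
  have hJ : p ^ j ≠ 0 := by positivity
  generalize p ^ j = J at *
  obtain ⟨E2, h2⟩ : ∃ E, E = 1 - α * β * (p ^ 2 * J ^ 2) := ⟨_, rfl⟩
  obtain ⟨E3, h3⟩ : ∃ E, E = 1 - α * β * (p ^ 3 * J ^ 2) := ⟨_, rfl⟩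
  obtain ⟨E4, h4⟩ : ∃ E, E = 1 - α * β * (p ^ 4 * J ^ 2) := ⟨_, rfl⟩
  obtain ⟨r, hr⟩ : ∃ E, E = 1 - p := ⟨_, rfl⟩
  rw [← h2] at hE2 ⊢
  rw [← h3] at hE3 ⊢
  rw [← h4] at hE4 ⊢
  rw [← hr] at hq ⊢
  field_simp
  rw [h2, h3, h4, hr]
  ring

/-- For `j = 0` the coefficient `C_0` is zero, also when its denominator vanishes. -/
theorem recDiag_zero_eq {p α β γ δ : ℝ} (hp : 0 < p) (h1 : p ≠ 1)
    (hE1 : 1 - α * β * p ≠ 0) (hE2 : 1 - α * β * p ^ 2 ≠ 0) :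
    -expCoeff p α β γ δ 1 0 + nu p γ δ ((0 : ℕ) : ℝ) = recDiag p α β γ δ 0 := by
  rw [expCoeff_succ_self p α β γ δ 0, eigval_succ_sub hp]
  simp only [nu_natCast hp, lowerCoeff, recDiag, recA, recC, zero_add, pow_one, pow_zero, mul_zero,
    mul_one]
  have h0 := hp.ne'
  have hq : 1 - p ≠ 0 := sub_ne_zero.2 h1.symm
  simp only [sub_self, mul_zero, zero_mul, zero_div, inv_one, sub_zero]
  generalize 1 - α * β * p = E1 at *
  generalize 1 - α * β * p ^ 2 = E2 at *
  field_simp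
  ring

/-- The rational identity behind the off-diagonal recurrence coefficient. -/
theorem recOff_identity {p α β γ δ : ℝ} (hp : 0 < p) (h1 : p ≠ 1) {j : ℕ}
    (hE1 : 1 - α * β * p ^ (2 * j + 1) ≠ 0)
    (hE2 : 1 - α * β * p ^ (2 * j + 2) ≠ 0) (hE3 : 1 - α * β * p ^ (2 * j + 3) ≠ 0) :
    lowerCoeff p α β γ δ (j + 2) / (eigval p α β (j + 2) - eigval p α β j)
      + lowerCoeff p α β γ δ j * p ^ (j + 1) / ((1 - p) * (1 + p) * (1 - α * β * p ^ (2 * j + 1)))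
      - lowerCoeff p α β γ δ (j + 1) / (eigval p α β (j + 1) - eigval p α β j)
      + nu p γ δ (j : ℝ) - nu p γ δ ((j + 1 : ℕ) : ℝ)
    = p ^ (j + 1) * (1 - p) * (1 - α * β * p ^ (j + 1)) * (1 - β * p ^ (j + 1))
        * (δ - α * p ^ (j + 1)) * (γ - α * β * p ^ (j + 1))
      / ((1 - α * β * p ^ (2 * j + 1)) * (1 - α * β * p ^ (2 * j + 2))
        * (1 - α * β * p ^ (2 * j + 3))) := by
  rw [eigval_add_two_sub hp, eigval_succ_sub hp]
  simp only [nu_natCast hp, lowerCoeff]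
  have h0 := hp.ne'
  have hq : 1 - p ≠ 0 := sub_ne_zero.2 h1.symm
  have hq' : 1 + p ≠ 0 := by positivity
  have e0 : p ^ (2 * j) = (p ^ j) ^ 2 := by ring
  have e1 : p ^ (j + 1) = p * p ^ j := by ring
  have e2 : p ^ (j + 2) = p ^ 2 * p ^ j := by ring
  have e3 : p ^ (2 * j + 1) = p * (p ^ j) ^ 2 := by ring
  have e4 : p ^ (2 * j + 2) = p ^ 2 * (p ^ j) ^ 2 := by ring
  have e5 : p ^ (2 * j + 3) = p ^ 3 * (p ^ j) ^ 2 := by ring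
  have e6 : p ^ (2 * (j + 1)) = p ^ 2 * (p ^ j) ^ 2 := by ring
  have e7 : p ^ (2 * (j + 2)) = p ^ 4 * (p ^ j) ^ 2 := by ring
  rw [e3] at hE1
  rw [e4] at hE2
  rw [e5] at hE3
  simp only [e0, e1, e2, e3, e4, e5, e6, e7]
  have hJ : p ^ j ≠ 0 := by positivity
  generalize p ^ j = J at *
  obtain ⟨E1, h2⟩ : ∃ E, E = 1 - α * β * (p * J ^ 2) := ⟨_, rfl⟩
  obtain ⟨E2, h3⟩ : ∃ E, E = 1 - α * β * (p ^ 2 * J ^ 2) := ⟨_, rfl⟩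
  obtain ⟨E3, h4⟩ : ∃ E, E = 1 - α * β * (p ^ 3 * J ^ 2) := ⟨_, rfl⟩
  obtain ⟨r, hr⟩ : ∃ E, E = 1 - p := ⟨_, rfl⟩
  obtain ⟨s, hs⟩ : ∃ E, E = 1 + p := ⟨_, rfl⟩
  rw [← h2] at hE1 ⊢
  rw [← h3] at hE2 ⊢
  rw [← h4] at hE3 ⊢
  rw [← hr] at hq ⊢
  rw [← hs] at hq' ⊢
  field_simp
  rw [h2, h3, h4, hr, hs]
  ring

namespace Admissible

variable {p α β γ δ : ℝ} {M : ℕ}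

theorem sign_ne (h : Admissible p α β γ δ M) {m : ℕ} (hm : m ≤ 2 * M + 1) :
    1 - α * β * p ^ m ≠ 0 := by
  rcases h.sign with h' | h'
  · exact (h' m hm).ne'
  · exact (h' m hm).ne

theorem form_newton_of_lt (h : Admissible p α β γ δ M) {j k : ℕ} (hj : j ≤ M) (hk : k < j) :
    form p α β γ δ M (onLattice p γ δ (newton p γ δ k))
      (onLattice p γ δ (racah p α β γ δ j)) = 0 :=
  h.form_racah_of_degree_lt hj (by rw [newton_degree]; exact_mod_cast hk)

theorem form_racah_eq_sum (j : ℕ) (g : ℕ → ℝ) :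
    form p α β γ δ M (onLattice p γ δ (racah p α β γ δ j)) g
      = ∑ k ∈ Finset.range (j + 1), expCoeff p α β γ δ j k *
          form p α β γ δ M (onLattice p γ δ (newton p γ δ k)) g := by
  rw [onLattice_racah, form_sum_left]
  simp only [form_smul_left]

theorem form_newton_self (h : Admissible p α β γ δ M) {j : ℕ} (hj : j ≤ M) :
    form p α β γ δ M (onLattice p γ δ (newton p γ δ j))
      (onLattice p γ δ (racah p α β γ δ j)) = sqNorm p α β γ δ M j := by
  unfold sqNorm
  rw [form_racah_eq_sum j, Finset.sum_range_succ, Finset.sum_eq_zero]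
  · simp [expCoeff]
  · intro k hk
    rw [h.form_newton_of_lt hj (Finset.mem_range.1 hk), mul_zero]

theorem form_newton_succ (h : Admissible p α β γ δ M) {j : ℕ} (hj : j + 1 ≤ M) :
    form p α β γ δ M (onLattice p γ δ (newton p γ δ (j + 1)))
      (onLattice p γ δ (racah p α β γ δ j))
      = -expCoeff p α β γ δ (j + 1) j * sqNorm p α β γ δ M j := by
  have h1 := h.form_racah_of_ne hj (show j ≤ M by omega) (by omega)
  rw [form_racah_eq_sum, Finset.sum_range_succ, Finset.sum_range_succ,
    Finset.sum_eq_zero, h.form_newton_self (by omega)] at h1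
  · simp [expCoeff] at h1 ⊢
    linarith
  · intro k hk
    rw [h.form_newton_of_lt (by omega) (Finset.mem_range.1 hk), mul_zero]

theorem form_newton_add_two (h : Admissible p α β γ δ M) {j : ℕ} (hj : j + 2 ≤ M) :
    form p α β γ δ M (onLattice p γ δ (newton p γ δ (j + 2)))
      (onLattice p γ δ (racah p α β γ δ j))
      = (expCoeff p α β γ δ (j + 2) (j + 1) * expCoeff p α β γ δ (j + 1) j
          - expCoeff p α β γ δ (j + 2) j) * sqNorm p α β γ δ M j := by
  have h1 := h.form_racah_of_ne hj (show j ≤ M by omega) (by omega)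
  rw [form_racah_eq_sum, Finset.sum_range_succ, Finset.sum_range_succ, Finset.sum_range_succ,
    Finset.sum_eq_zero, h.form_newton_self (by omega), h.form_newton_succ (by omega),
    show expCoeff p α β γ δ (j + 2) (j + 2) = 1 by simp [expCoeff]] at h1
  · linarith
  · intro k hk
    rw [h.form_newton_of_lt (by omega) (Finset.mem_range.1 hk), mul_zero]

/-- Multiplication by `ν` is bidiagonal on Newton polynomials. -/
theorem form_nu_mul_racah (j : ℕ) (g : ℕ → ℝ) :
    form p α β γ δ M (fun y => nu p γ δ (y : ℝ) * onLattice p γ δ (racah p α β γ δ j) y) g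
      = ∑ k ∈ Finset.range (j + 1), expCoeff p α β γ δ j k *
          (form p α β γ δ M (onLattice p γ δ (newton p γ δ (k + 1))) g
            + nu p γ δ (k : ℝ) * form p α β γ δ M (onLattice p γ δ (newton p γ δ k)) g) := by
  have e : (fun y : ℕ => nu p γ δ (y : ℝ) * onLattice p γ δ (racah p α β γ δ j) y)
      = fun y => ∑ k ∈ Finset.range (j + 1), expCoeff p α β γ δ j k *
        (onLattice p γ δ (newton p γ δ (k + 1)) y
          + nu p γ δ (k : ℝ) * onLattice p γ δ (newton p γ δ k) y) := by
    ext y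
    rw [onLattice_racah, Finset.mul_sum]
    refine Finset.sum_congr rfl fun k _ => ?_
    simp only [onLattice, eval_newton_succ]
    ring
  rw [e, form_sum_left]
  refine Finset.sum_congr rfl fun k _ => ?_
  rw [form_smul_left, form_add_left, form_smul_left]

theorem form_nu_mul_self (h : Admissible p α β γ δ M) {j : ℕ} (hj : j + 1 ≤ M) :
    form p α β γ δ M (fun y => nu p γ δ (y : ℝ) * onLattice p γ δ (racah p α β γ δ j) y)
      (onLattice p γ δ (racah p α β γ δ j)) = recDiag p α β γ δ j * sqNorm p α β γ δ M j := by
  have hd : expCoeff p α β γ δ j j = 1 := by simp [expCoeff]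
  rw [form_nu_mul_racah, Finset.sum_range_succ, h.form_newton_succ hj,
    h.form_newton_self (by omega), hd]
  rcases j with _ | j
  · rw [← recDiag_zero_eq h.pos h.ne_one (by simpa using h.sign_ne (m := 1) (by omega))
      (h.sign_ne (by omega))]
    simp
    ring
  · rw [← recDiag_succ_eq h.pos h.ne_one (h.sign_ne (by omega)) (h.sign_ne (by omega))
      (h.sign_ne (by omega)), Finset.sum_range_succ, Finset.sum_eq_zero,
      h.form_newton_self (by omega), h.form_newton_of_lt (by omega) (by omega)]
    · ring
    · intro k hk
      have := Finset.mem_range.1 hk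
      rw [h.form_newton_of_lt (by omega) (by omega), h.form_newton_of_lt (by omega) (by omega)]
      simp

theorem form_nu_mul_succ (h : Admissible p α β γ δ M) {j : ℕ} (hj : j + 2 ≤ M) :
    form p α β γ δ M (fun y => nu p γ δ (y : ℝ) * onLattice p γ δ (racah p α β γ δ (j + 1)) y)
      (onLattice p γ δ (racah p α β γ δ j))
      = recA p α β γ δ j * recC p α β γ δ (j + 1) * sqNorm p α β γ δ M j := by
  have hd : expCoeff p α β γ δ (j + 1) (j + 1) = 1 := by simp [expCoeff]
  have hp := h.pos
  have h0 := hp.ne'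
  have hE1 := h.sign_ne (m := 2 * j + 1) (by omega)
  have hE2 := h.sign_ne (m := 2 * j + 2) (by omega)
  have hE3 := h.sign_ne (m := 2 * j + 3) (by omega)
  have hq : 1 - p ≠ 0 := sub_ne_zero.2 h.ne_one.symm
  have hq' : 1 + p ≠ 0 := by positivity
  have hl1 := h.eigval_ne (j := j + 1) (k := j) (by omega) (by omega) (by omega)
  have hl2 := h.eigval_ne (j := j + 2) (k := j + 1) (by omega) (by omega) (by omega)
  have hl3 := h.eigval_ne (j := j + 2) (k := j) (by omega) (by omega) (by omega)
  -- the contribution of the Newton polynomial of degree `j - 1`, absent for `j = 0`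
  have hlow : ∑ k ∈ Finset.range j, expCoeff p α β γ δ (j + 1) k *
      (form p α β γ δ M (onLattice p γ δ (newton p γ δ (k + 1)))
          (onLattice p γ δ (racah p α β γ δ j))
        + nu p γ δ (k : ℝ) * form p α β γ δ M (onLattice p γ δ (newton p γ δ k))
          (onLattice p γ δ (racah p α β γ δ j)))
      = expCoeff p α β γ δ (j + 1) j * (lowerCoeff p α β γ δ j * p ^ (j + 1)
        / ((1 - p) * (1 + p) * (1 - α * β * p ^ (2 * j + 1)))) * sqNorm p α β γ δ M j := by
    rcases j with _ | j
    · simp [lowerCoeff]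
    · rw [Finset.sum_range_succ, Finset.sum_eq_zero, h.form_newton_self (by omega),
        h.form_newton_of_lt (by omega) (by omega), expCoeff_add_two_self, expCoeff_succ_self,
        eigval_add_two_sub hp]
      · rw [show 2 * (j + 1) + 1 = 2 * j + 3 by ring] at hE1 ⊢
        generalize 1 - α * β * p ^ (2 * j + 3) = z at *
        have e : p ^ (j + 1 + 1) = p ^ (j + 2) := by ring
        rw [e]
        field_simp
        ring
      · intro k hk
        have := Finset.mem_range.1 hk
        rw [h.form_newton_of_lt (by omega) (by omega), h.form_newton_of_lt (by omega) (by omega)]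
        simp
  rw [form_nu_mul_racah, Finset.sum_range_succ, Finset.sum_range_succ, hlow, hd,
    h.form_newton_add_two hj, h.form_newton_succ (by omega), h.form_newton_self (by omega)]
  have key := recOff_identity (α := α) (β := β) (γ := γ) (δ := δ) hp h.ne_one hE1 hE2 hE3
  have hsum : expCoeff p α β γ δ (j + 2) (j + 1) * expCoeff p α β γ δ (j + 1) j
          - expCoeff p α β γ δ (j + 2) j = expCoeff p α β γ δ (j + 1) j *
        (lowerCoeff p α β γ δ (j + 2) / (eigval p α β (j + 2) - eigval p α β j)) := by
    rw [expCoeff_succ_self, expCoeff_succ_self, expCoeff_add_two_self]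
    have e : eigval p α β (j + 1) - eigval p α β j = (eigval p α β (j + 2) - eigval p α β j)
        - (eigval p α β (j + 2) - eigval p α β (j + 1)) := by ring
    rw [show j + 1 + 1 = j + 2 by ring]
    rw [e] at hl1 ⊢
    generalize eigval p α β (j + 2) - eigval p α β j = u at *
    generalize eigval p α β (j + 2) - eigval p α β (j + 1) = v at *
    field_simp
    ring
  have hrec : recA p α β γ δ j * recC p α β γ δ (j + 1) = expCoeff p α β γ δ (j + 1) j *
      (p ^ (j + 1) * (1 - p) * (1 - α * β * p ^ (j + 1)) * (1 - β * p ^ (j + 1))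
        * (δ - α * p ^ (j + 1)) * (γ - α * β * p ^ (j + 1))
      / ((1 - α * β * p ^ (2 * j + 1)) * (1 - α * β * p ^ (2 * j + 2))
        * (1 - α * β * p ^ (2 * j + 3)))) := by
    rw [expCoeff_succ_self, eigval_succ_sub hp]
    simp only [recA, recC, lowerCoeff]
    rw [show 2 * (j + 1) + 1 = 2 * j + 3 by ring, show 2 * (j + 1) = 2 * j + 2 by ring]
    have e3 : p ^ (2 * j + 2) = (p ^ (j + 1)) ^ 2 := by ring
    generalize 1 - α * β * p ^ (2 * j + 2) = z1 at *
    generalize 1 - α * β * p ^ (2 * j + 1) = z2 at *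
    generalize 1 - α * β * p ^ (2 * j + 3) = z3 at *
    rw [e3]
    have : p ^ (j + 1) ≠ 0 := by positivity
    generalize p ^ (j + 1) = J at *
    field_simp
  rw [← expCoeff_succ_self] at key
  rw [hsum, hrec, ← key]
  ring

/-- The same matrix element computed from the leading coefficients. -/
theorem form_nu_mul_succ' (h : Admissible p α β γ δ M) {j : ℕ} (hj : j + 1 ≤ M) :
    form p α β γ δ M (fun y => nu p γ δ (y : ℝ) * onLattice p γ δ (racah p α β γ δ (j + 1)) y)
      (onLattice p γ δ (racah p α β γ δ j)) = sqNorm p α β γ δ M (j + 1) := by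
  have e1 : form p α β γ δ M
      (fun y => nu p γ δ (y : ℝ) * onLattice p γ δ (racah p α β γ δ (j + 1)) y)
      (onLattice p γ δ (racah p α β γ δ j))
      = form p α β γ δ M (onLattice p γ δ (X * racah p α β γ δ j))
        (onLattice p γ δ (racah p α β γ δ (j + 1))) := by
    refine Finset.sum_congr rfl fun y _ => ?_
    simp [onLattice]
    ring
  have e2 : onLattice p γ δ (X * racah p α β γ δ j)
      = fun y => onLattice p γ δ (X * racah p α β γ δ j - racah p α β γ δ (j + 1)) y
        + onLattice p γ δ (racah p α β γ δ (j + 1)) y := by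
    ext y
    simp [onLattice]
  have hm : (X * racah p α β γ δ j).Monic := monic_X.mul (racah_monic j)
  have hd : (X * racah p α β γ δ j).degree = ((j + 1 : ℕ) : WithBot ℕ) := by
    rw [degree_eq_natDegree hm.ne_zero, monic_X.natDegree_mul (racah_monic j), natDegree_X,
      racah_natDegree, add_comm]
  have hd' : (racah p α β γ δ (j + 1)).degree = ((j + 1 : ℕ) : WithBot ℕ) := by
    rw [degree_eq_natDegree (racah_monic (j + 1)).ne_zero, racah_natDegree]
  rw [e1, e2, form_add_left, h.form_racah_of_degree_lt hj, zero_add, sqNorm]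
  rw [← hd]
  refine degree_sub_lt_left (by rw [hd, hd']) hm.ne_zero ?_
  rw [hm.leadingCoeff, (racah_monic _).leadingCoeff]

/-- The two evaluations of the off-diagonal matrix element of `ν`, compared. -/
theorem recA_mul_recC (h : Admissible p α β γ δ M) {j : ℕ} (hj : j + 2 ≤ M) :
    recA p α β γ δ j * recC p α β γ δ (j + 1)
      = sqNorm p α β γ δ M (j + 1) / sqNorm p α β γ δ M j := by
  have h1 := h.form_nu_mul_succ hj
  rw [h.form_nu_mul_succ' (by omega)] at h1
  rw [h1]
  have := (h.sqNorm_pos (j := j) (by omega)).ne'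
  field_simp

theorem recA_mul_recC_pos (h : Admissible p α β γ δ M) {j : ℕ} (hj : j + 2 ≤ M) :
    0 < recA p α β γ δ j * recC p α β γ δ (j + 1) := by
  rw [h.recA_mul_recC hj]
  exact div_pos (h.sqNorm_pos (by omega)) (h.sqNorm_pos (by omega))

theorem diffUp_mul_diffDown_nonneg (h : Admissible p α β γ δ M) {y : ℕ} (hy : y < M) :
    0 ≤ diffUp p α β γ δ y * diffDown p α β γ δ (y + 1) := by
  have h1 := h.weight_mul_diffUp hy
  have h2 := h.weight_pos y hy.le
  have h3 := h.weight_pos (y + 1) hy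
  have h4 : diffUp p α β γ δ y = weight p α β γ δ (y + 1) / weight p α β γ δ y
      * diffDown p α β γ δ (y + 1) := by
    field_simp
    linarith
  rw [h4, mul_assoc]
  exact mul_nonneg (div_pos h3 h2).le (mul_self_nonneg _)

end Admissible

/-- The matrix whose rows are the orthonormal `q`-Racah functions
`√(w(y)) P_j(ν(y)) / ‖P_j‖`. -/
def orthoMat (p α β γ δ : ℝ) (M : ℕ) : Matrix (Fin (M + 1)) (Fin (M + 1)) ℝ :=
  Matrix.of fun j y => Real.sqrt (weight p α β γ δ y)
    * onLattice p γ δ (racah p α β γ δ j) y / Real.sqrt (sqNorm p α β γ δ M j)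

namespace Admissible

variable {p α β γ δ : ℝ} {M : ℕ}

/-- Sums over rows of `orthoMat` are values of the bilinear form. -/
theorem sum_orthoMat (h : Admissible p α β γ δ M) (g : ℕ → ℝ) (i j : Fin (M + 1)) :
    ∑ y : Fin (M + 1), orthoMat p α β γ δ M i y * g y * orthoMat p α β γ δ M j y
      = form p α β γ δ M (fun y => g y * onLattice p γ δ (racah p α β γ δ i) y)
          (onLattice p γ δ (racah p α β γ δ j))
        / (Real.sqrt (sqNorm p α β γ δ M i) * Real.sqrt (sqNorm p α β γ δ M j)) := by
  rw [form, Finset.sum_range, Finset.sum_div]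
  refine Finset.sum_congr rfl fun y _ => ?_
  have h1 := Real.mul_self_sqrt (h.weight_pos y (Nat.lt_succ_iff.1 y.2)).le
  simp only [orthoMat, Matrix.of_apply]
  nth_rewrite 3 [← h1]
  ring

theorem sqrt_sqNorm_pos (h : Admissible p α β γ δ M) (i : Fin (M + 1)) :
    0 < Real.sqrt (sqNorm p α β γ δ M i) :=
  Real.sqrt_pos.2 (h.sqNorm_pos (Nat.lt_succ_iff.1 i.2))

theorem orthoMat_mul_transpose (h : Admissible p α β γ δ M) :
    orthoMat p α β γ δ M * (orthoMat p α β γ δ M).transpose = 1 := by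
  ext i j
  have h1 := h.sum_orthoMat (fun _ => 1) i j
  simp only [mul_one, one_mul] at h1
  rw [Matrix.mul_apply]
  simp only [Matrix.transpose_apply]
  rw [h1]
  rcases eq_or_ne i j with rfl | hij
  · rw [Matrix.one_apply_eq, Real.mul_self_sqrt (h.sqNorm_pos (Nat.lt_succ_iff.1 i.2)).le]
    exact div_self (h.sqNorm_pos (Nat.lt_succ_iff.1 i.2)).ne'
  · rw [Matrix.one_apply_ne hij]
    have := h.form_racah_of_ne (Nat.lt_succ_iff.1 i.2) (Nat.lt_succ_iff.1 j.2)
      (fun h => hij (Fin.ext h))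
    change form p α β γ δ M (onLattice p γ δ (racah p α β γ δ i)) _ / _ = 0
    rw [this, zero_div]

theorem transpose_mul_orthoMat (h : Admissible p α β γ δ M) :
    (orthoMat p α β γ δ M).transpose * orthoMat p α β γ δ M = 1 :=
  mul_eq_one_comm.1 h.orthoMat_mul_transpose

/-- Multiplication by `ν^m` raises the degree by `m` only, so the matrix of `ν^m` is banded. -/
theorem sum_pow_eq_zero (h : Admissible p α β γ δ M) {m : ℕ} {i j : Fin (M + 1)}
    (hij : (i : ℕ) + m < j) :
    ∑ y : Fin (M + 1), orthoMat p α β γ δ M i y * nu p γ δ ((y : ℕ) : ℝ) ^ m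
      * orthoMat p α β γ δ M j y = 0 := by
  rw [h.sum_orthoMat (fun y => nu p γ δ (y : ℝ) ^ m)]
  have e : (fun y : ℕ => nu p γ δ (y : ℝ) ^ m * onLattice p γ δ (racah p α β γ δ i) y)
      = onLattice p γ δ (X ^ m * racah p α β γ δ i) := by
    ext y
    simp [onLattice]
  rw [e, h.form_racah_of_degree_lt (Nat.lt_succ_iff.1 j.2), zero_div]
  rw [degree_eq_natDegree ((monic_X_pow m).mul (racah_monic _)).ne_zero,
    (monic_X_pow m).natDegree_mul (racah_monic _), natDegree_X_pow, racah_natDegree]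
  exact_mod_cast (by omega : m + (i : ℕ) < j)

theorem sum_nu_self (h : Admissible p α β γ δ M) {j : Fin (M + 1)} (hj : (j : ℕ) + 1 ≤ M) :
    ∑ y : Fin (M + 1), orthoMat p α β γ δ M j y * nu p γ δ ((y : ℕ) : ℝ)
      * orthoMat p α β γ δ M j y = recDiag p α β γ δ j := by
  rw [h.sum_orthoMat (fun y => nu p γ δ (y : ℝ)), h.form_nu_mul_self hj,
    Real.mul_self_sqrt (h.sqNorm_pos (Nat.lt_succ_iff.1 j.2)).le]
  exact mul_div_cancel_right₀ _ (h.sqNorm_pos (Nat.lt_succ_iff.1 j.2)).ne'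

theorem sum_nu_succ (h : Admissible p α β γ δ M) {i j : Fin (M + 1)} (hij : (i : ℕ) = j + 1)
    (hj : (j : ℕ) + 2 ≤ M) :
    ∑ y : Fin (M + 1), orthoMat p α β γ δ M i y * nu p γ δ ((y : ℕ) : ℝ)
      * orthoMat p α β γ δ M j y = recOff p α β γ δ j := by
  have hi := h.sqrt_sqNorm_pos i
  have hj' := h.sqrt_sqNorm_pos j
  have hs := Real.mul_self_sqrt (h.sqNorm_pos (Nat.lt_succ_iff.1 i.2)).le
  rw [h.sum_orthoMat (fun y => nu p γ δ (y : ℝ)), recOff, h.recA_mul_recC hj, ← hij,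
    Real.sqrt_div (h.sqNorm_pos (Nat.lt_succ_iff.1 i.2)).le]
  rw [hij] at hs hi ⊢
  rw [h.form_nu_mul_succ' (by omega)]
  nth_rewrite 1 [← hs]
  field_simp

/-- The diagonal entry of the difference operator is an average of its eigenvalues. -/
theorem sum_eigval (h : Admissible p α β γ δ M) (y : Fin (M + 1)) :
    ∑ j : Fin (M + 1), eigval p α β j * orthoMat p α β γ δ M j y ^ 2
      = -(diffUp p α β γ δ y + diffDown p α β γ δ y) := by
  have hw : ∀ y : Fin (M + 1), 0 < Real.sqrt (weight p α β γ δ y) := fun y =>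
    Real.sqrt_pos.2 (h.weight_pos y (Nat.lt_succ_iff.1 y.2))
  set Φ : Fin (M + 1) → ℕ → ℝ := fun j z =>
    onLattice p γ δ (racah p α β γ δ j) z / Real.sqrt (sqNorm p α β γ δ M j) with hΦ
  have hU : ∀ j z : Fin (M + 1), orthoMat p α β γ δ M j z
      = Real.sqrt (weight p α β γ δ z) * Φ j z := fun j z => by
    simp [orthoMat, hΦ, mul_div_assoc]
  have horth : ∀ z : Fin (M + 1), z ≠ y → ∑ j, Φ j z * Φ j y = 0 := by
    intro z hz
    have h1 := congrFun (congrFun h.transpose_mul_orthoMat z) y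
    rw [Matrix.mul_apply, Matrix.one_apply_ne hz] at h1
    simp only [Matrix.transpose_apply, hU] at h1
    have h2 : ∑ j, Real.sqrt (weight p α β γ δ z) * Φ j z
        * (Real.sqrt (weight p α β γ δ y) * Φ j y)
        = Real.sqrt (weight p α β γ δ z) * Real.sqrt (weight p α β γ δ y)
          * ∑ j, Φ j z * Φ j y := by
      rw [Finset.mul_sum]
      exact Finset.sum_congr rfl fun _ _ => by ring
    rw [h2] at h1
    have := hw z
    have := hw y
    simpa [(hw z).ne', (hw y).ne'] using h1
  have hnorm : ∑ j, orthoMat p α β γ δ M j y ^ 2 = 1 := by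
    have h1 := congrFun (congrFun h.transpose_mul_orthoMat y) y
    rw [Matrix.mul_apply, Matrix.one_apply_eq] at h1
    rw [← h1]
    exact Finset.sum_congr rfl fun _ _ => by simp [sq]
  have hterm : ∀ j : Fin (M + 1), eigval p α β j * orthoMat p α β γ δ M j y ^ 2
      = weight p α β γ δ y * diffUp p α β γ δ y * (Φ j (y + 1) * Φ j y)
        + weight p α β γ δ y * diffDown p α β γ δ y * (Φ j (y - 1) * Φ j y)
        - (diffUp p α β γ δ y + diffDown p α β γ δ y) * orthoMat p α β γ δ M j y ^ 2 := by
    intro j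
    have h1 := h.diffOp_racah (Nat.lt_succ_iff.1 j.2) (Nat.lt_succ_iff.1 y.2)
    have h2 : diffUp p α β γ δ y * (Φ j (y + 1) - Φ j y)
        + diffDown p α β γ δ y * (Φ j (y - 1) - Φ j y) = eigval p α β j * Φ j y := by
      simp only [hΦ]
      rw [← mul_div_assoc, ← h1, diffOp]
      ring
    rw [hU, mul_pow, Real.sq_sqrt (h.weight_pos y (Nat.lt_succ_iff.1 y.2)).le]
    linear_combination -weight p α β γ δ y * Φ j y * h2
  simp only [hterm]
  rw [Finset.sum_sub_distrib, Finset.sum_add_distrib, ← Finset.mul_sum, ← Finset.mul_sum,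
    ← Finset.mul_sum, hnorm]
  have hup : diffUp p α β γ δ y * ∑ j, Φ j (y + 1) * Φ j y = 0 := by
    rcases (Nat.lt_succ_iff.1 y.2).lt_or_eq with hy | hy
    · have := horth ⟨y + 1, by omega⟩ (by simp [Fin.ext_iff])
      simp only at this
      rw [this, mul_zero]
    · rw [hy, h.diffUp_top, zero_mul]
  have hdown : diffDown p α β γ δ y * ∑ j, Φ j (y - 1) * Φ j y = 0 := by
    rcases Nat.eq_zero_or_pos (y : ℕ) with hy | hy
    · rw [hy]
      simp [diffDown]
    · have := horth ⟨y - 1, by omega⟩ (by simp [Fin.ext_iff]; omega)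
      simp only at this
      rw [this, mul_zero]
  rw [mul_assoc, hup, mul_assoc, hdown]
  ring

end Admissible

end

end QRacah

namespace QRacah

noncomputable section

/-! ### Sums of squared minors -/

section Determinantal

open Matrix

variable {ι κ : Type*} [Fintype ι] [DecidableEq ι] [Fintype κ] [DecidableEq κ]

theorem det_mul_diagonal_mul_transpose {R : Type*} [CommRing R] (V : Matrix ι κ R) (h : κ → R) :
    (V * diagonal h * Vᵀ).det
      = ∑ y : ι → κ, (∏ i, h (y i)) * (∏ i, V i (y i)) * (V.submatrix id y).det := by
  have hentry : ∀ a b, (V * diagonal h * Vᵀ) a b = ∑ z, V a z * h z * V b z := by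
    intro a b
    rw [Matrix.mul_apply]
    simp only [Matrix.mul_diagonal, Matrix.transpose_apply]
  rw [det_apply']
  simp only [hentry, Finset.prod_univ_sum, Fintype.piFinset_univ, Finset.mul_sum]
  rw [Finset.sum_comm]
  refine Finset.sum_congr rfl fun y _ => ?_
  rw [det_apply', Finset.mul_sum]
  refine Finset.sum_congr rfl fun σ _ => ?_
  simp only [submatrix_apply, id, Finset.prod_mul_distrib]
  ring

/-- The **Andréief identity** for a biorthogonal sum with equal factors. -/
theorem sum_det_sq_mul_prod {R : Type*} [CommRing R] (V : Matrix ι κ R) (h : κ → R) :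
    ∑ y : ι → κ, (V.submatrix id y).det ^ 2 * ∏ i, h (y i)
      = (Fintype.card ι).factorial * (V * diagonal h * Vᵀ).det := by
  have h1 : ∀ τ : Equiv.Perm ι, (V * diagonal h * Vᵀ).det = ∑ y : ι → κ, (∏ i, h (y i)) *
      ((Equiv.Perm.sign τ : ℤ) * ∏ i, V i (y (τ i))) * (V.submatrix id y).det := by
    intro τ
    rw [det_mul_diagonal_mul_transpose,
      ← (Equiv.arrowCongr τ.symm (Equiv.refl κ)).sum_comp]
    refine Finset.sum_congr rfl fun y _ => ?_
    have e1 : ∏ i, h (y (τ i)) = ∏ i, h (y i) := Equiv.prod_comp τ fun i => h (y i)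
    have e2 : (V.submatrix id fun i => y (τ i)).det
        = (Equiv.Perm.sign τ : ℤ) * (V.submatrix id y).det := by
      rw [← det_permute']
      rfl
    have e3 : Equiv.arrowCongr τ.symm (Equiv.refl κ) y = fun i => y (τ i) := rfl
    simp only [e3, e1, e2]
    ring
  have h2 : ((Fintype.card ι).factorial : R) * (V * diagonal h * Vᵀ).det
      = ∑ τ : Equiv.Perm ι, (V * diagonal h * Vᵀ).det := by
    rw [Finset.sum_const, Finset.card_univ, Fintype.card_perm, nsmul_eq_mul]
  rw [h2, Finset.sum_congr rfl fun τ _ => h1 τ, Finset.sum_comm]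
  refine Finset.sum_congr rfl fun y _ => ?_
  rw [← Finset.sum_mul, ← Finset.mul_sum]
  have e4 : ∑ τ : Equiv.Perm ι, ((Equiv.Perm.sign τ : ℤ) : R) * ∏ i, V i (y (τ i))
      = (V.submatrix id y).det := by
    rw [← det_transpose, det_apply']
    simp
  rw [e4]
  ring

open Polynomial in
/-- The first elementary symmetric functions in terms of power sums. -/
theorem coeff_prod_one_add {ι : Type*} [DecidableEq ι] (s : Finset ι) (c : ι → ℝ) :
    (∏ i ∈ s, (1 + C (c i) * X : ℝ[X])).coeff 0 = 1 ∧
    (∏ i ∈ s, (1 + C (c i) * X : ℝ[X])).coeff 1 = ∑ i ∈ s, c i ∧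
    2 * (∏ i ∈ s, (1 + C (c i) * X : ℝ[X])).coeff 2 = (∑ i ∈ s, c i) ^ 2 - ∑ i ∈ s, c i ^ 2 := by
  induction s using Finset.induction_on with
  | empty => simp [coeff_one]
  | insert a s ha ih =>
    obtain ⟨h0, h1, h2⟩ := ih
    rw [Finset.prod_insert ha, Finset.sum_insert ha, Finset.sum_insert ha]
    have e : (1 + C (c a) * X) * ∏ i ∈ s, (1 + C (c i) * X : ℝ[X])
        = (∏ i ∈ s, (1 + C (c i) * X : ℝ[X])) + C (c a) * (X * ∏ i ∈ s, (1 + C (c i) * X)) := by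
      ring
    rw [e]
    simp only [coeff_add, coeff_C_mul]
    refine ⟨by simp [h0], ?_, ?_⟩
    · rw [show (1 : ℕ) = 0 + 1 from rfl, coeff_X_mul, zero_add, h0, h1]
      ring
    · rw [show (2 : ℕ) = 1 + 1 from rfl, coeff_X_mul, h1]
      linear_combination h2

open Polynomial in
/-- The first two elementary symmetric functions of the eigenvalues of a symmetric matrix. -/
theorem exists_eigenvalues {G : Matrix ι ι ℝ} (hG : G.IsHermitian) : ∃ c : ι → ℝ,
    (∀ t : ℝ, (1 + t • G).det = ∏ i, (1 + c i * t)) ∧ G.trace = ∑ i, c i ∧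
      (G * G).trace = ∑ i, c i ^ 2 := by
  set U : Matrix ι ι ℝ := (hG.eigenvectorUnitary : Matrix ι ι ℝ)
  set Λ : Matrix ι ι ℝ := diagonal hG.eigenvalues with hΛ
  have hUU : star U * U = 1 := Unitary.coe_star_mul_self hG.eigenvectorUnitary
  have hUU' : U * star U = 1 := Unitary.coe_mul_star_self hG.eigenvectorUnitary
  have hs : G = U * Λ * star U := by
    have := hG.spectral_theorem
    rw [Unitary.conjStarAlgAut_apply] at this
    exact this
  refine ⟨hG.eigenvalues, fun t => ?_, ?_, ?_⟩
  · have e : 1 + t • G = U * (1 + t • Λ) * star U := by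
      rw [mul_add, add_mul, mul_one, hUU', Matrix.mul_smul, Matrix.smul_mul, ← hs]
    have e2 : 1 + t • Λ = diagonal fun i => 1 + hG.eigenvalues i * t := by
      ext i j
      rcases eq_or_ne i j with rfl | hij
      · simp [hΛ, mul_comm]
      · simp [hΛ, hij]
    rw [e, det_mul_right_comm, hUU', one_mul, e2, det_diagonal]
  · conv_lhs => rw [hs]
    rw [trace_mul_cycle, hUU, one_mul, hΛ, trace_diagonal]
  · have e : G * G = U * (Λ * Λ) * star U := by
      calc G * G = U * Λ * (star U * U) * Λ * star U := by
            conv_lhs => rw [hs]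
            simp only [mul_assoc]
        _ = _ := by rw [hUU]; simp only [mul_assoc, mul_one]
    rw [e, trace_mul_cycle, hUU, one_mul, hΛ, diagonal_mul_diagonal, trace_diagonal]
    simp [sq]

open Polynomial in
/-- Total mass, mean and second factorial moment of a linear statistic of a determinantal ensemble,
read off from the coefficients in `t` of the Andréief identity for `1 + t g`. -/
theorem sum_det_sq_mul_symm {V : Matrix ι κ ℝ} (hV : V * Vᵀ = 1) (g : κ → ℝ) :
    ∑ y : ι → κ, (V.submatrix id y).det ^ 2 = (Fintype.card ι).factorial ∧
    ∑ y : ι → κ, (V.submatrix id y).det ^ 2 * ∑ i, g (y i)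
      = (Fintype.card ι).factorial * (V * diagonal g * Vᵀ).trace ∧
    ∑ y : ι → κ, (V.submatrix id y).det ^ 2 * ((∑ i, g (y i)) ^ 2 - ∑ i, g (y i) ^ 2)
      = (Fintype.card ι).factorial * ((V * diagonal g * Vᵀ).trace ^ 2
        - ((V * diagonal g * Vᵀ) * (V * diagonal g * Vᵀ)).trace) := by
  have hG : (V * diagonal g * Vᵀ).IsHermitian := by
    rw [IsHermitian, conjTranspose_eq_transpose_of_trivial]
    simp [transpose_mul, Matrix.mul_assoc]
  obtain ⟨c, hc1, hc2, hc3⟩ := exists_eigenvalues hG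
  have key : ∑ y : ι → κ, C ((V.submatrix id y).det ^ 2) * ∏ i, (1 + C (g (y i)) * X)
      = C ((Fintype.card ι).factorial : ℝ) * ∏ i, (1 + C (c i) * X) := by
    refine Polynomial.funext fun t => ?_
    simp only [eval_finsetSum, eval_mul, eval_C, eval_prod, eval_add, eval_one, eval_X]
    rw [← hc1, sum_det_sq_mul_prod V fun z => 1 + g z * t]
    congr 2
    have e : (diagonal fun z => 1 + g z * t) = 1 + t • diagonal g := by
      ext i j
      rcases eq_or_ne i j with rfl | hij
      · simp [mul_comm]
      · simp [hij]
    rw [e, Matrix.mul_add, Matrix.add_mul, Matrix.mul_one, hV, Matrix.mul_smul, Matrix.smul_mul]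
  have hk : ∀ k : ℕ, ∑ y : ι → κ, (V.submatrix id y).det ^ 2
        * (∏ i, (1 + C (g (y i)) * X : ℝ[X])).coeff k
      = (Fintype.card ι).factorial * (∏ i, (1 + C (c i) * X : ℝ[X])).coeff k := by
    intro k
    have := congrArg (fun P : ℝ[X] => P.coeff k) key
    simpa only [finsetSum_coeff, coeff_C_mul] using this
  refine ⟨?_, ?_, ?_⟩
  · have := hk 0
    simpa only [(coeff_prod_one_add _ _).1, mul_one] using this
  · have := hk 1
    rw [(coeff_prod_one_add _ _).2.1, ← hc2] at this
    simpa only [(coeff_prod_one_add _ _).2.1] using this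
  · have := congrArg (fun x => 2 * x) (hk 2)
    simp only [Finset.mul_sum] at this
    rw [mul_left_comm, (coeff_prod_one_add _ _).2.2, ← hc2, ← hc3] at this
    simp only [mul_left_comm (2 : ℝ), (coeff_prod_one_add _ _).2.2] at this
    exact this

/-- The variance of a linear statistic of a determinantal ensemble. -/
theorem sum_det_sq_mul_sq_sub {V : Matrix ι κ ℝ} (hV : V * Vᵀ = 1) (g : κ → ℝ) :
    ∑ y : ι → κ, (V.submatrix id y).det ^ 2
        * (∑ i, g (y i) - (V * diagonal g * Vᵀ).trace) ^ 2
      = (Fintype.card ι).factorial * ((V * diagonal (fun z => g z ^ 2) * Vᵀ).trace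
        - ((V * diagonal g * Vᵀ) * (V * diagonal g * Vᵀ)).trace) := by
  obtain ⟨h0, h1, h2⟩ := sum_det_sq_mul_symm hV g
  obtain ⟨-, h3, -⟩ := sum_det_sq_mul_symm hV fun z => g z ^ 2
  set m := (V * diagonal g * Vᵀ).trace
  have e : ∀ y : ι → κ, (V.submatrix id y).det ^ 2 * (∑ i, g (y i) - m) ^ 2
      = (V.submatrix id y).det ^ 2 * ((∑ i, g (y i)) ^ 2 - ∑ i, g (y i) ^ 2)
        + (V.submatrix id y).det ^ 2 * ∑ i, g (y i) ^ 2
        - 2 * m * ((V.submatrix id y).det ^ 2 * ∑ i, g (y i))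
        + m ^ 2 * (V.submatrix id y).det ^ 2 := fun y => by ring
  simp only [e, Finset.sum_add_distrib, Finset.sum_sub_distrib, ← Finset.mul_sum]
  rw [h0, h1, h2, h3]
  ring

end Determinantal

end

end QRacah

namespace QRacah

noncomputable section

/-! ### Matrix elements of powers of `ν` -/

open Matrix Polynomial

/-- The entry `(i, j)` of the `m`-th power of the Jacobi matrix, as the integral of `ν^m` against
two orthonormal functions. -/
def moment (p α β γ δ : ℝ) (M m i j : ℕ) : ℝ :=
  form p α β γ δ M (fun y => nu p γ δ (y : ℝ) ^ m * onLattice p γ δ (racah p α β γ δ i) y)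
      (onLattice p γ δ (racah p α β γ δ j))
    / (Real.sqrt (sqNorm p α β γ δ M i) * Real.sqrt (sqNorm p α β γ δ M j))

theorem sum_mul_mem_uIcc {ι : Type*} {s : Finset ι} {c x : ι → ℝ} {a b : ℝ}
    (hc : ∀ i ∈ s, 0 ≤ c i) (hc1 : ∑ i ∈ s, c i = 1) (hx : ∀ i ∈ s, x i ∈ Set.uIcc a b) :
    ∑ i ∈ s, c i * x i ∈ Set.uIcc a b := by
  simpa using (convex_uIcc a b).sum_mem hc hc1 hx

theorem mem_uIcc_of_mul_nonpos {a b x : ℝ} (h : (x - a) * (x - b) ≤ 0) : x ∈ Set.uIcc a b := by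
  rw [Set.mem_uIcc]
  rcases le_total x a with h1 | h1 <;> rcases le_total x b with h2 | h2
  · rcases h1.eq_or_lt with rfl | h1
    · exact Or.inl ⟨le_rfl, h2⟩
    · rcases h2.eq_or_lt with rfl | h2
      · exact Or.inr ⟨le_rfl, h1.le⟩
      · nlinarith [mul_pos_of_neg_of_neg (sub_neg.2 h1) (sub_neg.2 h2)]
  · exact Or.inr ⟨h2, h1⟩
  · exact Or.inl ⟨h1, h2⟩
  · rcases h1.eq_or_lt with rfl | h1
    · exact Or.inr ⟨h2, le_rfl⟩
    · rcases h2.eq_or_lt with rfl | h2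
      · exact Or.inl ⟨h1.le, le_rfl⟩
      · nlinarith [mul_pos (sub_pos.2 h1) (sub_pos.2 h2)]

namespace Admissible

variable {p α β γ δ : ℝ} {M : ℕ}

theorem sum_orthoMat_pow (h : Admissible p α β γ δ M) (m : ℕ) (i j : Fin (M + 1)) :
    ∑ y : Fin (M + 1), orthoMat p α β γ δ M i y * nu p γ δ ((y : ℕ) : ℝ) ^ m
      * orthoMat p α β γ δ M j y = moment p α β γ δ M m i j :=
  h.sum_orthoMat (fun y => nu p γ δ (y : ℝ) ^ m) i j

theorem orthoMat_mul_diagonal (h : Admissible p α β γ δ M) (m : ℕ) (i j : Fin (M + 1)) :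
    (orthoMat p α β γ δ M * diagonal (fun y : Fin (M + 1) => nu p γ δ ((y : ℕ) : ℝ) ^ m)
      * (orthoMat p α β γ δ M)ᵀ) i j = moment p α β γ δ M m i j := by
  rw [← h.sum_orthoMat_pow, Matrix.mul_apply]
  simp only [Matrix.mul_diagonal, Matrix.transpose_apply]

theorem sum_orthoMat_sq (h : Admissible p α β γ δ M) (i : Fin (M + 1)) :
    ∑ y : Fin (M + 1), orthoMat p α β γ δ M i y ^ 2 = 1 := by
  have := congrFun (congrFun h.orthoMat_mul_transpose i) i
  rw [Matrix.mul_apply, Matrix.one_apply_eq] at this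
  rw [← this]
  exact Finset.sum_congr rfl fun _ _ => by simp [sq]

theorem sum_orthoMat_sq' (h : Admissible p α β γ δ M) (y : Fin (M + 1)) :
    ∑ i : Fin (M + 1), orthoMat p α β γ δ M i y ^ 2 = 1 := by
  have := congrFun (congrFun h.transpose_mul_orthoMat y) y
  rw [Matrix.mul_apply, Matrix.one_apply_eq] at this
  rw [← this]
  exact Finset.sum_congr rfl fun _ _ => by simp [sq]

theorem moment_zero (h : Admissible p α β γ δ M) {i j : ℕ} (hi : i ≤ M) (hj : j ≤ M) :
    moment p α β γ δ M 0 i j = if i = j then 1 else 0 := by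
  have e := h.orthoMat_mul_diagonal 0 ⟨i, Nat.lt_succ_of_le hi⟩ ⟨j, Nat.lt_succ_of_le hj⟩
  have e2 : (diagonal fun y : Fin (M + 1) => nu p γ δ ((y : ℕ) : ℝ) ^ 0) = 1 := by
    simp
  rw [e2, Matrix.mul_one, h.orthoMat_mul_transpose, Matrix.one_apply] at e
  rw [← e]
  simp [Fin.ext_iff]

theorem moment_comm (m i j : ℕ) : moment p α β γ δ M m i j = moment p α β γ δ M m j i := by
  unfold moment form
  rw [mul_comm (Real.sqrt _)]
  congr 1
  exact Finset.sum_congr rfl fun _ _ => by ring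

theorem moment_eq_zero (h : Admissible p α β γ δ M) {m i j : ℕ} (hj : j ≤ M) (hij : i + m < j) :
    moment p α β γ δ M m i j = 0 := by
  have := h.sum_pow_eq_zero (m := m) (i := ⟨i, by omega⟩) (j := ⟨j, by omega⟩) hij
  rwa [h.sum_orthoMat_pow] at this

theorem moment_one_self (h : Admissible p α β γ δ M) {i : ℕ} (hi : i + 1 ≤ M) :
    moment p α β γ δ M 1 i i = recDiag p α β γ δ i := by
  rw [← h.sum_nu_self (j := ⟨i, by omega⟩) hi]
  have := h.sum_orthoMat_pow 1 ⟨i, by omega⟩ ⟨i, by omega⟩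
  simp only [pow_one] at this
  exact this.symm

theorem moment_one_succ (h : Admissible p α β γ δ M) {i : ℕ} (hi : i + 2 ≤ M) :
    moment p α β γ δ M 1 (i + 1) i = recOff p α β γ δ i := by
  rw [← h.sum_nu_succ (i := ⟨i + 1, by omega⟩) (j := ⟨i, by omega⟩) rfl hi]
  have := h.sum_orthoMat_pow 1 ⟨i + 1, by omega⟩ ⟨i, by omega⟩
  simp only [pow_one] at this
  exact this.symm

theorem moment_add (h : Admissible p α β γ δ M) (m k : ℕ) {i j : ℕ} (hi : i ≤ M) (hj : j ≤ M) :
    moment p α β γ δ M (m + k) i j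
      = ∑ l ∈ Finset.range (M + 1), moment p α β γ δ M m i l * moment p α β γ δ M k l j := by
  have e := h.orthoMat_mul_diagonal (m + k) ⟨i, Nat.lt_succ_of_le hi⟩ ⟨j, Nat.lt_succ_of_le hj⟩
  have e2 : (orthoMat p α β γ δ M
        * diagonal (fun y : Fin (M + 1) => nu p γ δ ((y : ℕ) : ℝ) ^ (m + k))
        * (orthoMat p α β γ δ M)ᵀ)
      = (orthoMat p α β γ δ M * diagonal (fun y : Fin (M + 1) => nu p γ δ ((y : ℕ) : ℝ) ^ m)
        * (orthoMat p α β γ δ M)ᵀ)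
        * (orthoMat p α β γ δ M * diagonal (fun y : Fin (M + 1) => nu p γ δ ((y : ℕ) : ℝ) ^ k)
        * (orthoMat p α β γ δ M)ᵀ) := by
    calc _ = orthoMat p α β γ δ M
          * (diagonal (fun y : Fin (M + 1) => nu p γ δ ((y : ℕ) : ℝ) ^ m)
            * ((orthoMat p α β γ δ M)ᵀ * orthoMat p α β γ δ M)
            * diagonal (fun y : Fin (M + 1) => nu p γ δ ((y : ℕ) : ℝ) ^ k))
          * (orthoMat p α β γ δ M)ᵀ := by
          rw [h.transpose_mul_orthoMat, Matrix.mul_one, diagonal_mul_diagonal]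
          simp only [pow_add]
      _ = _ := by simp only [Matrix.mul_assoc]
  rw [e2, Matrix.mul_apply] at e
  simp only [h.orthoMat_mul_diagonal] at e
  rw [Finset.sum_range]
  exact e.symm

/-- The three-term recurrence for the matrix elements of powers of `ν`. -/
theorem moment_succ (h : Admissible p α β γ δ M) (m : ℕ) {i j : ℕ} (hi : i + 3 ≤ M)
    (hj : j ≤ M) : moment p α β γ δ M (m + 1) (i + 1) j
      = recOff p α β γ δ i * moment p α β γ δ M m i j
        + recDiag p α β γ δ (i + 1) * moment p α β γ δ M m (i + 1) j
        + recOff p α β γ δ (i + 1) * moment p α β γ δ M m (i + 2) j := by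
  rw [add_comm m 1, h.moment_add 1 m (by omega) hj]
  have hsub : ({i, i + 1, i + 2} : Finset ℕ) ⊆ Finset.range (M + 1) := by
    intro x hx
    simp only [Finset.mem_insert, Finset.mem_singleton] at hx
    rw [Finset.mem_range]
    omega
  rw [← Finset.sum_subset hsub]
  · rw [Finset.sum_insert (by simp), Finset.sum_insert (by simp), Finset.sum_singleton,
      h.moment_one_succ (by omega), h.moment_one_self (by omega), moment_comm 1 (i + 1) (i + 2),
      h.moment_one_succ (by omega)]
    ring
  · intro l hl hl'
    simp only [Finset.mem_insert, Finset.mem_singleton, not_or, Finset.mem_range] at hl hl'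
    rcases lt_or_gt_of_ne hl'.1 with h1 | h1
    · rw [moment_comm, h.moment_eq_zero (by omega) (by omega), zero_mul]
    · rw [h.moment_eq_zero (by omega) (by omega), zero_mul]

theorem moment_self (h : Admissible p α β γ δ M) (m : ℕ) (i : Fin (M + 1)) :
    moment p α β γ δ M m i i = ∑ y : Fin (M + 1), orthoMat p α β γ δ M i y ^ 2
      * nu p γ δ ((y : ℕ) : ℝ) ^ m := by
  rw [← h.sum_orthoMat_pow]
  exact Finset.sum_congr rfl fun _ _ => by ring

theorem abs_moment_self_le (h : Admissible p α β γ δ M) (m : ℕ) {i : ℕ} (hi : i ≤ M) {K : ℝ}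
    (hK : ∀ y ≤ M, |nu p γ δ (y : ℝ)| ≤ K) : |moment p α β γ δ M m i i| ≤ K ^ m := by
  have h1 := h.moment_self m ⟨i, Nat.lt_succ_of_le hi⟩
  simp only at h1
  rw [h1]
  calc _ ≤ ∑ y : Fin (M + 1), orthoMat p α β γ δ M ⟨i, Nat.lt_succ_of_le hi⟩ y ^ 2 * K ^ m := by
        refine (Finset.abs_sum_le_sum_abs _ _).trans (Finset.sum_le_sum fun y _ => ?_)
        rw [abs_mul, abs_of_nonneg (sq_nonneg _), abs_pow]
        gcongr
        exact hK y (Nat.lt_succ_iff.1 y.2)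
    _ = K ^ m := by rw [← Finset.sum_mul, h.sum_orthoMat_sq, one_mul]

theorem nu_mem_uIcc (h : Admissible p α β γ δ M) {y : ℕ} (hy : y ≤ M) :
    nu p γ δ (y : ℝ) ∈ Set.uIcc (nu p γ δ ((0 : ℕ) : ℝ)) (nu p γ δ (M : ℝ)) := by
  rw [Set.mem_uIcc]
  rcases h.strict with h' | h'
  · exact Or.inl ⟨h'.monotoneOn (Set.mem_Iic.2 (Nat.zero_le _)) hy (Nat.zero_le _),
      h'.monotoneOn hy (Set.mem_Iic.2 le_rfl) hy⟩
  · exact Or.inr ⟨h'.antitoneOn hy (Set.mem_Iic.2 le_rfl) hy,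
      h'.antitoneOn (Set.mem_Iic.2 (Nat.zero_le _)) hy (Nat.zero_le _)⟩

/-- A diagonal matrix element of `ν` is an average of nodes. -/
theorem recDiag_mem_uIcc (h : Admissible p α β γ δ M) {j : ℕ} (hj : j + 1 ≤ M) :
    recDiag p α β γ δ j ∈ Set.uIcc (nu p γ δ ((0 : ℕ) : ℝ)) (nu p γ δ (M : ℝ)) := by
  rw [← h.moment_one_self hj]
  have h1 := h.moment_self 1 ⟨j, by omega⟩
  simp only [pow_one] at h1
  rw [h1]
  exact sum_mul_mem_uIcc (fun _ _ => sq_nonneg _) (h.sum_orthoMat_sq _)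
    fun y _ => h.nu_mem_uIcc (Nat.lt_succ_iff.1 y.2)

/-- The eigenvalues are monotone in `j`. -/
theorem eigval_mem_uIcc (h : Admissible p α β γ δ M) {j : ℕ} (hj : j ≤ M) :
    eigval p α β j ∈ Set.uIcc (eigval p α β 0) (eigval p α β M) := by
  refine mem_uIcc_of_mul_nonpos ?_
  rw [eigval_sub h.pos, eigval_sub h.pos]
  have hp := h.pos
  have h1 : 0 < (1 - α * β * p ^ (j + 0 + 1)) * (1 - α * β * p ^ (j + M + 1)) := by
    rcases h.sign with h' | h'
    · exact mul_pos (h' _ (by omega)) (h' _ (by omega))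
    · exact mul_pos_of_neg_of_neg (h' _ (by omega)) (h' _ (by omega))
  have h2 : (p ^ 0 - p ^ j) * (p ^ M - p ^ j) ≤ 0 := by
    rcases le_total p 1 with h' | h'
    · have a1 := pow_le_pow_of_le_one hp.le h' (Nat.zero_le j)
      have a2 := pow_le_pow_of_le_one hp.le h' hj
      exact mul_nonpos_of_nonneg_of_nonpos (by linarith) (by linarith)
    · have a1 := pow_le_pow_right₀ h' (Nat.zero_le j)
      have a2 := pow_le_pow_right₀ h' hj
      exact mul_nonpos_of_nonpos_of_nonneg (by linarith) (by linarith)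
  have e : (p ^ 0 - p ^ j) * (1 - α * β * p ^ (j + 0 + 1)) / (p ^ j * p ^ 0)
      * ((p ^ M - p ^ j) * (1 - α * β * p ^ (j + M + 1)) / (p ^ j * p ^ M))
      = ((p ^ 0 - p ^ j) * (p ^ M - p ^ j))
        * (((1 - α * β * p ^ (j + 0 + 1)) * (1 - α * β * p ^ (j + M + 1)))
          / ((p ^ j * p ^ 0) * (p ^ j * p ^ M))) := by
    ring
  rw [e]
  exact mul_nonpos_of_nonpos_of_nonneg h2 (div_nonneg h1.le (by positivity))

/-- The dual of `recDiag_mem_uIcc`, with eigenvalues in place of nodes. -/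
theorem diff_mem_uIcc (h : Admissible p α β γ δ M) {y : ℕ} (hy : y ≤ M) :
    -(diffUp p α β γ δ y + diffDown p α β γ δ y)
      ∈ Set.uIcc (eigval p α β 0) (eigval p α β M) := by
  have h1 := h.sum_eigval ⟨y, Nat.lt_succ_of_le hy⟩
  simp only at h1
  rw [← h1]
  simp only [mul_comm (eigval p α β _)]
  exact sum_mul_mem_uIcc (fun _ _ => sq_nonneg _) (h.sum_orthoMat_sq' _)
    fun j _ => h.eigval_mem_uIcc (Nat.lt_succ_iff.1 j.2)

/-! ### The ensemble as a determinantal point process -/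

/-- The Vandermonde determinant in the nodes is the determinant of the first `n` monic `q`-Racah
polynomials, so the joint density is a squared minor of the orthogonal matrix `orthoMat`. -/
theorem jointWeight_eq (h : Admissible p α β γ δ M) {n : ℕ} (hn : n ≤ M + 1)
    (y : Fin n → Fin (M + 1)) : jointWeight n M p α β γ δ y
      = (∏ i : Fin n, sqNorm p α β γ δ M i)
        * (((orthoMat p α β γ δ M).submatrix (Fin.castLE hn) id).submatrix id y).det ^ 2 := by
  have e1 : (((orthoMat p α β γ δ M).submatrix (Fin.castLE hn) id).submatrix id y)
      = Matrix.of fun i j : Fin n => (Real.sqrt (sqNorm p α β γ δ M i))⁻¹ *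
        (Matrix.of fun i j : Fin n => Real.sqrt (weight p α β γ δ (y j)) *
          (Matrix.of fun j i : Fin n =>
            ((racah p α β γ δ i).eval (nu p γ δ ((y j : ℕ) : ℝ))))ᵀ i j) i j := by
    ext i j
    simp [orthoMat, onLattice]
    ring
  rw [e1, det_mul_column, det_mul_row, det_transpose,
    ← det_eval_matrixOfPolynomials_eq_det_vandermonde
      (fun j => nu p γ δ ((y j : ℕ) : ℝ)) (fun i : Fin n => racah p α β γ δ i)
      (fun i => racah_natDegree _) (fun i => racah_monic _), det_vandermonde, jointWeight,
    mul_pow, mul_pow, ← Finset.prod_pow, ← Finset.prod_pow, ← Finset.prod_pow]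
  have e2 : ∏ i : Fin n, sqNorm p α β γ δ M i * ((Real.sqrt (sqNorm p α β γ δ M i))⁻¹) ^ 2
      = 1 := by
    refine Finset.prod_eq_one fun i _ => ?_
    have hi := h.sqNorm_pos (j := i) (by omega)
    rw [inv_pow, Real.sq_sqrt hi.le, mul_inv_cancel₀ hi.ne']
  rw [Finset.prod_mul_distrib] at e2
  rw [← mul_assoc, e2, one_mul, mul_comm]
  congr 1
  · exact Finset.prod_congr rfl fun j _ =>
      (Real.sq_sqrt (h.weight_pos _ (Nat.lt_succ_iff.1 (y j).2)).le).symm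
  · refine Finset.prod_congr rfl fun i _ => ?_
    rw [← Finset.prod_pow]
    exact Finset.prod_congr rfl fun j _ => by ring

theorem submatrix_mul_transpose (h : Admissible p α β γ δ M) {n : ℕ} (hn : n ≤ M + 1) :
    (orthoMat p α β γ δ M).submatrix (Fin.castLE hn) id
      * ((orthoMat p α β γ δ M).submatrix (Fin.castLE hn) id)ᵀ = 1 := by
  ext i j
  have := congrFun (congrFun h.orthoMat_mul_transpose (Fin.castLE hn i)) (Fin.castLE hn j)
  rw [Matrix.mul_apply] at this ⊢
  simp only [transpose_apply, submatrix_apply, id] at this ⊢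
  rw [this]
  simp [Matrix.one_apply]

theorem jointWeight_div_sum (h : Admissible p α β γ δ M) {n : ℕ} (hn : n ≤ M + 1)
    (y : Fin n → Fin (M + 1)) :
    jointWeight n M p α β γ δ y / ∑ z, jointWeight n M p α β γ δ z
      = (((orthoMat p α β γ δ M).submatrix (Fin.castLE hn) id).submatrix id y).det ^ 2
        / n.factorial := by
  have h1 := (sum_det_sq_mul_symm (h.submatrix_mul_transpose hn) 0).1
  rw [Fintype.card_fin] at h1
  simp only [h.jointWeight_eq hn]
  rw [← Finset.mul_sum, h1]
  have h2 : ∏ i : Fin n, sqNorm p α β γ δ M i ≠ 0 :=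
    Finset.prod_ne_zero_iff.2 fun i _ => (h.sqNorm_pos (j := i) (by omega)).ne'
  exact mul_div_mul_left _ _ h2

theorem integral_ensemble (h : Admissible p α β γ δ M) {n : ℕ} (hn : n ≤ M + 1)
    (F : (Fin n → Fin (M + 1)) → ℝ) :
    ∫ y, F y ∂(ensemble n M p α β γ δ) = (∑ y,
      (((orthoMat p α β γ δ M).submatrix (Fin.castLE hn) id).submatrix id y).det ^ 2 * F y)
        / n.factorial := by
  unfold ensemble
  rw [integral_finsetSum_measure]
  · rw [Finset.sum_div]
    refine Finset.sum_congr rfl fun y _ => ?_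
    rw [integral_smul_measure, integral_dirac, h.jointWeight_div_sum hn,
      ENNReal.toReal_ofReal (by positivity), smul_eq_mul]
    ring
  · intro y _
    exact (integrable_dirac (by simp)).smul_measure ENNReal.ofReal_ne_top

/-- The mean of the linear statistic of `ν^m`: the sum of the first `n` diagonal entries of the
`m`-th power of the Jacobi matrix. -/
def meanStat (p α β γ δ : ℝ) (M n m : ℕ) : ℝ :=
  ∑ k ∈ Finset.range n, moment p α β γ δ M m k k

/-- Matrix elements of a power of `ν` couple only `m` of the first `n` orthonormal functions to the
remaining ones, so the variance of a linear statistic stays bounded. -/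
theorem integral_sq_sub_le (h : Admissible p α β γ δ M) {n : ℕ} (hn : n ≤ M + 1) (m : ℕ) {K : ℝ}
    (hK : ∀ y ≤ M, |nu p γ δ (y : ℝ)| ≤ K) :
    ∫ y, (∑ i, nu p γ δ ((y i : ℕ) : ℝ) ^ m - meanStat p α β γ δ M n m) ^ 2
      ∂(ensemble n M p α β γ δ) ≤ m * K ^ (2 * m) := by
  set V := (orthoMat p α β γ δ M).submatrix (Fin.castLE hn) id with hV
  have hentry : ∀ (k : ℕ) (i j : Fin n), (V * diagonal (fun y : Fin (M + 1) =>
      nu p γ δ ((y : ℕ) : ℝ) ^ k) * Vᵀ) i j = moment p α β γ δ M k i j := by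
    intro k i j
    have := h.orthoMat_mul_diagonal k (Fin.castLE hn i) (Fin.castLE hn j)
    rw [Matrix.mul_apply] at this ⊢
    simpa [Matrix.mul_diagonal, hV] using this
  have htr : ∀ k : ℕ, (V * diagonal (fun y : Fin (M + 1) =>
      nu p γ δ ((y : ℕ) : ℝ) ^ k) * Vᵀ).trace = meanStat p α β γ δ M n k := by
    intro k
    rw [meanStat, Finset.sum_range, Matrix.trace]
    exact Finset.sum_congr rfl fun i _ => hentry k i i
  have hvar := sum_det_sq_mul_sq_sub (h.submatrix_mul_transpose hn)
    (fun y : Fin (M + 1) => nu p γ δ ((y : ℕ) : ℝ) ^ m)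
  rw [htr] at hvar
  rw [h.integral_ensemble hn, hvar, Fintype.card_fin,
    mul_div_cancel_left₀ _ (by positivity : (n.factorial : ℝ) ≠ 0)]
  simp only [← pow_mul]
  have hsq : ((V * diagonal (fun y : Fin (M + 1) => nu p γ δ ((y : ℕ) : ℝ) ^ m) * Vᵀ)
      * (V * diagonal (fun y : Fin (M + 1) => nu p γ δ ((y : ℕ) : ℝ) ^ m) * Vᵀ)).trace
      = ∑ i : Fin n, ∑ j : Fin n, moment p α β γ δ M m i j * moment p α β γ δ M m j i := by
    refine Finset.sum_congr rfl fun i _ => ?_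
    rw [Matrix.diag_apply, Matrix.mul_apply]
    exact Finset.sum_congr rfl fun j _ => by rw [hentry, hentry]
  rw [htr, hsq]
  rw [meanStat, Finset.sum_range, ← Finset.sum_sub_distrib]
  have hterm : ∀ i : Fin n, moment p α β γ δ M (m * 2) i i
      - ∑ j : Fin n, moment p α β γ δ M m i j * moment p α β γ δ M m j i
      = ∑ l ∈ Finset.Ico n (M + 1), moment p α β γ δ M m i l * moment p α β γ δ M m l i := by
    intro i
    rw [mul_two, h.moment_add m m (by omega) (by omega),
      ← Finset.sum_range_add_sum_Ico _ hn, Finset.sum_range]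
    ring
  have hK0 : 0 ≤ K := (abs_nonneg _).trans (hK 0 (Nat.zero_le _))
  have hbound : ∀ i : Fin n, moment p α β γ δ M (m * 2) i i
      - ∑ j : Fin n, moment p α β γ δ M m i j * moment p α β γ δ M m j i
      ≤ if n ≤ i + m then K ^ (2 * m) else 0 := by
    intro i
    split_ifs with hi
    · have h1 : 0 ≤ ∑ j : Fin n, moment p α β γ δ M m i j * moment p α β γ δ M m j i := by
        refine Finset.sum_nonneg fun j _ => ?_
        rw [moment_comm m j i]
        exact mul_self_nonneg _
      have h2 := (le_abs_self _).trans (h.abs_moment_self_le (m * 2) (i := i) (by omega) hK)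
      rw [mul_comm m 2] at h2 ⊢
      linarith
    · rw [hterm]
      refine (Finset.sum_eq_zero fun l hl => ?_).le
      rw [Finset.mem_Ico] at hl
      rw [h.moment_eq_zero (by omega) (by omega), zero_mul]
  refine (Finset.sum_le_sum fun i _ => hbound i).trans ?_
  rw [← Finset.sum_filter, Finset.sum_const, nsmul_eq_mul]
  gcongr
  have hcard : (Finset.univ.filter fun i : Fin n => n ≤ (i : ℕ) + m).card
      ≤ (Finset.Ico (n - m) n).card := by
    refine Finset.card_le_card_of_injOn (fun i => (i : ℕ)) ?_ ?_
    · intro i hi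
      simp at hi ⊢
      omega
    · exact fun i _ j _ hij => Fin.ext hij
  rw [Nat.card_Ico] at hcard
  omega

end Admissible

end

end QRacah

namespace QRacah

noncomputable section

/-! ### The scaling regime -/

/-- The scaling regime: `γ_n → γ = q^(-L)` with `L > 1`, positive weights and monotone nodes for
large `n`, and the condition on `αβ` that keeps `1 - αβ q^(2ξ)` away from zero on `[0, L]`. -/
structure Regime (q α β γ δ L : ℝ) (M : ℕ → ℕ) : Prop where
  pos : 0 < q
  ne_one : q ≠ 1
  one_lt : 1 < L
  gamma_eq : γ = q ^ (-L)
  tendsto_gamma : Tendsto (fun n : ℕ => gammaSeq q M n) atTop (𝓝 γ)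
  weight_pos : ∀ᶠ n : ℕ in atTop, ∀ y : ℕ, y ≤ M n →
    0 < weight (base q n) α β (gammaSeq q M n) δ y
  strict : ∀ᶠ n : ℕ in atTop,
    StrictMonoOn (fun y : ℕ => nu (base q n) (gammaSeq q M n) δ (y : ℝ)) (Set.Iic (M n)) ∨
    StrictAntiOn (fun y : ℕ => nu (base q n) (gammaSeq q M n) δ (y : ℝ)) (Set.Iic (M n))
  sign : α * β ≤ 0 ∨ (q < 1 ∧ γ ^ 2 < α * β) ∨ (1 < q ∧ 0 < α * β ∧ α * β < γ ^ 2)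

/-- The limit of `diffUp` as `y / n → x`. -/
def limUp (q α β γ δ x : ℝ) : ℝ :=
  (1 - α * q ^ x) * (1 - β * δ * q ^ x) * (1 - γ * q ^ x) * (1 - γ * δ * q ^ x) /
    (1 - γ * δ * q ^ (2 * x)) ^ 2

/-- The limit of `diffDown` as `y / n → x`. -/
def limDown (q α β γ δ x : ℝ) : ℝ :=
  (1 - q ^ x) * (1 - δ * q ^ x) * (β - γ * q ^ x) * (α - γ * δ * q ^ x) /
    (1 - γ * δ * q ^ (2 * x)) ^ 2

theorem base_pow {q : ℝ} (hq : 0 < q) (n k : ℕ) : base q n ^ k = q ^ ((k : ℝ) / n) := by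
  unfold base
  rw [← Real.rpow_natCast, ← Real.rpow_mul hq.le]
  congr 1
  ring

theorem base_pos {q : ℝ} (hq : 0 < q) (n : ℕ) : 0 < base q n := Real.rpow_pos_of_pos hq _

theorem mem_uIcc_of_tendsto {ι : Type*} {l : Filter ι} [l.NeBot] {a b x : ι → ℝ} {a' b' x' : ℝ}
    (ha : Tendsto a l (𝓝 a')) (hb : Tendsto b l (𝓝 b')) (hx : Tendsto x l (𝓝 x'))
    (h : ∀ᶠ i in l, x i ∈ Set.uIcc (a i) (b i)) : x' ∈ Set.uIcc a' b' := by
  constructor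
  · exact le_of_tendsto_of_tendsto (ha.min hb) hx (h.mono fun i hi => hi.1)
  · exact le_of_tendsto_of_tendsto hx (ha.max hb) (h.mono fun i hi => hi.2)

namespace Regime

variable {q α β γ δ L : ℝ} {M : ℕ → ℕ}

theorem gamma_pos (h : Regime q α β γ δ L M) : 0 < γ := by
  rw [h.gamma_eq]
  exact Real.rpow_pos_of_pos h.pos _

theorem L_pos (h : Regime q α β γ δ L M) : 0 < L := one_pos.trans h.one_lt

theorem gamma_mul_rpow (h : Regime q α β γ δ L M) : γ * q ^ L = 1 := by
  rw [h.gamma_eq, ← Real.rpow_add h.pos]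
  simp

theorem tendsto_top (h : Regime q α β γ δ L M) :
    Tendsto (fun n : ℕ => ((M n : ℝ) + 1) / n) atTop (𝓝 L) := by
  have h1 := (Real.continuousAt_log h.gamma_pos.ne').tendsto.comp h.tendsto_gamma
  have hl : Real.log q ≠ 0 := Real.log_ne_zero_of_pos_of_ne_one h.pos h.ne_one
  have h2 := (h1.div_const (Real.log q)).neg
  have e : -(Real.log γ / Real.log q) = L := by
    rw [h.gamma_eq, Real.log_rpow h.pos]
    field_simp
  rw [e] at h2
  refine h2.congr fun n => ?_
  simp only [Function.comp, gammaSeq]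
  rw [Real.log_rpow h.pos]
  field_simp

theorem tendsto_M (h : Regime q α β γ δ L M) :
    Tendsto (fun n : ℕ => (M n : ℝ) / n) atTop (𝓝 L) := by
  have h1 := h.tendsto_top.sub tendsto_one_div_atTop_nhds_zero_nat
  rw [sub_zero] at h1
  refine h1.congr fun n => ?_
  ring

/-- As `M_n / n` tends to `L > 1`, the indices up to `n` stay away from the top. -/
theorem eventually_add_le (h : Regime q α β γ δ L M) (k : ℕ) : ∀ᶠ n : ℕ in atTop,
    n + k ≤ M n := by
  obtain ⟨c, hc1, hcL⟩ := exists_between h.one_lt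
  have h1 := h.tendsto_M.eventually (lt_mem_nhds hcL)
  have h2 : Tendsto (fun n : ℕ => (c - 1) * (n : ℝ)) atTop atTop :=
    tendsto_natCast_atTop_atTop.const_mul_atTop (sub_pos.2 hc1)
  filter_upwards [h1, h2.eventually_ge_atTop (k : ℝ), eventually_gt_atTop 0] with n hn hk h0
  have h0' : (0 : ℝ) < n := by exact_mod_cast h0
  rw [lt_div_iff₀ h0'] at hn
  have : ((n + k : ℕ) : ℝ) ≤ M n := by
    push_cast
    linarith
  exact_mod_cast this

theorem tendsto_pow (h : Regime q α β γ δ L M) {k : ℕ → ℕ} {x : ℝ}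
    (hk : Tendsto (fun n : ℕ => (k n : ℝ) / n) atTop (𝓝 x)) :
    Tendsto (fun n : ℕ => base q n ^ k n) atTop (𝓝 (q ^ x)) := by
  simp only [base_pow h.pos]
  exact (Real.continuousAt_const_rpow h.pos.ne').tendsto.comp hk

theorem tendsto_base (h : Regime q α β γ δ L M) :
    Tendsto (fun n : ℕ => base q n) atTop (𝓝 1) := by
  have := h.tendsto_pow (k := fun _ => 1) (x := 0)
    (by simpa using tendsto_one_div_atTop_nhds_zero_nat (𝕜 := ℝ))
  simpa using this

theorem base_ne_one (h : Regime q α β γ δ L M) {n : ℕ} (hn : n ≠ 0) : base q n ≠ 1 := by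
  have hn' : (1 / (n : ℝ)) ≠ 0 := by positivity
  have hl : Real.log q ≠ 0 := Real.log_ne_zero_of_pos_of_ne_one h.pos h.ne_one
  intro h1
  have h2 := congrArg Real.log h1
  rw [base, Real.log_rpow h.pos, Real.log_one] at h2
  exact mul_ne_zero hn' hl h2

theorem gammaSeq_mul (h : Regime q α β γ δ L M) (n : ℕ) :
    gammaSeq q M n * base q n ^ (M n + 1) = 1 := by
  rw [base_pow h.pos, gammaSeq, ← Real.rpow_add h.pos]
  simp

/-- For large `n` the ensemble is admissible. -/
theorem admissible (h : Regime q α β γ δ L M) : ∀ᶠ n : ℕ in atTop,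
    Admissible (base q n) α β (gammaSeq q M n) δ (M n) := by
  have hsign : ∀ᶠ n : ℕ in atTop, (∀ m ≤ 2 * M n + 1, 0 < 1 - α * β * base q n ^ m) ∨
      (∀ m ≤ 2 * M n + 1, 1 - α * β * base q n ^ m < 0) := by
    have hsq : ∀ n : ℕ, gammaSeq q M n ^ 2 * base q n ^ (2 * M n + 1) * base q n = 1 := by
      intro n
      have := h.gammaSeq_mul n
      calc _ = (gammaSeq q M n * base q n ^ (M n + 1)) ^ 2 := by ring
        _ = 1 := by rw [this, one_pow]
    rcases h.sign with hs | ⟨hq, hs⟩ | ⟨hq, hs0, hs⟩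
    · refine Eventually.of_forall fun n => Or.inl fun m _ => ?_
      have := pow_pos (base_pos h.pos n) m
      nlinarith
    · filter_upwards [(h.tendsto_gamma.pow 2).eventually (gt_mem_nhds hs)] with n hn
      refine Or.inr fun m hm => ?_
      have hb1 : base q n ≤ 1 := Real.rpow_le_one h.pos.le hq.le (by positivity)
      have hb := base_pos h.pos n
      have h1 := pow_le_pow_of_le_one hb.le hb1 hm
      have h2 := hsq n
      have hp := pow_pos hb (2 * M n + 1)
      have h3 : 1 ≤ gammaSeq q M n ^ 2 * base q n ^ (2 * M n + 1) := by
        rw [← h2]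
        exact mul_le_of_le_one_right (by positivity) hb1
      have h4 : gammaSeq q M n ^ 2 * base q n ^ (2 * M n + 1)
          < α * β * base q n ^ (2 * M n + 1) := mul_lt_mul_of_pos_right hn hp
      have h5 : α * β * base q n ^ (2 * M n + 1) ≤ α * β * base q n ^ m :=
        mul_le_mul_of_nonneg_left h1 ((sq_nonneg _).trans hs.le)
      linarith
    · filter_upwards [(h.tendsto_gamma.pow 2).eventually (lt_mem_nhds hs)] with n hn
      refine Or.inl fun m hm => ?_
      have hb1 : 1 ≤ base q n := Real.one_le_rpow hq.le (by positivity)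
      have hb := base_pos h.pos n
      have h1 := pow_le_pow_right₀ hb1 hm
      have h2 := hsq n
      have hp := pow_pos hb (2 * M n + 1)
      have h3 : gammaSeq q M n ^ 2 * base q n ^ (2 * M n + 1) ≤ 1 := by
        rw [← h2]
        exact le_mul_of_one_le_right (by positivity) hb1
      have h4 : α * β * base q n ^ (2 * M n + 1)
          < gammaSeq q M n ^ 2 * base q n ^ (2 * M n + 1) := mul_lt_mul_of_pos_right hn hp
      have h5 : α * β * base q n ^ m ≤ α * β * base q n ^ (2 * M n + 1) :=
        mul_le_mul_of_nonneg_left h1 hs0.le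
      linarith
  filter_upwards [hsign, h.weight_pos, h.strict, eventually_ne_atTop 0] with n h1 h2 h3 h4
  exact ⟨base_pos h.pos n, h.base_ne_one h4, h.gammaSeq_mul n, h2, h3, h1⟩

/-! ### Limits of the coefficients -/

theorem tendsto_nu_mul (h : Regime q α β γ δ L M) (x : ℝ) : Tendsto
    (fun n : ℕ => nu (base q n) (gammaSeq q M n) δ ((n : ℝ) * x)) atTop (𝓝 (mu q γ δ x)) := by
  have h1 : Tendsto (fun n : ℕ => q ^ (-x) + δ * gammaSeq q M n * (q ^ x * base q n)) atTop
      (𝓝 (q ^ (-x) + δ * γ * (q ^ x * 1))) :=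
    tendsto_const_nhds.add ((h.tendsto_gamma.const_mul δ).mul (h.tendsto_base.const_mul _))
  rw [mul_one, mul_comm δ γ] at h1
  refine h1.congr' ?_
  filter_upwards [eventually_ne_atTop 0] with n hn
  have hn' : (n : ℝ) ≠ 0 := by exact_mod_cast hn
  have hb := base_pos h.pos n
  have e : ∀ t : ℝ, base q n ^ ((n : ℝ) * t) = q ^ t := by
    intro t
    unfold base
    rw [← Real.rpow_mul h.pos.le]
    congr 1
    field_simp
  rw [nu, Real.rpow_add hb, ← mul_neg, e, e, Real.rpow_one]

theorem tendsto_add_const {k : ℕ → ℕ} {x : ℝ}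
    (hk : Tendsto (fun n : ℕ => (k n : ℝ) / n) atTop (𝓝 x)) (c : ℕ) :
    Tendsto (fun n : ℕ => ((k n + c : ℕ) : ℝ) / n) atTop (𝓝 x) := by
  have h1 := hk.add (tendsto_const_div_atTop_nhds_zero_nat (c : ℝ))
  rw [add_zero] at h1
  refine h1.congr fun n => ?_
  push_cast
  ring

theorem tendsto_two_mul {k : ℕ → ℕ} {x : ℝ}
    (hk : Tendsto (fun n : ℕ => (k n : ℝ) / n) atTop (𝓝 x)) :
    Tendsto (fun n : ℕ => ((2 * k n : ℕ) : ℝ) / n) atTop (𝓝 (2 * x)) := by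
  refine (hk.const_mul 2).congr fun n => ?_
  push_cast
  ring

theorem tendsto_nu_natCast (h : Regime q α β γ δ L M) {k : ℕ → ℕ} {x : ℝ}
    (hk : Tendsto (fun n : ℕ => (k n : ℝ) / n) atTop (𝓝 x)) :
    Tendsto (fun n : ℕ => nu (base q n) (gammaSeq q M n) δ (k n : ℝ)) atTop
      (𝓝 (mu q γ δ x)) := by
  simp only [nu_natCast (base_pos h.pos _)]
  rw [mu, Real.rpow_neg h.pos.le, mul_comm γ δ]
  exact ((h.tendsto_pow hk).inv₀ (Real.rpow_pos_of_pos h.pos _).ne').add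
    ((h.tendsto_gamma.const_mul δ).mul (h.tendsto_pow (tendsto_add_const hk 1)))

theorem sign_of_nonpos (h : Regime q α β γ δ L M) (hs : α * β ≤ 0) (ξ : ℝ) :
    0 < 1 - α * β * q ^ (2 * ξ) := by
  have := Real.rpow_pos_of_pos h.pos (2 * ξ)
  nlinarith

theorem gamma_sq_mul (h : Regime q α β γ δ L M) : γ ^ 2 * q ^ (2 * L) = 1 := by
  rw [two_mul, Real.rpow_add h.pos]
  calc _ = (γ * q ^ L) ^ 2 := by ring
    _ = 1 := by rw [h.gamma_mul_rpow, one_pow]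

theorem sign_of_lt_one (h : Regime q α β γ δ L M) (hs : 0 < α * β) (hq : q < 1) {ξ : ℝ}
    (hξ : ξ ≤ L) : 1 - α * β * q ^ (2 * ξ) < 0 := by
  rcases h.sign with h' | ⟨-, h'⟩ | ⟨h', -⟩
  · linarith
  · have h1 : q ^ (2 * L) ≤ q ^ (2 * ξ) :=
      Real.rpow_le_rpow_of_exponent_ge h.pos hq.le (by linarith)
    have h2 := Real.rpow_pos_of_pos h.pos (2 * L)
    have h3 := h.gamma_sq_mul
    nlinarith [mul_lt_mul_of_pos_right h' h2, mul_le_mul_of_nonneg_left h1 hs.le]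
  · linarith

theorem sign_of_one_lt (h : Regime q α β γ δ L M) (hs : 0 < α * β) (hq : 1 < q) {ξ : ℝ}
    (hξ : ξ ≤ L) : 0 < 1 - α * β * q ^ (2 * ξ) := by
  rcases h.sign with h' | ⟨h', -⟩ | ⟨-, -, h'⟩
  · linarith
  · linarith
  · have h1 : q ^ (2 * ξ) ≤ q ^ (2 * L) :=
      Real.rpow_le_rpow_of_exponent_le hq.le (by linarith)
    have h2 := Real.rpow_pos_of_pos h.pos (2 * L)
    have h3 := h.gamma_sq_mul
    nlinarith [mul_lt_mul_of_pos_right h' h2, mul_le_mul_of_nonneg_left h1 hs.le]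

theorem sign_ne (h : Regime q α β γ δ L M) {ξ : ℝ} (hξ : ξ ≤ L) :
    1 - α * β * q ^ (2 * ξ) ≠ 0 := by
  rcases le_or_gt (α * β) 0 with hs | hs
  · exact (h.sign_of_nonpos hs ξ).ne'
  · rcases lt_or_gt_of_ne h.ne_one with hq | hq
    · exact (h.sign_of_lt_one hs hq hξ).ne
    · exact (h.sign_of_one_lt hs hq hξ).ne'

theorem tendsto_recA (h : Regime q α β γ δ L M) {k : ℕ → ℕ} {x : ℝ} (hx : x ≤ L)
    (hk : Tendsto (fun n : ℕ => (k n : ℝ) / n) atTop (𝓝 x)) :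
    Tendsto (fun n : ℕ => recA (base q n) α β (gammaSeq q M n) δ (k n)) atTop
      (𝓝 (limA q α β γ δ x)) := by
  have h1 := h.tendsto_pow (tendsto_add_const hk 1)
  have h2 := h.tendsto_pow (tendsto_add_const (tendsto_two_mul hk) 1)
  have h3 := h.tendsto_pow (tendsto_add_const (tendsto_two_mul hk) 2)
  have hd := h.sign_ne hx
  unfold recA limA
  rw [sq]
  exact ((((h.tendsto_gamma.mul h1).const_sub 1).mul ((h1.const_mul α).const_sub 1)).mul
    ((h1.const_mul (α * β)).const_sub 1)).mul ((h1.const_mul (δ * β)).const_sub 1) |>.div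
    (((h2.const_mul (α * β)).const_sub 1).mul ((h3.const_mul (α * β)).const_sub 1))
    (mul_ne_zero hd hd)

theorem tendsto_recC (h : Regime q α β γ δ L M) {k : ℕ → ℕ} {x : ℝ} (hx : x ≤ L)
    (hk : Tendsto (fun n : ℕ => (k n : ℝ) / n) atTop (𝓝 x)) :
    Tendsto (fun n : ℕ => recC (base q n) α β (gammaSeq q M n) δ (k n)) atTop
      (𝓝 (limC q α β γ δ x)) := by
  have h1 := h.tendsto_pow hk
  have h2 := h.tendsto_pow (tendsto_two_mul hk)
  have h3 := h.tendsto_pow (tendsto_add_const (tendsto_two_mul hk) 1)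
  have hd := h.sign_ne hx
  unfold recC limC
  rw [sq]
  have := (((((h.tendsto_base.mul (h1.const_sub 1)).mul ((h1.const_mul β).const_sub 1)).mul
    ((h1.const_mul α).const_sub δ)).mul (h.tendsto_gamma.sub (h1.const_mul (α * β))))).div
    (((h2.const_mul (α * β)).const_sub 1).mul ((h3.const_mul (α * β)).const_sub 1))
    (mul_ne_zero hd hd)
  rwa [one_mul] at this

theorem tendsto_recOff (h : Regime q α β γ δ L M) {k : ℕ → ℕ} {x : ℝ} (hx : x ≤ L)
    (hk : Tendsto (fun n : ℕ => (k n : ℝ) / n) atTop (𝓝 x)) :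
    Tendsto (fun n : ℕ => recOff (base q n) α β (gammaSeq q M n) δ (k n)) atTop
      (𝓝 (limOff q α β γ δ x)) :=
  ((h.tendsto_recA hx hk).mul (h.tendsto_recC hx (tendsto_add_const hk 1))).sqrt

theorem tendsto_recDiag (h : Regime q α β γ δ L M) {k : ℕ → ℕ} {x : ℝ} (hx : x ≤ L)
    (hk : Tendsto (fun n : ℕ => (k n : ℝ) / n) atTop (𝓝 x)) :
    Tendsto (fun n : ℕ => recDiag (base q n) α β (gammaSeq q M n) δ (k n)) atTop
      (𝓝 (limDiag q α β γ δ x)) := by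
  have h1 := ((h.tendsto_gamma.const_mul δ).mul h.tendsto_base).const_add 1
  rw [mul_one] at h1
  exact (h1.sub (h.tendsto_recA hx hk)).sub (h.tendsto_recC hx hk)

theorem tendsto_diffUp (h : Regime q α β γ δ L M) {k : ℕ → ℕ} {x : ℝ}
    (hx : 1 - γ * δ * q ^ (2 * x) ≠ 0)
    (hk : Tendsto (fun n : ℕ => (k n : ℝ) / n) atTop (𝓝 x)) :
    Tendsto (fun n : ℕ => diffUp (base q n) α β (gammaSeq q M n) δ (k n)) atTop
      (𝓝 (limUp q α β γ δ x)) := by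
  have h1 := h.tendsto_pow (tendsto_add_const hk 1)
  have h2 := h.tendsto_pow (tendsto_add_const (tendsto_two_mul hk) 1)
  have h3 := h.tendsto_pow (tendsto_add_const (tendsto_two_mul hk) 2)
  have hg := h.tendsto_gamma.mul_const δ
  unfold diffUp limUp
  rw [sq]
  exact (((((h1.const_mul α).const_sub 1).mul ((h1.const_mul (β * δ)).const_sub 1)).mul
    ((h.tendsto_gamma.mul h1).const_sub 1)).mul ((hg.mul h1).const_sub 1)).div
    (((hg.mul h2).const_sub 1).mul ((hg.mul h3).const_sub 1)) (mul_ne_zero hx hx)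

theorem tendsto_diffDown (h : Regime q α β γ δ L M) {k : ℕ → ℕ} {x : ℝ}
    (hx : 1 - γ * δ * q ^ (2 * x) ≠ 0)
    (hk : Tendsto (fun n : ℕ => (k n : ℝ) / n) atTop (𝓝 x)) :
    Tendsto (fun n : ℕ => diffDown (base q n) α β (gammaSeq q M n) δ (k n)) atTop
      (𝓝 (limDown q α β γ δ x)) := by
  have h1 := h.tendsto_pow hk
  have h2 := h.tendsto_pow (tendsto_two_mul hk)
  have h3 := h.tendsto_pow (tendsto_add_const (tendsto_two_mul hk) 1)
  have hg := h.tendsto_gamma.mul_const δ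
  unfold diffDown limDown
  rw [sq]
  have := (((((h.tendsto_base.mul (h1.const_sub 1)).mul ((h1.const_mul δ).const_sub 1)).mul
    ((h.tendsto_gamma.mul h1).const_sub β)).mul ((hg.mul h1).const_sub α))).div
    (((hg.mul h2).const_sub 1).mul ((hg.mul h3).const_sub 1)) (mul_ne_zero hx hx)
  rwa [one_mul] at this

/-- Every point of `[0, L]` is a limit of rescaled indices that stay `c` below the top. -/
theorem exists_seq (h : Regime q α β γ δ L M) {x : ℝ} (hx : x ∈ Set.Icc 0 L) (c : ℕ) :
    ∃ k : ℕ → ℕ, Tendsto (fun n : ℕ => (k n : ℝ) / n) atTop (𝓝 x) ∧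
      ∀ᶠ n : ℕ in atTop, k n + c ≤ M n := by
  refine ⟨fun n => min ⌊x * n⌋₊ (M n - c), ?_, ?_⟩
  · have h1 : Tendsto (fun n : ℕ => (⌊x * (n : ℝ)⌋₊ : ℝ) / n) atTop (𝓝 x) :=
      (tendsto_nat_floor_mul_div_atTop hx.1).comp tendsto_natCast_atTop_atTop
    have h2 := h.tendsto_M.sub (tendsto_const_div_atTop_nhds_zero_nat (c : ℝ))
    rw [sub_zero] at h2
    have h3 := h1.min h2
    rw [min_eq_left hx.2] at h3
    refine h3.congr' ?_
    filter_upwards [h.eventually_add_le c, eventually_gt_atTop 0] with n hn h0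
    have h0' : (0 : ℝ) < n := by exact_mod_cast h0
    rw [Nat.cast_min, Nat.cast_sub (by omega), ← sub_div]
    exact (min_div_div_right h0'.le _ _)
  · filter_upwards [h.eventually_add_le c] with n hn
    have := min_le_right ⌊x * n⌋₊ (M n - c)
    omega

theorem limA_mul_limC_nonneg (h : Regime q α β γ δ L M) {x : ℝ} (hx : x ∈ Set.Icc 0 L) :
    0 ≤ limA q α β γ δ x * limC q α β γ δ x := by
  obtain ⟨k, hk, hk2⟩ := h.exists_seq hx 2
  refine ge_of_tendsto ((h.tendsto_recA hx.2 hk).mul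
    (h.tendsto_recC hx.2 (tendsto_add_const hk 1))) ?_
  filter_upwards [h.admissible, hk2] with n hn hk
  exact (hn.recA_mul_recC_pos hk).le

/-- The bound `recDiag_mem_uIcc` survives in the limit. -/
theorem limDiag_mem (h : Regime q α β γ δ L M) {x : ℝ} (hx : x ∈ Set.Icc 0 L) :
    limDiag q α β γ δ x ∈ Set.uIcc (mu q γ δ 0) (mu q γ δ L) := by
  obtain ⟨k, hk, hk2⟩ := h.exists_seq hx 2
  refine mem_uIcc_of_tendsto (h.tendsto_nu_natCast (k := fun _ => 0) (by simp))
    (h.tendsto_nu_natCast h.tendsto_M) (h.tendsto_recDiag hx.2 hk) ?_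
  filter_upwards [h.admissible, hk2] with n hn hk
  exact hn.recDiag_mem_uIcc (by omega)

theorem limUp_mul_limDown_nonneg (h : Regime q α β γ δ L M) {x : ℝ} (hx : x ∈ Set.Icc 0 L)
    (hx' : 1 - γ * δ * q ^ (2 * x) ≠ 0) :
    0 ≤ limUp q α β γ δ x * limDown q α β γ δ x := by
  obtain ⟨k, hk, hk2⟩ := h.exists_seq hx 2
  refine ge_of_tendsto ((h.tendsto_diffUp hx' hk).mul
    (h.tendsto_diffDown hx' (tendsto_add_const hk 1))) ?_
  filter_upwards [h.admissible, hk2] with n hn hk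
  exact hn.diffUp_mul_diffDown_nonneg (by omega)

/-- The bound `diff_mem_uIcc` survives in the limit. -/
theorem lim_diff_mem (h : Regime q α β γ δ L M) {x : ℝ} (hx : x ∈ Set.Icc 0 L)
    (hx' : 1 - γ * δ * q ^ (2 * x) ≠ 0) :
    1 + α * β - limUp q α β γ δ x - limDown q α β γ δ x
      ∈ Set.uIcc (yFun q α β 0) (yFun q α β L) := by
  obtain ⟨k, hk, hk2⟩ := h.exists_seq hx 2
  have hev : ∀ {k : ℕ → ℕ} {x : ℝ}, Tendsto (fun n : ℕ => (k n : ℝ) / n) atTop (𝓝 x) →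
      Tendsto (fun n : ℕ => 1 + α * β + eigval (base q n) α β (k n)) atTop
        (𝓝 (yFun q α β x)) := by
    intro k x hk
    have h1 := (((h.tendsto_pow hk).inv₀ (Real.rpow_pos_of_pos h.pos _).ne').sub_const 1).add
      (((h.tendsto_pow (tendsto_add_const hk 1)).sub h.tendsto_base).const_mul (α * β))
    have h2 := h1.const_add (1 + α * β)
    have e : 1 + α * β + ((q ^ x)⁻¹ - 1 + α * β * (q ^ x - 1)) = yFun q α β x := by
      rw [yFun, Real.rpow_neg h.pos.le]
      ring
    rw [e] at h2
    exact h2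
  have hB := ((h.tendsto_diffUp (α := α) (β := β) hx' hk).add
    (h.tendsto_diffDown hx' hk)).neg.const_add (1 + α * β)
  have e : 1 + α * β + -(limUp q α β γ δ x + limDown q α β γ δ x)
      = 1 + α * β - limUp q α β γ δ x - limDown q α β γ δ x := by ring
  rw [e] at hB
  refine mem_uIcc_of_tendsto (hev (k := fun _ => 0) (by simp)) (hev h.tendsto_M) hB ?_
  filter_upwards [h.admissible, hk2] with n hn hk
  have := hn.diff_mem_uIcc (y := k n) (by omega)
  rw [Set.mem_uIcc] at this ⊢
  rcases this with h1 | h1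
  · exact Or.inl ⟨by linarith [h1.1], by linarith [h1.2]⟩
  · exact Or.inr ⟨by linarith [h1.1], by linarith [h1.2]⟩

/-- `μ'` does not vanish inside `(0, L)`: otherwise `ν_n` would change its direction there. -/
theorem mu_factor_ne (h : Regime q α β γ δ L M) {x : ℝ} (hx : x ∈ Set.Ioo 0 L) :
    1 - γ * δ * q ^ (2 * x) ≠ 0 := by
  intro h0
  -- the increment of `ν_n` at `k` has the sign of `(1 - p) (1 - γ_n δ p^(2 k + 2))`
  have hinc : ∀ (n k : ℕ), nu (base q n) (gammaSeq q M n) δ ((k + 1 : ℕ) : ℝ)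
      - nu (base q n) (gammaSeq q M n) δ (k : ℝ) = (base q n ^ (k + 1))⁻¹ * ((1 - base q n)
        * (1 - gammaSeq q M n * δ * base q n ^ (2 * k + 2))) := by
    intro n k
    have hb := (base_pos h.pos n).ne'
    simp only [nu_natCast (base_pos h.pos n)]
    field_simp
    ring
  obtain ⟨x1, hx10, hx1⟩ := exists_between hx.1
  obtain ⟨x2, hx2, hx2L⟩ := exists_between hx.2
  obtain ⟨k1, hk1, hk1'⟩ := h.exists_seq ⟨hx10.le, (hx1.trans hx.2).le⟩ 2
  obtain ⟨k2, hk2, hk2'⟩ := h.exists_seq ⟨(hx.1.trans hx2).le, hx2L.le⟩ 2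
  have hlim : ∀ {k : ℕ → ℕ} {x : ℝ}, Tendsto (fun n : ℕ => (k n : ℝ) / n) atTop (𝓝 x) →
      Tendsto (fun n : ℕ => 1 - gammaSeq q M n * δ * base q n ^ (2 * k n + 2)) atTop
        (𝓝 (1 - γ * δ * q ^ (2 * x))) := fun hk =>
    ((h.tendsto_gamma.mul_const δ).mul
      (h.tendsto_pow (tendsto_add_const (tendsto_two_mul hk) 2))).const_sub 1
  have hneg : (1 - γ * δ * q ^ (2 * x1)) * (1 - γ * δ * q ^ (2 * x2)) < 0 := by
    have hgd : γ * δ = (q ^ (2 * x))⁻¹ := by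
      have := Real.rpow_pos_of_pos h.pos (2 * x)
      field_simp
      linarith
    have e : ∀ t, 1 - γ * δ * q ^ (2 * t) = 1 - q ^ (2 * (t - x)) := by
      intro t
      rw [hgd, ← Real.rpow_neg h.pos.le, ← Real.rpow_add h.pos]
      ring_nf
    rw [e, e]
    rcases lt_or_gt_of_ne h.ne_one with hq | hq
    · have h1 := Real.one_lt_rpow_of_pos_of_lt_one_of_neg h.pos hq
        (show 2 * (x1 - x) < 0 by linarith)
      have h2 := Real.rpow_lt_one h.pos.le hq (show 0 < 2 * (x2 - x) by linarith)
      exact mul_neg_of_neg_of_pos (by linarith) (by linarith)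
    · have h1 := Real.rpow_lt_one_of_one_lt_of_neg hq (show 2 * (x1 - x) < 0 by linarith)
      have h2 := Real.one_lt_rpow hq (show 0 < 2 * (x2 - x) by linarith)
      exact mul_neg_of_pos_of_neg (by linarith) (by linarith)
  have hev := ((hlim hk1).mul (hlim hk2)).eventually (gt_mem_nhds hneg)
  obtain ⟨n, h1, h2, h3, h4⟩ := (hev.and (h.admissible.and (hk1'.and hk2'))).exists
  have hb := base_pos h.pos n
  have hprod : ∀ {k1 k2 : ℕ}, (nu (base q n) (gammaSeq q M n) δ ((k1 + 1 : ℕ) : ℝ)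
      - nu (base q n) (gammaSeq q M n) δ (k1 : ℝ))
      * (nu (base q n) (gammaSeq q M n) δ ((k2 + 1 : ℕ) : ℝ)
      - nu (base q n) (gammaSeq q M n) δ (k2 : ℝ))
      = ((base q n ^ (k1 + 1))⁻¹ * (base q n ^ (k2 + 1))⁻¹ * (1 - base q n) ^ 2)
        * ((1 - gammaSeq q M n * δ * base q n ^ (2 * k1 + 2))
          * (1 - gammaSeq q M n * δ * base q n ^ (2 * k2 + 2))) := by
    intro k1 k2
    rw [hinc, hinc]
    ring
  have h5 := hprod (k1 := k1 n) (k2 := k2 n)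
  have h6 : 0 < (base q n ^ (k1 n + 1))⁻¹ * (base q n ^ (k2 n + 1))⁻¹ * (1 - base q n) ^ 2 := by
    have : (1 - base q n) ≠ 0 := sub_ne_zero.2 h2.ne_one.symm
    positivity
  have h7 := mul_neg_of_pos_of_neg h6 h1
  rw [← h5] at h7
  have m1 : k1 n ∈ Set.Iic (M n) := Set.mem_Iic.2 (by omega)
  have m1' : k1 n + 1 ∈ Set.Iic (M n) := Set.mem_Iic.2 (by omega)
  have m2 : k2 n ∈ Set.Iic (M n) := Set.mem_Iic.2 (by omega)
  have m2' : k2 n + 1 ∈ Set.Iic (M n) := Set.mem_Iic.2 (by omega)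
  rcases h2.strict with hm | hm
  · exact h7.not_gt (mul_pos (sub_pos.2 (hm m1 m1' (Nat.lt_succ_self _)))
      (sub_pos.2 (hm m2 m2' (Nat.lt_succ_self _))))
  · exact h7.not_gt (mul_pos_of_neg_of_neg (sub_neg.2 (hm m1 m1' (Nat.lt_succ_self _)))
      (sub_neg.2 (hm m2 m2' (Nat.lt_succ_self _))))

/-- For `α = δ = 0` the denominator of the weight vanishes at `y = 1`. -/
theorem alpha_or_delta_ne (h : Regime q α β γ δ L M) : ¬(α = 0 ∧ δ = 0) := by
  rintro ⟨rfl, rfl⟩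
  obtain ⟨n, h1, h2⟩ := (h.weight_pos.and (h.eventually_add_le 1)).exists
  have := h1 1 (by omega)
  simp [weight] at this

end Regime

end

end QRacah

namespace QRacah

noncomputable section

/-! ### Duality and the roots of the discriminant -/

theorem rpow_two_mul {q : ℝ} (hq : 0 < q) (x : ℝ) : q ^ (2 * x) = (q ^ x) ^ 2 := by
  rw [mul_comm, Real.rpow_mul hq.le]
  norm_cast

/-- The discriminant `4a(ξ)² - (μ(x) - b(ξ))²`, with `a²` replaced by `AC`. -/
def disc (q α β γ δ x ξ : ℝ) : ℝ :=
  4 * (limA q α β γ δ ξ * limC q α β γ δ ξ) - (mu q γ δ x - limDiag q α β γ δ ξ) ^ 2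

/-- The polynomial identity behind `disc_duality`; it is invariant under exchanging
`(Q, α, β)` and `(X, γ, δ)`. -/
theorem duality_polynomial (α β γ δ Q X : ℝ) :
    (1 - α * β * Q ^ 2) ^ 2 * ((1 - X) * (1 - γ * δ * X)) ^ 2
      + 2 * ((1 - X) * (1 - γ * δ * X)) * X
        * ((1 - γ * Q) * (1 - α * Q) * (1 - α * β * Q) * (1 - δ * β * Q)
          + (1 - Q) * (1 - β * Q) * (δ - α * Q) * (γ - α * β * Q))
      + X ^ 2 * (1 - δ * γ + (-γ - α - α * β - δ * β + (1 + β) * δ * γ + α * γ + α * β * δ) * Q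
        + α * β * (1 - γ * δ) * Q ^ 2) ^ 2
    = (1 - γ * δ * X ^ 2) ^ 2 * ((1 - Q) * (1 - α * β * Q)) ^ 2
      + 2 * ((1 - Q) * (1 - α * β * Q)) * Q
        * ((1 - α * X) * (1 - β * δ * X) * (1 - γ * X) * (1 - γ * δ * X)
          + (1 - X) * (1 - δ * X) * (β - γ * X) * (α - γ * δ * X))
      + Q ^ 2 * (1 - α * β + (-α - γ - γ * δ - β * δ + (1 + δ) * β * α + γ * α + γ * δ * β) * X
        + γ * δ * (1 - α * β) * X ^ 2) ^ 2 := by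
  ring

/-- If `N - N' = E S`, then `4 (N/E²) (N'/E²) - (m + N/E² + N'/E²)²` has only `E²` in its
denominator. -/
theorem four_mul_sub_sq {N N' E S m : ℝ} (hE : E ≠ 0) (hS : N - N' = E * S) :
    (4 * (N / E ^ 2 * (N' / E ^ 2)) - (m + N / E ^ 2 + N' / E ^ 2) ^ 2) * E ^ 2
      = -(E ^ 2 * m ^ 2 + 2 * m * (N + N') + S ^ 2) := by
  obtain rfl : N = N' + E * S := by linarith
  field_simp
  ring

/-- The **duality** of the `q`-Racah polynomials in the scaling limit: the discriminants of the
recurrence and of the difference equation agree up to squares. -/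
theorem disc_duality {q : ℝ} (hq : 0 < q) {α β γ δ x ξ : ℝ}
    (hE : 1 - α * β * q ^ (2 * ξ) ≠ 0) (hH : 1 - γ * δ * q ^ (2 * x) ≠ 0) :
    disc q α β γ δ x ξ * ((1 - α * β * q ^ (2 * ξ)) / q ^ ξ) ^ 2
      = (4 * (limUp q α β γ δ x * limDown q α β γ δ x)
        - (yFun q α β ξ - (1 + α * β - limUp q α β γ δ x - limDown q α β γ δ x)) ^ 2)
        * ((1 - γ * δ * q ^ (2 * x)) / q ^ x) ^ 2 := by
  have hQ := Real.rpow_pos_of_pos hq ξ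
  have hX := Real.rpow_pos_of_pos hq x
  simp only [disc, limA, limC, limDiag, mu, limUp, limDown, yFun, rpow_two_mul hq,
    Real.rpow_neg hq.le] at hE hH ⊢
  generalize q ^ ξ = Q at *
  generalize q ^ x = X at *
  have key := duality_polynomial α β γ δ Q X
  have h1 := four_mul_sub_sq
    (N := (1 - γ * Q) * (1 - α * Q) * (1 - α * β * Q) * (1 - δ * β * Q))
    (N' := (1 - Q) * (1 - β * Q) * (δ - α * Q) * (γ - α * β * Q))
    (S := 1 - δ * γ + (-γ - α - α * β - δ * β + (1 + β) * δ * γ + α * γ + α * β * δ) * Q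
        + α * β * (1 - γ * δ) * Q ^ 2) (m := X⁻¹ + γ * δ * X - 1 - δ * γ) hE (by ring)
  have h2 := four_mul_sub_sq
    (N := (1 - α * X) * (1 - β * δ * X) * (1 - γ * X) * (1 - γ * δ * X))
    (N' := (1 - X) * (1 - δ * X) * (β - γ * X) * (α - γ * δ * X))
    (S := 1 - α * β + (-α - γ - γ * δ - β * δ + (1 + δ) * β * α + γ * α + γ * δ * β) * X
        + γ * δ * (1 - α * β) * X ^ 2) (m := Q⁻¹ + α * β * Q - 1 - α * β) hH (by ring)
  generalize (1 - γ * Q) * (1 - α * Q) * (1 - α * β * Q) * (1 - δ * β * Q) = NA at *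
  generalize (1 - Q) * (1 - β * Q) * (δ - α * Q) * (γ - α * β * Q) = NC at *
  generalize (1 - α * X) * (1 - β * δ * X) * (1 - γ * X) * (1 - γ * δ * X) = NB at *
  generalize (1 - X) * (1 - δ * X) * (β - γ * X) * (α - γ * δ * X) = ND at *
  generalize 1 - δ * γ + (-γ - α - α * β - δ * β + (1 + β) * δ * γ + α * γ + α * β * δ) * Q
        + α * β * (1 - γ * δ) * Q ^ 2 = SA at *
  generalize 1 - α * β + (-α - γ - γ * δ - β * δ + (1 + δ) * β * α + γ * α + γ * δ * β) * X
        + γ * δ * (1 - α * β) * X ^ 2 = SB at *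
  have hm : (X⁻¹ + γ * δ * X - 1 - δ * γ) = (1 - X) * (1 - γ * δ * X) / X := by
    field_simp
    ring
  have hm' : (Q⁻¹ + α * β * Q - 1 - α * β) = (1 - Q) * (1 - α * β * Q) / Q := by
    field_simp
    ring
  generalize 1 - α * β * Q ^ 2 = E at *
  generalize 1 - γ * δ * X ^ 2 = H at *
  have e1 : X⁻¹ + γ * δ * X - (1 + δ * γ - NA / E ^ 2 - NC / E ^ 2)
      = X⁻¹ + γ * δ * X - 1 - δ * γ + NA / E ^ 2 + NC / E ^ 2 := by ring
  have e2 : Q⁻¹ + α * β * Q - (1 + α * β - NB / H ^ 2 - ND / H ^ 2)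
      = Q⁻¹ + α * β * Q - 1 - α * β + NB / H ^ 2 + ND / H ^ 2 := by ring
  rw [e1, e2]
  generalize 4 * (NA / E ^ 2 * (NC / E ^ 2))
    - (X⁻¹ + γ * δ * X - 1 - δ * γ + NA / E ^ 2 + NC / E ^ 2) ^ 2 = u at *
  generalize 4 * (NB / H ^ 2 * (ND / H ^ 2))
    - (Q⁻¹ + α * β * Q - 1 - α * β + NB / H ^ 2 + ND / H ^ 2) ^ 2 = v at *
  rw [div_pow, div_pow, ← mul_div_assoc, ← mul_div_assoc, h1, h2, hm, hm']
  generalize (1 - X) * (1 - γ * δ * X) = n at *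
  generalize (1 - Q) * (1 - α * β * Q) = n' at *
  field_simp
  linear_combination -key

/-- At `x = 0` the discriminant is minus a square. -/
theorem disc_zero_nonpos (q α β γ δ ξ : ℝ) : disc q α β γ δ 0 ξ ≤ 0 := by
  have : disc q α β γ δ 0 ξ = -(limA q α β γ δ ξ - limC q α β γ δ ξ) ^ 2 := by
    simp only [disc, limDiag, mu]
    simp
    ring
  rw [this]
  exact neg_nonpos.2 (sq_nonneg _)

/-- A centre `c` between `a` and `b`, and a radius `r` that does not reach beyond them. -/
theorem sq_le_of_mem_uIcc {a b c r : ℝ} (hr : 0 ≤ r) (hc : c ∈ Set.uIcc a b)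
    (ha : r ^ 2 ≤ (a - c) ^ 2) (hb : r ^ 2 ≤ (b - c) ^ 2) :
    c + r ∈ Set.uIcc a b ∧ c - r ∈ Set.uIcc a b := by
  have h1 := sq_le_sq.1 ha
  have h2 := sq_le_sq.1 hb
  rw [abs_of_nonneg hr] at h1 h2
  simp only [Set.mem_uIcc] at hc ⊢
  rcases hc with ⟨h3, h4⟩ | ⟨h3, h4⟩
  · rw [abs_of_nonpos (by linarith)] at h1
    rw [abs_of_nonneg (by linarith)] at h2
    exact ⟨Or.inl ⟨by linarith, by linarith⟩, Or.inl ⟨by linarith, by linarith⟩⟩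
  · rw [abs_of_nonneg (by linarith)] at h1
    rw [abs_of_nonpos (by linarith)] at h2
    exact ⟨Or.inr ⟨by linarith, by linarith⟩, Or.inr ⟨by linarith, by linarith⟩⟩

theorem hasDerivAt_rpow_neg_add {q : ℝ} (hq : 0 < q) (c x : ℝ) :
    HasDerivAt (fun t => q ^ (-t) + c * q ^ t)
      (-(Real.log q * ((1 - c * q ^ (2 * x)) / q ^ x))) x := by
  have h1 : HasDerivAt (fun t : ℝ => q ^ (-t)) (Real.log q * -1 * q ^ (-x)) x :=
    (hasDerivAt_neg x).const_rpow hq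
  have h2 : HasDerivAt (fun t : ℝ => q ^ t) (Real.log q * 1 * q ^ x) x :=
    (hasDerivAt_id x).const_rpow hq
  refine (h1.fun_add (h2.const_mul c)).congr_deriv ?_
  have hX := Real.rpow_pos_of_pos hq x
  rw [rpow_two_mul hq, Real.rpow_neg hq.le]
  field_simp
  ring

theorem hasDerivAt_mu {q : ℝ} (hq : 0 < q) (γ δ x : ℝ) : HasDerivAt (mu q γ δ)
    (-(Real.log q * ((1 - γ * δ * q ^ (2 * x)) / q ^ x))) x :=
  hasDerivAt_rpow_neg_add hq _ x

theorem hasDerivAt_yFun {q : ℝ} (hq : 0 < q) (α β x : ℝ) : HasDerivAt (yFun q α β)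
    (-(Real.log q * ((1 - α * β * q ^ (2 * x)) / q ^ x))) x :=
  hasDerivAt_rpow_neg_add hq _ x

theorem continuous_yFun {q : ℝ} (hq : 0 < q) (α β : ℝ) : Continuous (yFun q α β) :=
  continuous_iff_continuousAt.2 fun x => (hasDerivAt_yFun hq α β x).continuousAt

theorem continuous_mu {q : ℝ} (hq : 0 < q) (γ δ : ℝ) : Continuous (mu q γ δ) :=
  continuous_iff_continuousAt.2 fun x => (hasDerivAt_mu hq γ δ x).continuousAt

namespace Regime

variable {q α β γ δ L : ℝ} {M : ℕ → ℕ}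

theorem log_ne (h : Regime q α β γ δ L M) : Real.log q ≠ 0 :=
  Real.log_ne_zero_of_pos_of_ne_one h.pos h.ne_one

theorem deriv_mu_ne_iff (h : Regime q α β γ δ L M) (x : ℝ) :
    deriv (mu q γ δ) x ≠ 0 ↔ 1 - γ * δ * q ^ (2 * x) ≠ 0 := by
  rw [(hasDerivAt_mu h.pos γ δ x).deriv]
  have := h.log_ne
  have := (Real.rpow_pos_of_pos h.pos x).ne'
  simp [*]

/-- The sign `ySign` is opposite to that of `y'`. -/
theorem ySign_mul_pos (h : Regime q α β γ δ L M) {ξ : ℝ} (hξ : ξ ≤ L) :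
    0 < ySign q α β * (Real.log q * (1 - α * β * q ^ (2 * ξ))) := by
  unfold ySign
  rcases lt_or_gt_of_ne h.ne_one with hq | hq
  · have hl := Real.log_neg h.pos hq
    rcases le_or_gt (α * β) 0 with hs | hs
    · rw [if_pos ⟨hq, hs⟩]
      nlinarith [mul_neg_of_neg_of_pos hl (h.sign_of_nonpos hs ξ)]
    · rw [if_neg fun h' => hs.not_ge h'.2]
      nlinarith [mul_pos_of_neg_of_neg hl (h.sign_of_lt_one hs hq hξ)]
  · have hl := Real.log_pos hq
    rw [if_neg fun h' => hq.not_gt h'.1, one_mul]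
    rcases le_or_gt (α * β) 0 with hs | hs
    · exact mul_pos hl (h.sign_of_nonpos hs ξ)
    · exact mul_pos hl (h.sign_of_one_lt hs hq hξ)

theorem ySign_sq (q α β : ℝ) : ySign q α β ^ 2 = 1 := by
  unfold ySign
  split_ifs <;> norm_num

theorem log_mul_rpow_sub_pos (h : Regime q α β γ δ L M) {ξ η : ℝ} (hξ : ξ < η) :
    0 < Real.log q * (q ^ η - q ^ ξ) := by
  rcases lt_or_gt_of_ne h.ne_one with hq | hq
  · exact mul_pos_of_neg_of_neg (Real.log_neg h.pos hq)
      (sub_neg.2 (Real.rpow_lt_rpow_of_exponent_gt h.pos hq hξ))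
  · exact mul_pos (Real.log_pos hq) (sub_pos.2 (Real.rpow_lt_rpow_of_exponent_lt hq hξ))

/-- Strict monotonicity of `y` on `(-∞, L]`, in the direction given by `ySign`. -/
theorem ySign_mul_sub_pos (h : Regime q α β γ δ L M) {ξ η : ℝ} (hξ : ξ < η) (hη : η ≤ L) :
    0 < ySign q α β * (yFun q α β ξ - yFun q α β η) := by
  have h1 := h.ySign_mul_pos (ξ := (ξ + η) / 2) (by linarith)
  have h2 := h.log_mul_rpow_sub_pos hξ
  have hQ := Real.rpow_pos_of_pos h.pos ξ
  have hQ' := Real.rpow_pos_of_pos h.pos η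
  have hl : 0 < Real.log q ^ 2 := by
    have := h.log_ne
    positivity
  rw [show 2 * ((ξ + η) / 2) = ξ + η by ring, Real.rpow_add h.pos] at h1
  have e : Real.log q ^ 2 * (ySign q α β * (yFun q α β ξ - yFun q α β η))
      = (ySign q α β * (Real.log q * (1 - α * β * (q ^ ξ * q ^ η))))
        * (Real.log q * (q ^ η - q ^ ξ)) / (q ^ ξ * q ^ η) := by
    simp only [yFun, Real.rpow_neg h.pos.le]
    field_simp
    ring
  have h3 : 0 < Real.log q ^ 2 * (ySign q α β * (yFun q α β ξ - yFun q α β η)) := by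
    rw [e]
    positivity
  exact pos_of_mul_pos_right h3 hl.le

theorem yFun_injOn (h : Regime q α β γ δ L M) : Set.InjOn (yFun q α β) (Set.Icc 0 L) := by
  intro ξ hξ η hη he
  by_contra hne
  rcases lt_or_gt_of_ne hne with h1 | h1
  · have := h.ySign_mul_sub_pos h1 hη.2
    rw [he, sub_self, mul_zero] at this
    exact lt_irrefl _ this
  · have := h.ySign_mul_sub_pos h1 hξ.2
    rw [he, sub_self, mul_zero] at this
    exact lt_irrefl _ this

theorem limOff_sq (h : Regime q α β γ δ L M) {ξ : ℝ} (hξ : ξ ∈ Set.Icc 0 L) :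
    limOff q α β γ δ ξ ^ 2 = limA q α β γ δ ξ * limC q α β γ δ ξ :=
  Real.sq_sqrt (h.limA_mul_limC_nonneg hξ)

theorem disc_eq (h : Regime q α β γ δ L M) {ξ : ℝ} (hξ : ξ ∈ Set.Icc 0 L) (x : ℝ) :
    4 * limOff q α β γ δ ξ ^ 2 - (mu q γ δ x - limDiag q α β γ δ ξ) ^ 2
      = disc q α β γ δ x ξ := by
  rw [h.limOff_sq hξ, disc]

/-- At `x = L` the discriminant is minus a square. -/
theorem disc_L_nonpos (h : Regime q α β γ δ L M) {ξ : ℝ} (hξ : ξ ≤ L) :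
    disc q α β γ δ L ξ ≤ 0 := by
  have hE := h.sign_ne hξ
  have hQ := Real.rpow_pos_of_pos h.pos ξ
  have hγ := h.gamma_pos
  have hL : q ^ L = γ⁻¹ := eq_inv_of_mul_eq_one_right h.gamma_mul_rpow
  have e : disc q α β γ δ L ξ = -(((((q ^ ξ)⁻¹ + α * β * q ^ ξ - 1 - α * β) * (γ - δ)
      + (γ - 1) * (β - 1) * (α - δ)) * q ^ ξ / (1 - α * β * q ^ (2 * ξ))) ^ 2) := by
    simp only [disc, limA, limC, limDiag, mu, rpow_two_mul h.pos, Real.rpow_neg h.pos.le, hL,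
      inv_inv] at hE ⊢
    generalize q ^ ξ = Q at *
    obtain ⟨E, hE'⟩ : ∃ E, E = 1 - α * β * Q ^ 2 := ⟨_, rfl⟩
    rw [← hE'] at hE ⊢
    field_simp
    rw [hE']
    ring
  rw [e]
  exact neg_nonpos.2 (sq_nonneg _)

/-- The roots of the discriminant: by duality it is a quadratic polynomial in `y(ξ)`, whose
vertex and values at the endpoints place both roots into `y([0, L])`. -/
theorem exists_roots (h : Regime q α β γ δ L M) {x : ℝ} (hx : x ∈ Set.Icc 0 L)
    (hH : 1 - γ * δ * q ^ (2 * x) ≠ 0) :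
    ∃ ξm ∈ Set.Icc 0 L, ∃ ξp ∈ Set.Icc 0 L, ξm ≤ ξp ∧
      (∀ ξ ≤ L, disc q α β γ δ x ξ * ((1 - α * β * q ^ (2 * ξ)) / q ^ ξ) ^ 2
        = ((1 - γ * δ * q ^ (2 * x)) / q ^ x) ^ 2
          * ((yFun q α β ξ - yFun q α β ξm) * (yFun q α β ξp - yFun q α β ξ))) ∧
      (ξm = ξp → limUp q α β γ δ x * limDown q α β γ δ x = 0) := by
  set B := limUp q α β γ δ x with hB
  set D := limDown q α β γ δ x with hD
  set c := 1 + α * β - B - D with hc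
  have hBD : 0 ≤ B * D := h.limUp_mul_limDown_nonneg hx hH
  set r := 2 * Real.sqrt (B * D) with hr
  have hr0 : 0 ≤ r := by positivity
  have hr2 : r ^ 2 = 4 * (B * D) := by rw [hr, mul_pow, Real.sq_sqrt hBD]; norm_num
  have hH2 : 0 < ((1 - γ * δ * q ^ (2 * x)) / q ^ x) ^ 2 := by
    have := (Real.rpow_pos_of_pos h.pos x).ne'
    positivity
  have hdual : ∀ ξ ≤ L, disc q α β γ δ x ξ * ((1 - α * β * q ^ (2 * ξ)) / q ^ ξ) ^ 2
      = (r ^ 2 - (yFun q α β ξ - c) ^ 2) * ((1 - γ * δ * q ^ (2 * x)) / q ^ x) ^ 2 := by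
    intro ξ hξ
    rw [disc_duality h.pos (h.sign_ne hξ) hH, hr2]
  have hend : ∀ ξ ≤ L, limA q α β γ δ ξ * limC q α β γ δ ξ = 0 →
      r ^ 2 ≤ (yFun q α β ξ - c) ^ 2 := by
    intro ξ hξ h0
    have h1 : disc q α β γ δ x ξ ≤ 0 := by
      rw [disc, h0, mul_zero, zero_sub]
      exact neg_nonpos.2 (sq_nonneg _)
    have h2 := mul_nonpos_of_nonpos_of_nonneg h1
      (sq_nonneg ((1 - α * β * q ^ (2 * ξ)) / q ^ ξ))
    rw [hdual ξ hξ] at h2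
    by_contra hcon
    have := mul_pos (sub_pos.2 (not_le.1 hcon)) hH2
    linarith
  have h0 := hend 0 h.L_pos.le (by simp [limC])
  have hL := hend L le_rfl (by simp [limA, h.gamma_mul_rpow])
  obtain ⟨hp, hm⟩ := sq_le_of_mem_uIcc hr0 (h.lim_diff_mem hx hH) h0 hL
  have hivt := intermediate_value_uIcc (a := 0) (b := L)
    (continuous_yFun h.pos α β).continuousOn
  rw [Set.uIcc_of_le h.L_pos.le] at hivt
  obtain ⟨ξ1, hξ1, e1⟩ := hivt hp
  obtain ⟨ξ2, hξ2, e2⟩ := hivt hm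
  have hfac : ∀ ξ, (yFun q α β ξ - yFun q α β ξ1) * (yFun q α β ξ2 - yFun q α β ξ)
      = r ^ 2 - (yFun q α β ξ - c) ^ 2 := by
    intro ξ
    rw [e1, e2]
    ring
  have hcoin : ξ1 = ξ2 → B * D = 0 := by
    intro he
    rw [he, e2] at e1
    have : r = 0 := by linarith
    rw [this] at hr2
    linarith
  rcases le_total ξ1 ξ2 with hle | hle
  · refine ⟨ξ1, hξ1, ξ2, hξ2, hle, fun ξ hξ => ?_, hcoin⟩
    rw [hdual ξ hξ, hfac]
    ring
  · refine ⟨ξ2, hξ2, ξ1, hξ1, hle, fun ξ hξ => ?_, fun he => hcoin he.symm⟩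
    rw [hdual ξ hξ, ← hfac]
    ring

end Regime

end

end QRacah

namespace QRacah

noncomputable section

/-! ### The explicit form of the density -/

theorem finite_setOf_sub_mul_rpow_eq_zero {q : ℝ} (hq : 0 < q) (hq1 : q ≠ 1) {a b : ℝ}
    (hab : ¬(a = 0 ∧ b = 0)) : {x : ℝ | a - b * q ^ x = 0}.Finite := by
  refine Set.Subsingleton.finite fun x hx y hy => ?_
  simp only [Set.mem_ofPred_eq] at hx hy
  have hb : b ≠ 0 := by
    rintro rfl
    exact hab ⟨by simpa using hx, rfl⟩
  have h1 : q ^ x = q ^ y := mul_left_cancel₀ hb (by linarith)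
  have h2 := congrArg Real.log h1
  rw [Real.log_rpow hq, Real.log_rpow hq] at h2
  exact mul_right_cancel₀ (Real.log_ne_zero_of_pos_of_ne_one hq hq1) h2

theorem abs_ySign (q α β : ℝ) : |ySign q α β| = 1 := by
  unfold ySign
  split_ifs <;> norm_num

namespace Regime

variable {q α β γ δ L : ℝ} {M : ℕ → ℕ}

theorem finite_limUp_mul_limDown_eq_zero (h : Regime q α β γ δ L M) :
    {x : ℝ | 1 - γ * δ * q ^ (2 * x) ≠ 0 ∧ limUp q α β γ δ x * limDown q α β γ δ x = 0}.Finite := by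
  have hf := fun {a b : ℝ} (hab : ¬(a = 0 ∧ b = 0)) =>
    finite_setOf_sub_mul_rpow_eq_zero h.pos h.ne_one hab
  have h1 : ∀ b : ℝ, {x : ℝ | 1 - b * q ^ x = 0}.Finite := fun b => hf (by simp)
  have h2 : {x : ℝ | β - γ * q ^ x = 0}.Finite := hf fun h' => h.gamma_pos.ne' h'.2
  have h3 : {x : ℝ | α - γ * δ * q ^ x = 0}.Finite := hf fun h' =>
    h.alpha_or_delta_ne ⟨h'.1, (mul_eq_zero.1 h'.2).resolve_left h.gamma_pos.ne'⟩
  refine ((((h1 α).union (h1 (β * δ))).union ((h1 γ).union (h1 (γ * δ)))).union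
    (((h1 1).union (h1 δ)).union (h2.union h3))).subset ?_
  rintro x ⟨hx, h0⟩
  simp only [limUp, limDown, mul_eq_zero, div_eq_zero_iff, pow_eq_zero_iff two_ne_zero] at h0
  simp only [Set.mem_union, Set.mem_ofPred_eq, one_mul]
  have hx' : ¬(1 - γ * δ * q ^ (2 * x) = 0) := hx
  tauto

theorem finite_limA_mul_limC_eq_zero (h : Regime q α β γ δ L M) :
    {x : ℝ | x ≤ L ∧ limA q α β γ δ x * limC q α β γ δ x = 0}.Finite := by
  have hf := fun {a b : ℝ} (hab : ¬(a = 0 ∧ b = 0)) =>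
    finite_setOf_sub_mul_rpow_eq_zero h.pos h.ne_one hab
  have h1 : ∀ b : ℝ, {x : ℝ | 1 - b * q ^ x = 0}.Finite := fun b => hf (by simp)
  have h2 : {x : ℝ | γ - α * β * q ^ x = 0}.Finite := hf fun h' => h.gamma_pos.ne' h'.1
  have h3 : {x : ℝ | δ - α * q ^ x = 0}.Finite := hf fun h' => h.alpha_or_delta_ne ⟨h'.2, h'.1⟩
  refine ((((h1 γ).union (h1 α)).union ((h1 (α * β)).union (h1 (δ * β)))).union
    (((h1 1).union (h1 β)).union (h2.union h3))).subset ?_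
  rintro x ⟨hx, h0⟩
  simp only [limA, limC, mul_eq_zero, div_eq_zero_iff, pow_eq_zero_iff two_ne_zero] at h0
  simp only [Set.mem_union, Set.mem_ofPred_eq, one_mul]
  have hx' : ¬(1 - α * β * q ^ (2 * x) = 0) := h.sign_ne hx
  tauto

theorem mem_Icc_of_mem_Ioo (h : Regime q α β γ δ L M) {ξ : ℝ} (hξ : ξ ∈ Set.Ioo (0 : ℝ) 1) :
    ξ ∈ Set.Icc 0 L := ⟨hξ.1.le, hξ.2.le.trans h.one_lt.le⟩

theorem mem_bulkSet_iff (h : Regime q α β γ δ L M) (x ξ : ℝ) :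
    ξ ∈ bulkSet q α β γ δ x ↔ ξ ∈ Set.Ioo (0 : ℝ) 1 ∧ 0 ≤ disc q α β γ δ x ξ := by
  refine and_congr_right fun hξ => ?_
  have ha : 0 ≤ limOff q α β γ δ ξ := Real.sqrt_nonneg _
  rw [← h.disc_eq (h.mem_Icc_of_mem_Ioo hξ), sub_nonneg,
    show 4 * limOff q α β γ δ ξ ^ 2 = (2 * limOff q α β γ δ ξ) ^ 2 by ring, sq_le_sq,
    abs_of_nonneg (show 0 ≤ 2 * limOff q α β γ δ ξ by positivity), abs_le]
  constructor
  · rintro ⟨h1, h2⟩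
    constructor <;> linarith
  · rintro ⟨h1, h2⟩
    constructor <;> linarith

theorem sub_mul_sub_pos (h : Regime q α β γ δ L M) {a b ξ : ℝ} (hb : b ≤ L)
    (haξ : a < ξ) (hξb : ξ < b) :
    0 < (yFun q α β ξ - yFun q α β a) * (yFun q α β b - yFun q α β ξ) := by
  have h1 := h.ySign_mul_sub_pos haξ (hξb.le.trans hb)
  have h2 := h.ySign_mul_sub_pos hξb hb
  have h3 := mul_pos h1 h2
  have h4 := ySign_sq q α β
  have e : ySign q α β * (yFun q α β a - yFun q α β ξ)
      * (ySign q α β * (yFun q α β ξ - yFun q α β b))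
      = ySign q α β ^ 2 * ((yFun q α β ξ - yFun q α β a) * (yFun q α β b - yFun q α β ξ)) := by
    ring
  rwa [e, h4, one_mul] at h3

theorem sub_mul_sub_neg (h : Regime q α β γ δ L M) {a b ξ : ℝ} (hab : a < b) (hb : b ≤ L)
    (hξ : ξ ≤ L) (hout : ξ < a ∨ b < ξ) :
    (yFun q α β ξ - yFun q α β a) * (yFun q α β b - yFun q α β ξ) < 0 := by
  have h4 := ySign_sq q α β
  have e : ∀ u v : ℝ, ySign q α β * u * (ySign q α β * v) = u * v := by
    intro u v
    calc _ = ySign q α β ^ 2 * (u * v) := by ring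
      _ = _ := by rw [h4, one_mul]
  rcases hout with ho | ho
  · have h3 := mul_pos (h.ySign_mul_sub_pos ho (hab.le.trans hb))
      (h.ySign_mul_sub_pos (ho.trans hab) hb)
    rw [e] at h3
    linarith
  · have h3 := mul_pos (h.ySign_mul_sub_pos (hab.trans ho) hξ) (h.ySign_mul_sub_pos ho hξ)
    rw [e] at h3
    linarith

/-- The argument of the arccosine in the explicit density, at the upper end `t` of the bulk. -/
def angle (q α β ξm ξp t : ℝ) : ℝ :=
  Real.arccos (ySign q α β * ((2 * yFun q α β t - yFun q α β ξm - yFun q α β ξp) /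
    |yFun q α β ξm - yFun q α β ξp|))

theorem ySign_mul_div_abs (h : Regime q α β γ δ L M) {a b : ℝ} (hab : a < b) (hb : b ≤ L) :
    ySign q α β * ((yFun q α β a - yFun q α β b) / |yFun q α β a - yFun q α β b|) = 1 := by
  have h1 := h.ySign_mul_sub_pos hab hb
  have h2 := abs_ySign q α β
  have h3 : ySign q α β * (yFun q α β a - yFun q α β b) = |yFun q α β a - yFun q α β b| := by
    rw [← abs_of_pos h1, abs_mul, h2, one_mul]
  rw [← mul_div_assoc, h3, div_self]
  rw [← h3]
  exact h1.ne'

theorem angle_left (h : Regime q α β γ δ L M) {ξm ξp : ℝ} (hlt : ξm < ξp) (hp : ξp ≤ L) :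
    angle q α β ξm ξp ξm = 0 := by
  have := h.ySign_mul_div_abs hlt hp
  rw [angle, show 2 * yFun q α β ξm - yFun q α β ξm - yFun q α β ξp
    = yFun q α β ξm - yFun q α β ξp by ring, this, Real.arccos_one]

theorem angle_right (h : Regime q α β γ δ L M) {ξm ξp : ℝ} (hlt : ξm < ξp) (hp : ξp ≤ L) :
    angle q α β ξm ξp ξp = Real.pi := by
  have := h.ySign_mul_div_abs hlt hp
  rw [angle, show 2 * yFun q α β ξp - yFun q α β ξm - yFun q α β ξp
    = -(yFun q α β ξm - yFun q α β ξp) by ring, neg_div, mul_neg, this, Real.arccos_neg_one]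

/-- The derivative of the angle is the integrand of the density, up to the factor `|μ'(x)|` and in
the form that the factorization of the discriminant gives. -/
theorem hasDerivAt_angle (h : Regime q α β γ δ L M) {ξm ξp ξ : ℝ} (hp : ξp ≤ L)
    (h1 : ξm < ξ) (h2 : ξ < ξp) :
    HasDerivAt (angle q α β ξm ξp) (|Real.log q| * |(1 - α * β * q ^ (2 * ξ)) / q ^ ξ|
      / Real.sqrt ((yFun q α β ξ - yFun q α β ξm) * (yFun q α β ξp - yFun q α β ξ))) ξ := by
  have hP := h.sub_mul_sub_pos hp h1 h2
  have hd : 0 < |yFun q α β ξm - yFun q α β ξp| := by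
    refine abs_pos.2 fun h0 => ?_
    have := h.ySign_mul_sub_pos (h1.trans h2) hp
    rw [h0, mul_zero] at this
    exact lt_irrefl _ this
  have hε := ySign_sq q α β
  set d := |yFun q α β ξm - yFun q α β ξp| with hdd
  set P := (yFun q α β ξ - yFun q α β ξm) * (yFun q α β ξp - yFun q α β ξ) with hPP
  set u := ySign q α β * ((2 * yFun q α β ξ - yFun q α β ξm - yFun q α β ξp) / d) with hu
  have hd2 : d ^ 2 = (yFun q α β ξm - yFun q α β ξp) ^ 2 := sq_abs _
  have hu2 : 1 - u ^ 2 = 4 * P / d ^ 2 := by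
    rw [hu, mul_pow, hε, one_mul, div_pow]
    field_simp
    rw [hd2, hPP]
    ring
  have hsq : Real.sqrt (1 - u ^ 2) = 2 * Real.sqrt P / d := by
    rw [hu2, Real.sqrt_div (by positivity), Real.sqrt_sq hd.le, Real.sqrt_mul (by norm_num),
      show (4 : ℝ) = 2 ^ 2 by norm_num, Real.sqrt_sq (by norm_num)]
  have hu3 : 0 < 1 - u ^ 2 := by
    rw [hu2]
    positivity
  have hne1 : u ≠ -1 := by
    intro h0
    rw [h0] at hu3
    norm_num at hu3
  have hne2 : u ≠ 1 := by
    intro h0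
    rw [h0] at hu3
    norm_num at hu3
  have hy := hasDerivAt_yFun h.pos α β ξ
  have hdu : HasDerivAt (fun t => ySign q α β *
      ((2 * yFun q α β t - yFun q α β ξm - yFun q α β ξp) / d))
      (ySign q α β * (2 * -(Real.log q * ((1 - α * β * q ^ (2 * ξ)) / q ^ ξ)) / d)) ξ :=
    ((((hy.const_mul 2).sub_const _).sub_const _).div_const _).const_mul _
  have hG := (Real.hasDerivAt_arccos hne1 hne2).comp ξ hdu
  refine hG.congr_deriv ?_
  have hs : |Real.log q| * |(1 - α * β * q ^ (2 * ξ)) / q ^ ξ|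
      = ySign q α β * (Real.log q * ((1 - α * β * q ^ (2 * ξ)) / q ^ ξ)) := by
    have hQ := Real.rpow_pos_of_pos h.pos ξ
    have hpos := div_pos (h.ySign_mul_pos (ξ := ξ) (h2.le.trans hp)) hQ
    have e : ySign q α β * (Real.log q * ((1 - α * β * q ^ (2 * ξ)) / q ^ ξ))
        = ySign q α β * (Real.log q * (1 - α * β * q ^ (2 * ξ))) / q ^ ξ := by ring
    rw [← abs_mul, e, ← abs_of_pos hpos, ← e, abs_mul (ySign q α β), abs_ySign, one_mul]
  rw [hs, hsq]
  have hsP := Real.sqrt_pos.2 hP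
  field_simp

theorem continuous_angle (h : Regime q α β γ δ L M) (ξm ξp : ℝ) :
    Continuous (angle q α β ξm ξp) := by
  have := continuous_yFun h.pos α β
  unfold angle
  exact Real.continuous_arccos.comp (continuous_const.mul
    ((((continuous_const.mul this).sub continuous_const).sub continuous_const).div_const _))

/-- The density is an angle, by integrating the derivative of the arccosine over the bulk. -/
theorem density_eq_angle (h : Regime q α β γ δ L M) {x ξm ξp : ℝ}
    (hH : 1 - γ * δ * q ^ (2 * x) ≠ 0) (hm : 0 ≤ ξm) (hp : ξp ≤ L) (hlt : ξm < ξp) (hm1 : ξm < 1)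
    (hfac : ∀ ξ ≤ L, disc q α β γ δ x ξ * ((1 - α * β * q ^ (2 * ξ)) / q ^ ξ) ^ 2
        = ((1 - γ * δ * q ^ (2 * x)) / q ^ x) ^ 2
          * ((yFun q α β ξ - yFun q α β ξm) * (yFun q α β ξp - yFun q α β ξ))) :
    density q α β γ δ x = 1 / Real.pi * angle q α β ξm ξp (min ξp 1) := by
  set t := min ξp 1 with ht
  have hmt : ξm < t := lt_min hlt hm1
  have hX := Real.rpow_pos_of_pos h.pos x
  have hHX : 0 < |(1 - γ * δ * q ^ (2 * x)) / q ^ x| := abs_pos.2 (div_ne_zero hH hX.ne')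
  have hEQ : ∀ {ξ}, ξ ≤ L → 0 < |(1 - α * β * q ^ (2 * ξ)) / q ^ ξ| := fun {ξ} hξ =>
    abs_pos.2 (div_ne_zero (h.sign_ne hξ) (Real.rpow_pos_of_pos h.pos ξ).ne')
  have hbulk : bulkSet q α β γ δ x = Set.Icc ξm ξp ∩ Set.Ioo 0 1 := by
    ext ξ
    rw [h.mem_bulkSet_iff, Set.mem_inter_iff, and_comm]
    refine and_congr_left fun hξ => ?_
    have hξL := (h.mem_Icc_of_mem_Ioo hξ).2
    have h1 := hfac ξ hξL
    rw [← sq_abs (_ / q ^ ξ), ← sq_abs (_ / q ^ x)] at h1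
    have h2 : 0 ≤ disc q α β γ δ x ξ ↔
        0 ≤ (yFun q α β ξ - yFun q α β ξm) * (yFun q α β ξp - yFun q α β ξ) := by
      rw [← mul_nonneg_iff_of_pos_right (pow_pos (hEQ hξL) 2), h1,
        mul_nonneg_iff_of_pos_left (pow_pos hHX 2)]
    rw [h2]
    constructor
    · intro h3
      by_contra hout
      rw [Set.mem_Icc, not_and_or, not_le, not_le] at hout
      exact (h.sub_mul_sub_neg hlt hp hξL hout).not_ge h3
    · rintro ⟨h3, h4⟩
      rcases h3.eq_or_lt with rfl | h3
      · simp
      · rcases h4.eq_or_lt with rfl | h4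
        · simp
        · exact (h.sub_mul_sub_pos hp h3 h4).le
  have hae : (bulkSet q α β γ δ x : Set ℝ) =ᵐ[volume] Set.Ioc ξm t := by
    have h1 : Set.Ioo ξm ξp ∩ Set.Ioo 0 1 = Set.Ioo ξm t := by
      rw [Set.Ioo_inter_Ioo, max_eq_left hm]
    rw [hbulk]
    refine (Ioo_ae_eq_Icc.symm.inter (ae_eq_refl _)).trans ?_
    rw [h1]
    exact Ioo_ae_eq_Ioc
  have htL : t ≤ L := (min_le_left _ _).trans hp
  have hμ : |deriv (mu q γ δ) x| = |Real.log q| * |(1 - γ * δ * q ^ (2 * x)) / q ^ x| := by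
    rw [(hasDerivAt_mu h.pos γ δ x).deriv, abs_neg, abs_mul]
  have hderiv : ∀ ξ ∈ Set.Ioo ξm t, HasDerivAt (angle q α β ξm ξp)
      (|deriv (mu q γ δ) x| * (1 / Real.sqrt (disc q α β γ δ x ξ))) ξ := by
    rintro ξ ⟨h1, h2⟩
    have h3 : ξ < ξp := h2.trans_le (min_le_left _ _)
    have hξL : ξ ≤ L := h3.le.trans hp
    refine (h.hasDerivAt_angle hp h1 h3).congr_deriv ?_
    have hP := h.sub_mul_sub_pos hp h1 h3
    have hE := hEQ hξL
    have h4 := hfac ξ hξL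
    rw [← sq_abs (_ / q ^ ξ), ← sq_abs (_ / q ^ x)] at h4
    rw [hμ]
    set P := (yFun q α β ξ - yFun q α β ξm) * (yFun q α β ξp - yFun q α β ξ)
    set E := |(1 - α * β * q ^ (2 * ξ)) / q ^ ξ|
    set H := |(1 - γ * δ * q ^ (2 * x)) / q ^ x|
    have h5 : disc q α β γ δ x ξ = H ^ 2 * P / E ^ 2 := by
      rw [← h4]
      field_simp
    have h6 : Real.sqrt (disc q α β γ δ x ξ) = H * Real.sqrt P / E := by
      rw [h5, Real.sqrt_div (by positivity), Real.sqrt_sq hE.le, Real.sqrt_mul (by positivity),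
        Real.sqrt_sq hHX.le]
    rw [h6]
    have := Real.sqrt_pos.2 hP
    field_simp
  have hint := intervalIntegral.integrableOn_deriv_of_nonneg
    (h.continuous_angle ξm ξp).continuousOn hderiv fun ξ _ => by positivity
  have hFTC := intervalIntegral.integral_eq_sub_of_hasDerivAt_of_le hmt.le
    (h.continuous_angle ξm ξp).continuousOn hderiv
    ((intervalIntegrable_iff_integrableOn_Ioc_of_le hmt.le).2 hint)
  rw [h.angle_left hlt hp, sub_zero, intervalIntegral.integral_of_le hmt.le,
    integral_const_mul] at hFTC
  rw [← hFTC, density, setIntegral_congr_set hae]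
  have hcongr : ∫ ξ in Set.Ioc ξm t, 1 / Real.sqrt (4 * limOff q α β γ δ ξ ^ 2
        - (mu q γ δ x - limDiag q α β γ δ ξ) ^ 2)
      = ∫ ξ in Set.Ioc ξm t, 1 / Real.sqrt (disc q α β γ δ x ξ) := by
    refine setIntegral_congr_fun measurableSet_Ioc fun ξ hξ => ?_
    rw [h.disc_eq ⟨hm.trans hξ.1.le, hξ.2.trans htL⟩]
  rw [hcongr]
  ring

theorem density_eq_zero (h : Regime q α β γ δ L M) {x ξm ξp : ℝ}
    (hp : ξp ≤ L) (hlt : ξm < ξp) (hm1 : 1 ≤ ξm)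
    (hfac : ∀ ξ ≤ L, disc q α β γ δ x ξ * ((1 - α * β * q ^ (2 * ξ)) / q ^ ξ) ^ 2
        = ((1 - γ * δ * q ^ (2 * x)) / q ^ x) ^ 2
          * ((yFun q α β ξ - yFun q α β ξm) * (yFun q α β ξp - yFun q α β ξ)))
    (hH : 1 - γ * δ * q ^ (2 * x) ≠ 0) :
    density q α β γ δ x = 0 := by
  have hbulk : bulkSet q α β γ δ x = ∅ := by
    ext ξ
    rw [h.mem_bulkSet_iff]
    simp only [Set.mem_empty_iff_false, iff_false, not_and]
    intro hξ h0
    have hξL := (h.mem_Icc_of_mem_Ioo hξ).2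
    have hX := (Real.rpow_pos_of_pos h.pos x).ne'
    have h2 : 0 < ((1 - γ * δ * q ^ (2 * x)) / q ^ x) ^ 2 := by positivity
    have h3 := mul_neg_of_pos_of_neg h2
      (h.sub_mul_sub_neg hlt hp hξL (Or.inl (hξ.2.trans_le hm1)))
    rw [← hfac ξ hξL] at h3
    exact h3.not_ge (mul_nonneg h0 (sq_nonneg _))
  rw [density, hbulk]
  simp

theorem exists_solutions (h : Regime q α β γ δ L M) : ∃ ξm ξp : ℝ → ℝ,
    (∀ x ∈ Set.Icc 0 L, deriv (mu q γ δ) x ≠ 0 →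
      ξm x ∈ Set.Icc 0 L ∧ ξp x ∈ Set.Icc 0 L ∧ ξm x ≤ ξp x ∧
      (∀ ξ ∈ Set.Icc 0 L,
        4 * limOff q α β γ δ ξ ^ 2 - (mu q γ δ x - limDiag q α β γ δ ξ) ^ 2 = 0
          ↔ ξ = ξm x ∨ ξ = ξp x) ∧
      (ξm x < ξp x → ξp x ≤ 1 → density q α β γ δ x = 1) ∧
      (ξm x < 1 → 1 < ξp x → density q α β γ δ x =
        1 / Real.pi * Real.arccos (ySign q α β *
          ((2 * yFun q α β 1 - yFun q α β (ξm x) - yFun q α β (ξp x)) /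
            |yFun q α β (ξm x) - yFun q α β (ξp x)|))) ∧
      (1 ≤ ξm x → ξm x < ξp x → density q α β γ δ x = 0)) ∧
    {x | x ∈ Set.Icc 0 L ∧ deriv (mu q γ δ) x ≠ 0 ∧ ξm x = ξp x}.Finite := by
  have hex : ∀ x : ℝ, ∃ ξm ξp : ℝ, x ∈ Set.Icc 0 L → 1 - γ * δ * q ^ (2 * x) ≠ 0 →
      ξm ∈ Set.Icc 0 L ∧ ξp ∈ Set.Icc 0 L ∧ ξm ≤ ξp ∧
      (∀ ξ ≤ L, disc q α β γ δ x ξ * ((1 - α * β * q ^ (2 * ξ)) / q ^ ξ) ^ 2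
        = ((1 - γ * δ * q ^ (2 * x)) / q ^ x) ^ 2
          * ((yFun q α β ξ - yFun q α β ξm) * (yFun q α β ξp - yFun q α β ξ))) ∧
      (ξm = ξp → limUp q α β γ δ x * limDown q α β γ δ x = 0) := by
    intro x
    by_cases hx : x ∈ Set.Icc 0 L ∧ 1 - γ * δ * q ^ (2 * x) ≠ 0
    · obtain ⟨ξm, h1, ξp, h2, h3⟩ := h.exists_roots hx.1 hx.2
      exact ⟨ξm, ξp, fun _ _ => ⟨h1, h2, h3⟩⟩
    · exact ⟨0, 0, fun h1 h2 => absurd ⟨h1, h2⟩ hx⟩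
  choose ξm ξp hroots using hex
  refine ⟨ξm, ξp, fun x hx hd => ?_, ?_⟩
  · have hH := (h.deriv_mu_ne_iff x).1 hd
    obtain ⟨hm, hp, hle, hfac, -⟩ := hroots x hx hH
    refine ⟨hm, hp, hle, fun ξ hξ => ?_, fun hlt hp1 => ?_, fun hm1 hp1 => ?_,
      fun hm1 hlt => h.density_eq_zero hp.2 hlt hm1 hfac hH⟩
    · rw [h.disc_eq hξ]
      have hX := (Real.rpow_pos_of_pos h.pos x).ne'
      have hQ := (Real.rpow_pos_of_pos h.pos ξ).ne'
      have h1 : ((1 - α * β * q ^ (2 * ξ)) / q ^ ξ) ^ 2 ≠ 0 :=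
        pow_ne_zero 2 (div_ne_zero (h.sign_ne hξ.2) hQ)
      have h2 : ((1 - γ * δ * q ^ (2 * x)) / q ^ x) ^ 2 ≠ 0 :=
        pow_ne_zero 2 (div_ne_zero hH hX)
      have h3 : disc q α β γ δ x ξ = 0 ↔
          (yFun q α β ξ - yFun q α β (ξm x)) * (yFun q α β (ξp x) - yFun q α β ξ) = 0 := by
        rw [← mul_eq_zero_iff_right h1, hfac ξ hξ.2, mul_eq_zero_iff_left h2]
      rw [h3, mul_eq_zero, sub_eq_zero, sub_eq_zero]
      exact or_congr ⟨fun he => h.yFun_injOn hξ hm he, fun he => by rw [he]⟩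
        ⟨fun he => h.yFun_injOn hξ hp he.symm, fun he => by rw [he]⟩
    · rcases lt_or_ge (ξm x) 1 with hm1 | hm1
      · rw [h.density_eq_angle hH hm.1 hp.2 hlt hm1 hfac, min_eq_left hp1, h.angle_right hlt hp.2,
          one_div_mul_cancel Real.pi_ne_zero]
      · linarith
    · rw [h.density_eq_angle hH hm.1 hp.2 (hm1.trans hp1) hm1 hfac, min_eq_right hp1.le, angle]
  · refine h.finite_limUp_mul_limDown_eq_zero.subset ?_
    rintro x ⟨hx, hd, he⟩
    have hH := (h.deriv_mu_ne_iff x).1 hd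
    exact ⟨hH, (hroots x hx hH).2.2.2.2 he⟩

end Regime

end

end QRacah

namespace QRacah

noncomputable section

/-! ### The density as a mixture of arcsine laws -/

/-- The arcsine kernel in an unnormalized form, `g(s) / √(4a² - (s - b)²)`. It vanishes for
`|s - b| ≥ 2a`, since then the square root is `0`. -/
def arcsineKernel (a b : ℝ) (g : ℝ → ℝ) (s : ℝ) : ℝ :=
  g s * (1 / Real.sqrt (4 * a ^ 2 - (s - b) ^ 2))

theorem arcsineKernel_eq_zero {a b : ℝ} (ha : 0 < a) (g : ℝ → ℝ) {s : ℝ}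
    (hs : s ∉ Set.Ioo (b - 2 * a) (b + 2 * a)) : arcsineKernel a b g s = 0 := by
  rw [arcsineKernel, Real.sqrt_eq_zero_of_nonpos, div_zero, mul_zero]
  rw [sub_nonpos, show 4 * a ^ 2 = (2 * a) ^ 2 by ring]
  rw [sq_le_sq, abs_of_pos (by positivity : 0 < 2 * a)]
  by_contra hcon
  rw [not_le, abs_lt] at hcon
  exact hs ⟨by linarith [hcon.1], by linarith [hcon.2]⟩

theorem image_cos (a b : ℝ) (ha : 0 < a) :
    (fun θ => b + 2 * a * Real.cos θ) '' Set.Ioo 0 Real.pi = Set.Ioo (b - 2 * a) (b + 2 * a) := by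
  ext s
  constructor
  · rintro ⟨θ, hθ, rfl⟩
    have h1 := Real.strictAntiOn_cos (Set.left_mem_Icc.2 Real.pi_pos.le)
      (Set.Ioo_subset_Icc_self hθ) hθ.1
    have h2 := Real.strictAntiOn_cos (Set.Ioo_subset_Icc_self hθ)
      (Set.right_mem_Icc.2 Real.pi_pos.le) hθ.2
    rw [Real.cos_zero] at h1
    rw [Real.cos_pi] at h2
    constructor <;> simp only <;> nlinarith
  · rintro ⟨h1, h2⟩
    have hu1 : -1 < (s - b) / (2 * a) := by
      rw [lt_div_iff₀ (by positivity)]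
      linarith
    have hu2 : (s - b) / (2 * a) < 1 := by
      rw [div_lt_iff₀ (by positivity)]
      linarith
    refine ⟨Real.arccos ((s - b) / (2 * a)), ⟨Real.arccos_pos.2 hu2, ?_⟩, ?_⟩
    · exact lt_of_le_of_ne (Real.arccos_le_pi _) fun h0 => hu1.not_ge (Real.arccos_eq_pi.1 h0)
    · simp only
      rw [Real.cos_arccos hu1.le hu2.le]
      field_simp
      ring

/-- The substitution `s = b + 2a cos θ`. -/
theorem arcsineKernel_substitution (a b : ℝ) (ha : 0 < a) (g : ℝ → ℝ) :
    (IntegrableOn (arcsineKernel a b g) (Set.Ioo (b - 2 * a) (b + 2 * a)) ↔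
      IntegrableOn (fun θ => g (b + 2 * a * Real.cos θ)) (Set.Ioo 0 Real.pi)) ∧
    ∫ s in Set.Ioo (b - 2 * a) (b + 2 * a), arcsineKernel a b g s
      = ∫ θ in Set.Ioo 0 Real.pi, g (b + 2 * a * Real.cos θ) := by
  have hd : ∀ θ ∈ Set.Ioo 0 Real.pi, HasDerivWithinAt (fun θ => b + 2 * a * Real.cos θ)
      (2 * a * -Real.sin θ) (Set.Ioo 0 Real.pi) θ := fun θ _ =>
    (((Real.hasDerivAt_cos θ).const_mul (2 * a)).const_add b).hasDerivWithinAt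
  have hinj : Set.InjOn (fun θ => b + 2 * a * Real.cos θ) (Set.Ioo 0 Real.pi) := by
    intro x hx y hy hxy
    refine Real.injOn_cos (Set.Ioo_subset_Icc_self hx) (Set.Ioo_subset_Icc_self hy) ?_
    simp only at hxy
    exact mul_left_cancel₀ (by positivity : 2 * a ≠ 0) (by linarith)
  have hval : ∀ θ ∈ Set.Ioo 0 Real.pi, |2 * a * -Real.sin θ| • arcsineKernel a b g
      (b + 2 * a * Real.cos θ) = g (b + 2 * a * Real.cos θ) := by
    intro θ hθ
    have hs := Real.sin_pos_of_mem_Ioo hθ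
    have e : 4 * a ^ 2 - (b + 2 * a * Real.cos θ - b) ^ 2 = (2 * a * Real.sin θ) ^ 2 := by
      have := Real.sin_sq_add_cos_sq θ
      linear_combination -4 * a ^ 2 * this
    rw [arcsineKernel, e, Real.sqrt_sq (by positivity), mul_neg, abs_neg,
      abs_of_pos (by positivity), smul_eq_mul]
    field_simp
  rw [← image_cos a b ha]
  constructor
  · rw [integrableOn_image_iff_integrableOn_abs_deriv_smul measurableSet_Ioo hd hinj]
    exact integrableOn_congr_fun hval measurableSet_Ioo
  · rw [integral_image_eq_integral_abs_deriv_smul measurableSet_Ioo hd hinj]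
    exact setIntegral_congr_fun measurableSet_Ioo hval

namespace Regime

variable {q α β γ δ L : ℝ} {M : ℕ → ℕ}

/-- As `μ'` has no zero inside `(0, L)`, the map `μ` is injective on `[0, L]`. -/
theorem mu_injOn (h : Regime q α β γ δ L M) : Set.InjOn (mu q γ δ) (Set.Icc 0 L) := by
  -- `μ(x) = μ(y)` with `x < y` makes `1 - γδ q^(2t)` vanish at the midpoint
  have key : ∀ x ∈ Set.Icc 0 L, ∀ y ∈ Set.Icc 0 L, x < y → mu q γ δ x ≠ mu q γ δ y := by
    intro x hx y hy hxy he
    refine h.mu_factor_ne (x := (x + y) / 2) ⟨by linarith [hx.1], by linarith [hy.2]⟩ ?_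
    have h1 := h.log_mul_rpow_sub_pos hxy
    have hne : q ^ y - q ^ x ≠ 0 := fun h0 => by simp [h0] at h1
    have hX := Real.rpow_pos_of_pos h.pos x
    have hY := Real.rpow_pos_of_pos h.pos y
    rw [show 2 * ((x + y) / 2) = x + y by ring, Real.rpow_add h.pos]
    simp only [mu, Real.rpow_neg h.pos.le] at he
    refine (mul_eq_zero.1 (?_ : (q ^ y - q ^ x) * (1 - γ * δ * (q ^ x * q ^ y)) = 0)).resolve_left
      hne
    field_simp at he
    linarith
  intro x hx y hy he
  by_contra hne
  rcases lt_or_gt_of_ne hne with h1 | h1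
  · exact key x hx y hy h1 he
  · exact key y hy x hx h1 he.symm

/-- Each arcsine law lives inside the range of `μ` on `(0, L)`, since the discriminant is nonpositive
at both ends. -/
theorem Ioo_subset_image_mu (h : Regime q α β γ δ L M) {ξ : ℝ} (hξ : ξ ∈ Set.Icc 0 L) :
    Set.Ioo (limDiag q α β γ δ ξ - 2 * limOff q α β γ δ ξ)
      (limDiag q α β γ δ ξ + 2 * limOff q α β γ δ ξ) ⊆ mu q γ δ '' Set.Ioo 0 L := by
  intro s hs
  have ha : 0 ≤ limOff q α β γ δ ξ := Real.sqrt_nonneg _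
  have h0 := disc_zero_nonpos q α β γ δ ξ
  have hL := h.disc_L_nonpos hξ.2
  rw [← h.disc_eq hξ] at h0 hL
  obtain ⟨hp, hm⟩ := sq_le_of_mem_uIcc (r := 2 * limOff q α β γ δ ξ) (by positivity)
    (h.limDiag_mem hξ) (by linarith) (by linarith)
  have hs' : s ∈ Set.uIcc (mu q γ δ 0) (mu q γ δ L) :=
    Set.ordConnected_uIcc.out hm hp (Set.Ioo_subset_Icc_self hs)
  have hivt := intermediate_value_uIcc (a := 0) (b := L) (continuous_mu h.pos γ δ).continuousOn
  obtain ⟨x, hx, rfl⟩ := hivt hs'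
  rw [Set.uIcc_of_le h.L_pos.le] at hx
  have hpos : 0 < 4 * limOff q α β γ δ ξ ^ 2 - (mu q γ δ x - limDiag q α β γ δ ξ) ^ 2 := by
    rw [sub_pos, show 4 * limOff q α β γ δ ξ ^ 2 = (2 * limOff q α β γ δ ξ) ^ 2 by ring]
    exact sq_lt_sq' (by linarith [hs.1]) (by linarith [hs.2])
  refine ⟨x, ⟨lt_of_le_of_ne hx.1 ?_, lt_of_le_of_ne hx.2 ?_⟩, rfl⟩
  · rintro rfl
    linarith
  · rintro rfl
    linarith

/-- The integrand of the density at `ξ`, as a function of `x`; the square root is `0`, and hence the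
slice vanishes, outside the bulk. -/
def slice (q α β γ δ ξ x : ℝ) : ℝ :=
  |deriv (mu q γ δ) x| / Real.pi *
    (1 / Real.sqrt (4 * limOff q α β γ δ ξ ^ 2 - (mu q γ δ x - limDiag q α β γ δ ξ) ^ 2))

theorem slice_nonneg (ξ x : ℝ) : 0 ≤ slice q α β γ δ ξ x := by
  unfold slice
  positivity

/-- Each slice is the arcsine law on `[b - 2a, b + 2a]` in the variable `μ(x)`. -/
theorem integral_slice (h : Regime q α β γ δ L M) {ξ : ℝ} (hξ : ξ ∈ Set.Icc 0 L)
    (ha : limA q α β γ δ ξ * limC q α β γ δ ξ ≠ 0) {g : ℝ → ℝ} (hg : Continuous g) :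
    IntegrableOn (fun x => g (mu q γ δ x) * slice q α β γ δ ξ x) (Set.Ioo 0 L) ∧
    ∫ x in Set.Ioo 0 L, g (mu q γ δ x) * slice q α β γ δ ξ x
      = 1 / Real.pi * ∫ θ in Set.Ioo 0 Real.pi,
        g (limDiag q α β γ δ ξ + 2 * limOff q α β γ δ ξ * Real.cos θ) := by
  have ha' : 0 < limOff q α β γ δ ξ :=
    Real.sqrt_pos.2 (lt_of_le_of_ne (h.limA_mul_limC_nonneg hξ) ha.symm)
  set a := limOff q α β γ δ ξ with hadef
  set b := limDiag q α β γ δ ξ with hbdef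
  have hd : ∀ x ∈ Set.Ioo 0 L, HasDerivWithinAt (mu q γ δ) (deriv (mu q γ δ) x)
      (Set.Ioo 0 L) x := fun x _ =>
    (hasDerivAt_mu h.pos γ δ x).differentiableAt.hasDerivAt.hasDerivWithinAt
  have hinj : Set.InjOn (mu q γ δ) (Set.Ioo 0 L) := h.mu_injOn.mono Set.Ioo_subset_Icc_self
  have hsub := h.Ioo_subset_image_mu hξ
  rw [← hadef, ← hbdef] at hsub
  have hval : ∀ x, g (mu q γ δ x) * slice q α β γ δ ξ x
      = 1 / Real.pi * (|deriv (mu q γ δ) x| • arcsineKernel a b g (mu q γ δ x)) := by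
    intro x
    rw [slice, arcsineKernel, smul_eq_mul]
    ring
  have hzero : ∀ s ∈ mu q γ δ '' Set.Ioo 0 L \ Set.Ioo (b - 2 * a) (b + 2 * a),
      arcsineKernel a b g s = 0 := fun s hs => arcsineKernel_eq_zero ha' g hs.2
  have hmeas : MeasurableSet (mu q γ δ '' Set.Ioo 0 L) :=
    measurable_image_of_fderivWithin measurableSet_Ioo
      (fun x hx => (hd x hx).hasFDerivWithinAt) hinj
  obtain ⟨hi, he⟩ := arcsineKernel_substitution a b ha' g
  have hcont : IntegrableOn (fun θ => g (b + 2 * a * Real.cos θ)) (Set.Ioo 0 Real.pi) := by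
    have : Continuous fun θ => g (b + 2 * a * Real.cos θ) := by fun_prop
    exact (this.continuousOn.integrableOn_Icc).mono_set Set.Ioo_subset_Icc_self
  simp only [hval]
  constructor
  · refine Integrable.const_mul ?_ _
    rw [← IntegrableOn, ← integrableOn_image_iff_integrableOn_abs_deriv_smul measurableSet_Ioo hd
      hinj]
    exact (hi.2 hcont).of_forall_sdiff_eq_zero hmeas hzero
  · rw [integral_const_mul, ← integral_image_eq_integral_abs_deriv_smul measurableSet_Ioo hd hinj,
      setIntegral_eq_of_subset_of_forall_sdiff_eq_zero hmeas hsub hzero, he]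

theorem measurable_slice (h : Regime q α β γ δ L M) :
    Measurable fun z : ℝ × ℝ => slice q α β γ δ z.1 z.2 := by
  have h1 : deriv (mu q γ δ) = fun x => -(Real.log q * ((1 - γ * δ * q ^ (2 * x)) / q ^ x)) := by
    ext x
    exact (hasDerivAt_mu h.pos γ δ x).deriv
  unfold slice limOff limDiag limA limC mu
  change Measurable fun z : ℝ × ℝ => |deriv (mu q γ δ) z.2| / _ * _
  rw [h1]
  fun_prop

theorem density_eq_integral_slice (h : Regime q α β γ δ L M) (x : ℝ) :
    density q α β γ δ x = ∫ ξ in Set.Ioo (0 : ℝ) 1, slice q α β γ δ ξ x := by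
  unfold slice density
  rw [integral_const_mul]
  congr 1
  refine (setIntegral_eq_of_subset_of_forall_sdiff_eq_zero measurableSet_Ioo
    (fun ξ hξ => hξ.1) ?_).symm
  rintro ξ ⟨h1, h2⟩
  rw [h.mem_bulkSet_iff, not_and, not_le] at h2
  rw [h.disc_eq (h.mem_Icc_of_mem_Ioo h1), Real.sqrt_eq_zero_of_nonpos (h2 h1).le, div_zero]

theorem ae_limA_mul_limC_ne (h : Regime q α β γ δ L M) :
    ∀ᵐ ξ ∂(volume.restrict (Set.Ioo (0 : ℝ) 1)),
      ξ ∈ Set.Icc 0 L ∧ limA q α β γ δ ξ * limC q α β γ δ ξ ≠ 0 := by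
  have h1 := ae_restrict_of_ae (s := Set.Ioo (0 : ℝ) 1)
    (compl_mem_ae_iff.2 (h.finite_limA_mul_limC_eq_zero.measure_zero volume))
  filter_upwards [h1, ae_restrict_mem measurableSet_Ioo] with ξ h2 h3
  have h4 := h.mem_Icc_of_mem_Ioo h3
  exact ⟨h4, fun h0 => h2 ⟨h4.2, h0⟩⟩

theorem integrable_slice (h : Regime q α β γ δ L M) :
    Integrable (fun z : ℝ × ℝ => slice q α β γ δ z.1 z.2)
      ((volume.restrict (Set.Ioo (0 : ℝ) 1)).prod (volume.restrict (Set.Ioo 0 L))) := by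
  rw [integrable_prod_iff h.measurable_slice.aestronglyMeasurable]
  constructor
  · filter_upwards [h.ae_limA_mul_limC_ne] with ξ hξ
    have h1 := (h.integral_slice hξ.1 hξ.2 (continuous_const (y := (1 : ℝ)))).1
    simp only [one_mul] at h1
    exact h1
  · refine (integrable_const (1 : ℝ)).congr ?_
    filter_upwards [h.ae_limA_mul_limC_ne] with ξ hξ
    have h1 := (h.integral_slice hξ.1 hξ.2 (continuous_const (y := (1 : ℝ)))).2
    simp only [one_mul, integral_const, smul_eq_mul, mul_one] at h1
    simp only [Real.norm_of_nonneg (slice_nonneg _ _)]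
    rw [h1]
    simp [Real.pi_pos.le, Real.pi_ne_zero]

theorem integrableOn_density (h : Regime q α β γ δ L M) :
    IntegrableOn (density q α β γ δ) (Set.Ioo 0 L) := by
  have h1 := h.integrable_slice.integral_prod_right
  exact h1.congr (Eventually.of_forall fun x => (h.density_eq_integral_slice x).symm)

theorem density_nonneg (h : Regime q α β γ δ L M) (x : ℝ) : 0 ≤ density q α β γ δ x := by
  rw [h.density_eq_integral_slice]
  exact integral_nonneg fun ξ => slice_nonneg _ _

/-- The density in the variable `μ(x)` is a mixture of arcsine laws. -/
theorem integral_mu_mul_density (h : Regime q α β γ δ L M) {g : ℝ → ℝ} (hg : Continuous g) :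
    ∫ x in Set.Ioo 0 L, g (mu q γ δ x) * density q α β γ δ x
      = ∫ ξ in Set.Ioo (0 : ℝ) 1, 1 / Real.pi * ∫ θ in Set.Ioo 0 Real.pi,
        g (limDiag q α β γ δ ξ + 2 * limOff q α β γ δ ξ * Real.cos θ) := by
  have hgm : Continuous fun x => g (mu q γ δ x) := hg.comp (continuous_mu h.pos γ δ)
  obtain ⟨K, hK⟩ := (isCompact_Icc (a := (0 : ℝ)) (b := L)).exists_bound_of_continuousOn
    hgm.continuousOn
  have hint : Integrable (fun z : ℝ × ℝ => g (mu q γ δ z.2) * slice q α β γ δ z.1 z.2)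
      ((volume.restrict (Set.Ioo (0 : ℝ) 1)).prod (volume.restrict (Set.Ioo 0 L))) := by
    refine h.integrable_slice.bdd_mul (c := K)
      (hgm.comp continuous_snd).aestronglyMeasurable ?_
    rw [Measure.prod_restrict]
    filter_upwards [ae_restrict_mem (measurableSet_Ioo.prod measurableSet_Ioo)] with z hz
    exact hK _ (Set.Ioo_subset_Icc_self hz.2)
  have hswap := integral_integral_swap (f := fun ξ x => g (mu q γ δ x) * slice q α β γ δ ξ x) hint
  have h1 : ∀ x, ∫ ξ in Set.Ioo (0 : ℝ) 1, g (mu q γ δ x) * slice q α β γ δ ξ x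
      = g (mu q γ δ x) * density q α β γ δ x := by
    intro x
    rw [integral_const_mul, h.density_eq_integral_slice]
  simp only [h1] at hswap
  rw [← hswap]
  refine integral_congr_ae ?_
  filter_upwards [h.ae_limA_mul_limC_ne] with ξ hξ
  exact (h.integral_slice hξ.1 hξ.2 hg).2

end Regime

end

end QRacah

namespace QRacah

noncomputable section

/-! ### Limits of the mean moments -/

/-- The entries of the `m`-th power of the doubly infinite Jacobi matrix with constant diagonal `b`
and constant off-diagonal `a`, on the `l`-th diagonal, by its spectral resolution. -/
def limMoment (a b : ℝ) (m : ℕ) (l : ℤ) : ℝ :=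
  1 / Real.pi * ∫ θ in Set.Ioo 0 Real.pi, Real.cos (l * θ) * (b + 2 * a * Real.cos θ) ^ m

theorem limMoment_zero (a b : ℝ) (l : ℤ) : limMoment a b 0 l = if l = 0 then 1 else 0 := by
  unfold limMoment
  rw [← integral_Ioc_eq_integral_Ioo, ← intervalIntegral.integral_of_le Real.pi_pos.le]
  split_ifs with hl
  · simp [hl, Real.pi_ne_zero]
  · have hl' : (l : ℝ) ≠ 0 := by exact_mod_cast hl
    simp only [pow_zero, mul_one]
    rw [intervalIntegral.integral_comp_mul_left (fun x => Real.cos x) hl']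
    simp [Real.sin_int_mul_pi]

/-- The three-term recurrence, from `2 cos θ cos lθ = cos (l - 1)θ + cos (l + 1)θ`. -/
theorem limMoment_succ (a b : ℝ) (m : ℕ) (l : ℤ) : limMoment a b (m + 1) l
    = a * limMoment a b m (l - 1) + b * limMoment a b m l + a * limMoment a b m (l + 1) := by
  have hint : ∀ (k : ℤ) (c : ℝ), Integrable (fun θ : ℝ => c *
      (Real.cos (k * θ) * (b + 2 * a * Real.cos θ) ^ m)) (volume.restrict (Set.Ioo 0 Real.pi)) := by
    intro k c
    have : Continuous fun θ : ℝ => c * (Real.cos (k * θ) * (b + 2 * a * Real.cos θ) ^ m) := by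
      fun_prop
    exact (this.integrableOn_Icc (a := 0) (b := Real.pi)).mono_set Set.Ioo_subset_Icc_self
  have e : ∀ θ : ℝ, Real.cos (l * θ) * (b + 2 * a * Real.cos θ) ^ (m + 1)
      = a * (Real.cos ((l - 1 : ℤ) * θ) * (b + 2 * a * Real.cos θ) ^ m)
        + b * (Real.cos (l * θ) * (b + 2 * a * Real.cos θ) ^ m)
        + a * (Real.cos ((l + 1 : ℤ) * θ) * (b + 2 * a * Real.cos θ) ^ m) := by
    intro θ
    push_cast
    rw [sub_mul, add_mul, one_mul, Real.cos_sub, Real.cos_add, pow_succ]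
    ring
  unfold limMoment
  simp only [e]
  have h2 := (hint (l - 1) a).add (hint l b)
  simp only [Pi.add_def] at h2
  rw [integral_add h2 (hint _ _), integral_add (hint _ _) (hint _ _), integral_const_mul,
    integral_const_mul, integral_const_mul]
  ring

/-- An average as the integral of a step function. -/
theorem integral_comp_floor (c : ℕ → ℝ) {n : ℕ} (hn : n ≠ 0) :
    ∫ x in Set.Ioo (0 : ℝ) 1, c ⌊(n : ℝ) * x⌋₊ = (∑ k ∈ Finset.range n, c k) / n := by
  have hn' : (n : ℝ) ≠ 0 := by exact_mod_cast hn
  have hfl : ∀ k : ℕ, Set.EqOn (fun x : ℝ => c ⌊x⌋₊) (fun _ => c k) (Set.Ioo (k : ℝ) (k + 1)) := by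
    intro k x hx
    have : ⌊x⌋₊ = k := (Nat.floor_eq_iff (k.cast_nonneg.trans hx.1.le)).2 ⟨hx.1.le, hx.2⟩
    simp only [this]
  rw [← integral_Ioc_eq_integral_Ioo, ← intervalIntegral.integral_of_le zero_le_one,
    intervalIntegral.integral_comp_mul_left (fun x => c ⌊x⌋₊) hn', mul_zero, mul_one]
  have h1 := intervalIntegral.sum_integral_adjacent_intervals (f := fun x : ℝ => c ⌊x⌋₊)
    (μ := volume) (a := fun k : ℕ => (k : ℝ)) (n := n) (fun k _ => by
      push_cast
      rw [intervalIntegrable_iff_integrableOn_Ioo_of_le (by linarith)]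
      exact (integrableOn_congr_fun (hfl k) measurableSet_Ioo).2 (by simp))
  simp only [Nat.cast_zero] at h1
  rw [← h1, smul_eq_mul, inv_mul_eq_div]
  congr 1
  refine Finset.sum_congr rfl fun k _ => ?_
  push_cast
  rw [intervalIntegral.integral_of_le (by linarith), integral_Ioc_eq_integral_Ioo,
    setIntegral_congr_fun measurableSet_Ioo (hfl k)]
  simp

namespace Regime

variable {q α β γ δ L : ℝ} {M : ℕ → ℕ}

/-- By monotonicity all nodes lie between the first and the last, and both converge. -/
theorem exists_bound_nu (h : Regime q α β γ δ L M) : ∃ K : ℝ, 0 ≤ K ∧ ∀ᶠ n : ℕ in atTop,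
    ∀ y ≤ M n, |nu (base q n) (gammaSeq q M n) δ (y : ℝ)| ≤ K := by
  have h0 := (h.tendsto_nu_natCast (k := fun _ => 0) (x := 0) (by simp)).abs
  have h1 := (h.tendsto_nu_natCast h.tendsto_M).abs
  refine ⟨max (|mu q γ δ 0| + 1) (|mu q γ δ L| + 1), by positivity, ?_⟩
  filter_upwards [h.admissible, h0.eventually (gt_mem_nhds (lt_add_one _)),
    h1.eventually (gt_mem_nhds (lt_add_one _))] with n hn h2 h3 y hy
  have h4 := hn.nu_mem_uIcc hy
  have h5 : |nu (base q n) (gammaSeq q M n) δ (y : ℝ)|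
      ≤ max |nu (base q n) (gammaSeq q M n) δ ((0 : ℕ) : ℝ)|
        |nu (base q n) (gammaSeq q M n) δ (M n : ℝ)| := by
    rcases Set.mem_uIcc.1 h4 with h6 | h6
    · exact abs_le_max_abs_abs (by simpa using h6.1) h6.2
    · rw [max_comm]
      exact abs_le_max_abs_abs h6.1 (by simpa using h6.2)
  exact h5.trans (max_le_max h2.le h3.le)

/-- The matrix elements of powers of `ν` near `j = ξ n` converge to those of a Jacobi matrix with
constant coefficients, since both satisfy the same three-term recurrence in the limit. -/
theorem tendsto_moment (h : Regime q α β γ δ L M) {ξ : ℝ} (hξ : ξ ∈ Set.Ioo (0 : ℝ) 1) (m : ℕ) :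
    ∀ (l : ℤ) (i j : ℕ → ℕ), Tendsto (fun n : ℕ => (i n : ℝ) / n) atTop (𝓝 ξ) →
      (∀ᶠ n : ℕ in atTop, (i n : ℤ) - j n = l) →
      Tendsto (fun n : ℕ => moment (base q n) α β (gammaSeq q M n) δ (M n) m (i n) (j n)) atTop
        (𝓝 (limMoment (limOff q α β γ δ ξ) (limDiag q α β γ δ ξ) m l)) := by
  have hlt : ∀ {i : ℕ → ℕ}, Tendsto (fun n : ℕ => (i n : ℝ) / n) atTop (𝓝 ξ) →
      ∀ᶠ n : ℕ in atTop, i n < n := by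
    intro i hi
    filter_upwards [hi.eventually (gt_mem_nhds hξ.2), eventually_gt_atTop 0] with n hn h0
    rw [div_lt_one (by exact_mod_cast h0)] at hn
    exact_mod_cast hn
  have hxL : ξ ≤ L := hξ.2.le.trans h.one_lt.le
  induction m with
  | zero =>
    intro l i j hi hij
    refine tendsto_const_nhds.congr' ?_
    filter_upwards [h.admissible, hlt hi, hij, h.eventually_add_le l.natAbs] with n hn h1 h2 h3
    rw [hn.moment_zero (by omega) (by omega), limMoment_zero]
    exact if_congr (by omega) rfl rfl
  | succ m ih =>
    intro l i j hi hij
    have hpos : ∀ᶠ n : ℕ in atTop, i n - 1 + 1 = i n := by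
      filter_upwards [hi.eventually (lt_mem_nhds hξ.1)] with n hn
      have : i n ≠ 0 := by
        rintro h0
        simp [h0] at hn
      omega
    have hi' : Tendsto (fun n : ℕ => ((i n - 1 : ℕ) : ℝ) / n) atTop (𝓝 ξ) := by
      have h1 := hi.sub tendsto_one_div_atTop_nhds_zero_nat
      rw [sub_zero] at h1
      refine h1.congr' ?_
      filter_upwards [hpos] with n hn
      have : (i n : ℝ) = ((i n - 1 : ℕ) : ℝ) + 1 := by exact_mod_cast hn.symm
      rw [this]
      ring
    have h1 := ih (l - 1) (fun n => i n - 1) j hi' (by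
      filter_upwards [hij, hpos] with n h1 h2
      omega)
    have h2 := ih l (fun n => i n - 1 + 1) j (tendsto_add_const hi' 1) (by
      filter_upwards [hij, hpos] with n h1 h2
      omega)
    have h3 := ih (l + 1) (fun n => i n - 1 + 2) j (tendsto_add_const hi' 2) (by
      filter_upwards [hij, hpos] with n h1 h2
      omega)
    rw [limMoment_succ]
    refine ((((h.tendsto_recOff hxL hi').mul h1).add
      ((h.tendsto_recDiag hxL (tendsto_add_const hi' 1)).mul h2)).add
      ((h.tendsto_recOff hxL (tendsto_add_const hi' 1)).mul h3)).congr' ?_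
    filter_upwards [h.admissible, hlt hi, hij, hpos, h.eventually_add_le (l.natAbs + 3)]
      with n hn h4 h5 h6 h7
    have h8 := hn.moment_succ m (i := i n - 1) (j := j n) (by omega) (by omega)
    rw [h6] at h8 ⊢
    exact h8.symm

/-- The mean moments converge, being Riemann sums of diagonal matrix elements. -/
theorem tendsto_meanStat (h : Regime q α β γ δ L M) (m : ℕ) :
    Tendsto (fun n : ℕ => Admissible.meanStat (base q n) α β (gammaSeq q M n) δ (M n) n m / n) atTop
      (𝓝 (∫ x in Set.Ioo 0 L, mu q γ δ x ^ m * density q α β γ δ x)) := by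
  obtain ⟨K, hK0, hK⟩ := h.exists_bound_nu
  rw [h.integral_mu_mul_density (g := fun t => t ^ m) (continuous_pow m)]
  have e : ∀ ξ : ℝ, 1 / Real.pi * ∫ θ in Set.Ioo 0 Real.pi,
      (limDiag q α β γ δ ξ + 2 * limOff q α β γ δ ξ * Real.cos θ) ^ m
      = limMoment (limOff q α β γ δ ξ) (limDiag q α β γ δ ξ) m 0 := by
    intro ξ
    simp [limMoment]
  simp only [e]
  have hlim : Tendsto (fun n : ℕ => ∫ ξ in Set.Ioo (0 : ℝ) 1,
      moment (base q n) α β (gammaSeq q M n) δ (M n) m ⌊(n : ℝ) * ξ⌋₊ ⌊(n : ℝ) * ξ⌋₊) atTop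
      (𝓝 (∫ ξ in Set.Ioo (0 : ℝ) 1,
        limMoment (limOff q α β γ δ ξ) (limDiag q α β γ δ ξ) m 0)) := by
    refine tendsto_integral_filter_of_dominated_convergence (fun _ => K ^ m) ?_ ?_
      (integrable_const _) ?_
    · refine Eventually.of_forall fun n => Measurable.aestronglyMeasurable ?_
      exact (measurable_of_countable (fun k : ℕ =>
        moment (base q n) α β (gammaSeq q M n) δ (M n) m k k)).comp
        (Nat.measurable_floor.comp (measurable_const_mul (n : ℝ)))
    · filter_upwards [h.admissible, hK, h.eventually_add_le 0, eventually_gt_atTop 0]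
        with n hn hKn hM h0
      filter_upwards [ae_restrict_mem measurableSet_Ioo] with ξ hξ
      have h0' : (0 : ℝ) < n := by exact_mod_cast h0
      have h1 : ⌊(n : ℝ) * ξ⌋₊ < n := by
        rw [Nat.floor_lt (mul_nonneg h0'.le hξ.1.le)]
        nlinarith [hξ.2]
      exact hn.abs_moment_self_le m (by omega) hKn
    · filter_upwards [ae_restrict_mem measurableSet_Ioo] with ξ hξ
      refine h.tendsto_moment hξ m 0 _ _ ?_ (by simp)
      have := (tendsto_nat_floor_mul_div_atTop hξ.1.le).comp
        (tendsto_natCast_atTop_atTop (R := ℝ))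
      refine this.congr fun n => ?_
      simp [mul_comm]
  refine hlim.congr' ?_
  filter_upwards [eventually_gt_atTop 0] with n h0
  exact integral_comp_floor (fun k => moment (base q n) α β (gammaSeq q M n) δ (M n) m k k) h0.ne'

end Regime

end

end QRacah

namespace QRacah

noncomputable section

/-! ### Almost sure convergence of the moments -/

/-- Mean squares of order `n⁻²` are summable, so the sequence tends to zero almost surely, whatever
the joint law. -/
theorem ae_tendsto_zero_of_integral_sq_le {Ω : Type*} [MeasurableSpace Ω] {P : Measure Ω}
    {D : ℕ → Ω → ℝ} {C : ℝ} (hD : ∀ᶠ n in atTop, Integrable (fun ω => D n ω ^ 2) P)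
    (hC : ∀ᶠ n : ℕ in atTop, ∫ ω, D n ω ^ 2 ∂P ≤ C / (n : ℝ) ^ 2) :
    ∀ᵐ ω ∂P, Tendsto (fun n => D n ω) atTop (𝓝 0) := by
  obtain ⟨N, hN⟩ := eventually_atTop.1 (hD.and hC)
  have hint : ∀ n, Integrable (fun ω => D (n + N) ω ^ 2) P := fun n => (hN _ (by omega)).1
  have hle : ∀ n, ∫ ω, D (n + N) ω ^ 2 ∂P ≤ C / ((n + N : ℕ) : ℝ) ^ 2 :=
    fun n => (hN _ (by omega)).2
  have hsum : Summable fun n : ℕ => C / ((n + N : ℕ) : ℝ) ^ 2 := by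
    refine (summable_nat_add_iff (f := fun n : ℕ => C / (n : ℝ) ^ 2) N).2 ?_
    simpa [div_eq_mul_inv] using (Real.summable_nat_pow_inv.2 one_lt_two).mul_left C
  have hmeas : ∀ n, AEMeasurable (fun ω => ENNReal.ofReal (D (n + N) ω ^ 2)) P :=
    fun n => (hint n).aestronglyMeasurable.aemeasurable.ennreal_ofReal
  have hfin : ∫⁻ ω, ∑' n, ENNReal.ofReal (D (n + N) ω ^ 2) ∂P ≠ ⊤ := by
    rw [lintegral_tsum hmeas]
    refine ne_top_of_le_ne_top hsum.tsum_ofReal_ne_top (ENNReal.tsum_le_tsum fun n => ?_)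
    rw [← ofReal_integral_eq_lintegral_ofReal (hint n) (ae_of_all _ fun ω => sq_nonneg _)]
    exact ENNReal.ofReal_le_ofReal (hle n)
  filter_upwards [ae_lt_top' (AEMeasurable.tsum hmeas) hfin] with ω hω
  have h1 := ENNReal.tendsto_atTop_zero_of_tsum_ne_top hω.ne
  have h2 := (ENNReal.tendsto_toReal ENNReal.zero_ne_top).comp h1
  simp only [Function.comp_def, ENNReal.toReal_ofReal (sq_nonneg _), ENNReal.toReal_zero] at h2
  have h3 := h2.sqrt
  simp only [Real.sqrt_sq_eq_abs, Real.sqrt_zero] at h3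
  exact (tendsto_add_atTop_iff_nat (f := fun n => D n ω) N).1
    ((tendsto_zero_iff_abs_tendsto_zero _).2 h3)

namespace Regime

variable {q α β γ δ L : ℝ} {M : ℕ → ℕ}

/-- The variances of the averages are of order `n⁻²`, because those of the sums are bounded. -/
theorem ae_tendsto_moments (h : Regime q α β γ δ L M) {Ω : Type*} [MeasurableSpace Ω]
    {P : Measure Ω} [IsProbabilityMeasure P] {Y : (n : ℕ) → Ω → Fin n → Fin (M n + 1)}
    (hY : ∀ᶠ n : ℕ in atTop, HasLaw (Y n)
      (ensemble n (M n) (base q n) α β (gammaSeq q M n) δ) P) :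
    ∀ᵐ ω ∂P, ∀ m : ℕ, Tendsto (fun n : ℕ => (1 / (n : ℝ)) * ∑ i : Fin n,
      nu (base q n) (gammaSeq q M n) δ ((Y n ω i : ℕ) : ℝ) ^ m) atTop
      (𝓝 (∫ x in Set.Ioo 0 L, mu q γ δ x ^ m * density q α β γ δ x)) := by
  obtain ⟨K, hK0, hK⟩ := h.exists_bound_nu
  rw [ae_all_iff]
  intro m
  have hzero : ∀ᵐ ω ∂P, Tendsto (fun n : ℕ => (1 / (n : ℝ)) * (∑ i : Fin n,
      nu (base q n) (gammaSeq q M n) δ ((Y n ω i : ℕ) : ℝ) ^ m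
        - Admissible.meanStat (base q n) α β (gammaSeq q M n) δ (M n) n m)) atTop (𝓝 0) := by
    refine ae_tendsto_zero_of_integral_sq_le (C := m * K ^ (2 * m)) ?_ ?_
    · filter_upwards [hY] with n hn
      have : IsFiniteMeasure (ensemble n (M n) (base q n) α β (gammaSeq q M n) δ) :=
        hn.isFiniteMeasure_iff.1 inferInstance
      have h1 : Integrable (fun y : Fin n → Fin (M n + 1) => ((1 / (n : ℝ)) * (∑ i : Fin n,
          nu (base q n) (gammaSeq q M n) δ ((y i : ℕ) : ℝ) ^ m
          - Admissible.meanStat (base q n) α β (gammaSeq q M n) δ (M n) n m)) ^ 2)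
          (P.map (Y n)) := by
        rw [hn.map_eq]
        exact .of_finite
      exact h1.comp_aemeasurable hn.aemeasurable
    · filter_upwards [hY, hK, h.admissible, h.eventually_add_le 0] with n hn hKn hadm hM
      have h1 := hadm.integral_sq_sub_le (n := n) (by omega) m hKn
      rw [← hn.integral_comp (by
        have : IsFiniteMeasure (ensemble n (M n) (base q n) α β (gammaSeq q M n) δ) :=
          hn.isFiniteMeasure_iff.1 inferInstance
        exact Integrable.of_finite.aestronglyMeasurable)] at h1
      simp only [Function.comp_def] at h1
      simp only [mul_pow]
      rw [integral_const_mul, one_div, inv_pow, inv_mul_eq_div]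
      gcongr
  filter_upwards [hzero] with ω hω
  have h1 := hω.add (h.tendsto_meanStat m)
  rw [zero_add] at h1
  refine h1.congr fun n => ?_
  ring

end Regime

end

end QRacah

namespace QRacah

noncomputable section

/-! ### From moments to continuous and to Riemann integrable test functions -/

/-- The Lipschitz regularization of `f` from below on `[0, R]`: the largest `k`-Lipschitz function
that is at most `f` on `[0, R]`. -/
def lipEnvelope (f : ℝ → ℝ) (R : ℝ) (k : ℕ) (x : ℝ) : ℝ :=
  ⨅ y : Set.Icc (0 : ℝ) R, (f y + k * |x - y|)

section Envelope

variable {f : ℝ → ℝ} {R K : ℝ}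

theorem bddBelow_lipEnvelope (hf : ∀ x ∈ Set.Icc 0 R, |f x| ≤ K) (k : ℕ) (x : ℝ) :
    BddBelow (Set.range fun y : Set.Icc (0 : ℝ) R => f y + k * |x - y|) := by
  refine ⟨-K, ?_⟩
  rintro _ ⟨y, rfl⟩
  have h1 := (abs_le.1 (hf y y.2)).1
  have h2 : 0 ≤ (k : ℝ) * |x - y| := by positivity
  simp only
  linarith

theorem lipEnvelope_le (hf : ∀ x ∈ Set.Icc 0 R, |f x| ≤ K) (k : ℕ) {x : ℝ}
    (hx : x ∈ Set.Icc 0 R) : lipEnvelope f R k x ≤ f x := by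
  have := ciInf_le (bddBelow_lipEnvelope hf k x) ⟨x, hx⟩
  simpa [lipEnvelope] using this

theorem neg_le_lipEnvelope (hR : 0 ≤ R) (hf : ∀ x ∈ Set.Icc 0 R, |f x| ≤ K) (k : ℕ) (x : ℝ) :
    -K ≤ lipEnvelope f R k x := by
  have : Nonempty (Set.Icc (0 : ℝ) R) := ⟨⟨0, le_rfl, hR⟩⟩
  refine le_ciInf fun y => ?_
  have h1 := (abs_le.1 (hf y y.2)).1
  have h2 : 0 ≤ (k : ℝ) * |x - y| := by positivity
  linarith

theorem continuous_lipEnvelope (hR : 0 ≤ R) (hf : ∀ x ∈ Set.Icc 0 R, |f x| ≤ K) (k : ℕ) :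
    Continuous (lipEnvelope f R k) := by
  have : Nonempty (Set.Icc (0 : ℝ) R) := ⟨⟨0, le_rfl, hR⟩⟩
  refine (LipschitzWith.of_le_add_mul (k : NNReal) fun x x' => ?_).continuous
  rw [← sub_le_iff_le_add]
  refine le_ciInf fun y => ?_
  have h1 : lipEnvelope f R k x ≤ f y + k * |x - y| := ciInf_le (bddBelow_lipEnvelope hf k x) y
  have h2 : (k : ℝ) * |x - y| ≤ k * (|x - x'| + |x' - y|) := by
    gcongr
    exact abs_sub_le _ _ _
  rw [Real.dist_eq]
  push_cast
  linarith

theorem tendsto_lipEnvelope (hf : ∀ x ∈ Set.Icc 0 R, |f x| ≤ K) {x : ℝ}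
    (hx : x ∈ Set.Icc 0 R) (hc : ContinuousAt f x) :
    Tendsto (fun k => lipEnvelope f R k x) atTop (𝓝 (f x)) := by
  have : Nonempty (Set.Icc (0 : ℝ) R) := ⟨⟨x, hx⟩⟩
  rw [Metric.tendsto_atTop']
  intro ε hε
  obtain ⟨η, hη, hη'⟩ := Metric.continuousAt_iff.1 hc (ε / 2) (by positivity)
  obtain ⟨k₀, hk₀⟩ := exists_nat_ge (2 * K / η)
  refine ⟨k₀, fun k hk => ?_⟩
  have hkη : 2 * K ≤ k * η := by
    rw [← div_le_iff₀ hη]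
    exact hk₀.trans (by exact_mod_cast hk.le)
  have h1 : f x - ε / 2 ≤ lipEnvelope f R k x := by
    refine le_ciInf fun y => ?_
    have h3 : 0 ≤ (k : ℝ) * |x - y| := by positivity
    rcases lt_or_ge (dist (y : ℝ) x) η with h2 | h2
    · have := hη' h2
      rw [Real.dist_eq] at this
      have := (abs_lt.1 this).1
      linarith
    · rw [dist_comm, Real.dist_eq] at h2
      have h4 : (k : ℝ) * η ≤ k * |x - y| := by gcongr
      have h5 := (abs_le.1 (hf y y.2)).1
      have h6 := (abs_le.1 (hf x hx)).2
      linarith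
  have h2 := lipEnvelope_le hf k hx
  rw [Real.dist_eq, abs_lt]
  constructor <;> linarith

end Envelope

/-- Convergence of the averages for continuous functions gives the lower half of the convergence for
Riemann integrable ones, by approximation with Lipschitz functions from below. -/
theorem eventually_lt_average {L R K : ℝ} {ρ f : ℝ → ℝ} {x : (n : ℕ) → Fin n → ℝ} (hL : 0 ≤ L)
    (hR : L ≤ R) (hρ : IntegrableOn ρ (Set.Ioo 0 L))
    (hx : ∀ᶠ n in atTop, ∀ i, x n i ∈ Set.Icc 0 R)
    (hlim : ∀ g : ℝ → ℝ, Continuous g → Tendsto (fun n : ℕ => 1 / (n : ℝ) * ∑ i, g (x n i)) atTop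
      (𝓝 (∫ t in Set.Ioo 0 L, g t * ρ t)))
    (hf : ∀ t ∈ Set.Icc 0 R, |f t| ≤ K)
    (hc : ∀ᵐ t ∂(volume.restrict (Set.Icc 0 R)), ContinuousAt f t)
    {c : ℝ} (hlt : c < ∫ t in Set.Ioo 0 L, f t * ρ t) :
    ∀ᶠ n : ℕ in atTop, c < 1 / (n : ℝ) * ∑ i, f (x n i) := by
  have hR0 : 0 ≤ R := hL.trans hR
  have hsub : Set.Ioo 0 L ⊆ Set.Icc 0 R := fun t ht => ⟨ht.1.le, ht.2.le.trans hR⟩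
  have hconv : Tendsto (fun k => ∫ t in Set.Ioo 0 L, lipEnvelope f R k t * ρ t) atTop
      (𝓝 (∫ t in Set.Ioo 0 L, f t * ρ t)) := by
    refine tendsto_integral_of_dominated_convergence (fun t => K * |ρ t|) ?_ ?_ ?_ ?_
    · exact fun k => (continuous_lipEnvelope hR0 hf k).aestronglyMeasurable.mul
        hρ.aestronglyMeasurable
    · exact hρ.abs.const_mul K
    · intro k
      filter_upwards [ae_restrict_mem measurableSet_Ioo] with t ht
      rw [Real.norm_eq_abs, abs_mul]
      gcongr
      exact abs_le.2 ⟨neg_le_lipEnvelope hR0 hf k t,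
        (lipEnvelope_le hf k (hsub ht)).trans (abs_le.1 (hf t (hsub ht))).2⟩
    · filter_upwards [ae_restrict_mem measurableSet_Ioo,
        ae_restrict_of_ae_restrict_of_subset hsub hc] with t ht htc
      exact (tendsto_lipEnvelope hf (hsub ht) htc).mul_const _
  obtain ⟨k, hk⟩ := (hconv.eventually (lt_mem_nhds hlt)).exists
  filter_upwards [hx, (hlim _ (continuous_lipEnvelope hR0 hf k)).eventually (lt_mem_nhds hk)]
    with n hn hlt'
  refine hlt'.trans_le ?_
  gcongr with i
  exact lipEnvelope_le hf k (hn i)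

/-- Upper bounds follow from lower bounds for `-f`. -/
theorem tendsto_average_of_ae_continuous {L R K : ℝ} {ρ f : ℝ → ℝ} {x : (n : ℕ) → Fin n → ℝ}
    (hL : 0 ≤ L) (hR : L ≤ R) (hρ : IntegrableOn ρ (Set.Ioo 0 L))
    (hx : ∀ᶠ n in atTop, ∀ i, x n i ∈ Set.Icc 0 R)
    (hlim : ∀ g : ℝ → ℝ, Continuous g → Tendsto (fun n : ℕ => 1 / (n : ℝ) * ∑ i, g (x n i)) atTop
      (𝓝 (∫ t in Set.Ioo 0 L, g t * ρ t)))
    (hf : ∀ t ∈ Set.Icc 0 R, |f t| ≤ K)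
    (hc : ∀ᵐ t ∂(volume.restrict (Set.Icc 0 R)), ContinuousAt f t) :
    Tendsto (fun n : ℕ => 1 / (n : ℝ) * ∑ i, f (x n i)) atTop
      (𝓝 (∫ t in Set.Ioo 0 L, f t * ρ t)) := by
  refine tendsto_order.2 ⟨fun c hlt => eventually_lt_average hL hR hρ hx hlim hf hc hlt,
    fun c hlt => ?_⟩
  have h1 := eventually_lt_average (f := fun t => -f t) (c := -c) hL hR hρ hx hlim
    (fun t ht => by rw [abs_neg]; exact hf t ht) (hc.mono fun t ht => ht.neg)
    (by simpa only [neg_mul, integral_neg, neg_lt_neg_iff] using hlt)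
  filter_upwards [h1] with n hn
  simpa only [Finset.sum_neg_distrib, mul_neg, neg_lt_neg_iff] using hn

namespace Regime

variable {q α β γ δ L : ℝ} {M : ℕ → ℕ}

/-- The density has total mass `1`. -/
theorem integral_density (h : Regime q α β γ δ L M) :
    ∫ x in Set.Ioo 0 L, density q α β γ δ x = 1 := by
  have h1 := h.integral_mu_mul_density (g := fun _ => 1) continuous_const
  simp only [one_mul] at h1
  rw [h1]
  simp [Real.pi_pos.le, Real.pi_ne_zero]

/-- The rescaled points exceed `L` by a vanishing amount only. -/
theorem eventually_abs_sub_min_lt (h : Regime q α β γ δ L M) {g : ℝ → ℝ} (hg : Continuous g)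
    {ε : ℝ} (hε : 0 < ε) : ∀ᶠ n : ℕ in atTop, ∀ y ≤ M n,
      |g ((y : ℝ) / n) - g (min ((y : ℝ) / n) L)| < ε := by
  have huc := (isCompact_Icc (a := (0 : ℝ)) (b := L + 1)).uniformContinuousOn_of_continuous
    hg.continuousOn
  obtain ⟨η, hη, hη'⟩ := Metric.uniformContinuousOn_iff.1 huc ε hε
  filter_upwards [h.tendsto_M.eventually (gt_mem_nhds (lt_add_of_pos_right L (lt_min hη one_pos)))]
    with n hn y hy
  have h0 : 0 ≤ (y : ℝ) / n := by positivity
  have h1 : (y : ℝ) / n ≤ M n / n := by gcongr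
  have h2 := min_le_left η 1
  have h3 := min_le_right η 1
  have hL := h.L_pos
  rcases le_total ((y : ℝ) / n) L with h4 | h4
  · simpa [min_eq_left h4] using hε
  · rw [min_eq_right h4]
    refine hη' _ ⟨h0, by linarith⟩ _ ⟨hL.le, by linarith⟩ ?_
    rw [Real.dist_eq, abs_lt]
    constructor <;> linarith

theorem eventually_abs_nu_sub_lt (h : Regime q α β γ δ L M) {ε : ℝ} (hε : 0 < ε) :
    ∀ᶠ n : ℕ in atTop, ∀ y ≤ M n,
      |nu (base q n) (gammaSeq q M n) δ (y : ℝ) - mu q γ δ ((y : ℝ) / n)| < ε := by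
  have hcont : Continuous fun t : ℝ => q ^ t := Real.continuous_const_rpow h.pos.ne'
  obtain ⟨B, hB⟩ := (isCompact_Icc (a := (0 : ℝ)) (b := L + 1)).exists_bound_of_continuousOn
    hcont.continuousOn
  have h1 : Tendsto (fun n : ℕ => |δ * (gammaSeq q M n * base q n - γ)| * B) atTop (𝓝 0) := by
    have h2 := (((h.tendsto_gamma.mul h.tendsto_base).sub_const γ).const_mul δ).abs.mul_const B
    simpa using h2
  filter_upwards [h1.eventually (gt_mem_nhds hε),
    h.tendsto_M.eventually (gt_mem_nhds (lt_add_one L))] with n hn hM y hy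
  have h2 : (y : ℝ) / n ≤ M n / n := by gcongr
  have h3 := hB ((y : ℝ) / n) ⟨by positivity, by linarith⟩
  rw [nu_natCast (base_pos h.pos _), pow_succ, base_pow h.pos, mu, Real.rpow_neg h.pos.le]
  have e : (q ^ ((y : ℝ) / n))⁻¹ + δ * gammaSeq q M n * (q ^ ((y : ℝ) / n) * base q n)
      - ((q ^ ((y : ℝ) / n))⁻¹ + γ * δ * q ^ ((y : ℝ) / n))
      = δ * (gammaSeq q M n * base q n - γ) * q ^ ((y : ℝ) / n) := by ring
  rw [e, abs_mul]
  refine lt_of_le_of_lt ?_ hn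
  gcongr
  exact h3

/-- As `μ` is injective on `[0, L]`, polynomials in `μ` are uniformly dense there. -/
theorem exists_polynomial_mu (h : Regime q α β γ δ L M) {f : ℝ → ℝ} (hf : Continuous f) {ε : ℝ}
    (hε : 0 < ε) : ∃ p : Polynomial ℝ, ∀ x ∈ Set.Icc 0 L, |p.eval (mu q γ δ x) - f x| < ε := by
  let m : C(Set.Icc 0 L, ℝ) := ⟨fun x => mu q γ δ x, (continuous_mu h.pos γ δ).comp
    continuous_subtype_val⟩
  let F : C(Set.Icc 0 L, ℝ) := ⟨fun x => f x, hf.comp continuous_subtype_val⟩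
  have hsep : (Algebra.adjoin ℝ {m}).SeparatesPoints := by
    intro x y hxy
    refine ⟨m, ⟨m, Algebra.self_mem_adjoin_singleton ℝ m, rfl⟩, fun he => hxy ?_⟩
    exact Subtype.ext (h.mu_injOn x.2 y.2 he)
  obtain ⟨⟨g, hg⟩, hgF⟩ :=
    ContinuousMap.exists_mem_subalgebra_near_continuousMap_of_separatesPoints _ hsep F ε hε
  rw [Algebra.adjoin_singleton_eq_range_aeval] at hg
  obtain ⟨p, rfl⟩ := hg
  refine ⟨p, fun x hx => ?_⟩
  have h1 := (ContinuousMap.norm_coe_le_norm _ ⟨x, hx⟩).trans_lt hgF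
  rw [ContinuousMap.sub_apply] at h1
  have h2 : (Polynomial.aeval m p) ⟨x, hx⟩ = p.eval (mu q γ δ x) :=
    Polynomial.aeval_continuousMap_apply p m ⟨x, hx⟩
  rw [← h2]
  exact h1

/-- A polynomial in `μ` close to `f` on `[0, L]` is, in the variable `ν_n`, close to `f` at all
rescaled points for large `n`. -/
theorem exists_polynomial_nu (h : Regime q α β γ δ L M) {f : ℝ → ℝ} (hf : Continuous f) {ε : ℝ}
    (hε : 0 < ε) : ∃ p : Polynomial ℝ, (∀ x ∈ Set.Icc 0 L, |p.eval (mu q γ δ x) - f x| < ε) ∧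
      ∀ᶠ n : ℕ in atTop, ∀ y ≤ M n,
        |p.eval (nu (base q n) (gammaSeq q M n) δ (y : ℝ)) - f ((y : ℝ) / n)| < ε := by
  obtain ⟨p, hp⟩ := h.exists_polynomial_mu hf (ε := ε / 4) (by positivity)
  refine ⟨p, fun x hx => (hp x hx).trans (by linarith), ?_⟩
  obtain ⟨K, -, hK⟩ := h.exists_bound_nu
  have huc := (isCompact_Icc (a := -(K + 1)) (b := K + 1)).uniformContinuousOn_of_continuous
    p.continuous.continuousOn
  obtain ⟨η, hη, hη'⟩ := Metric.uniformContinuousOn_iff.1 huc (ε / 4) (by positivity)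
  have hpm : Continuous fun x => p.eval (mu q γ δ x) :=
    p.continuous.comp (continuous_mu h.pos γ δ)
  filter_upwards [hK, h.eventually_abs_nu_sub_lt (lt_min hη one_pos),
    h.eventually_abs_sub_min_lt hf (ε := ε / 4) (by positivity),
    h.eventually_abs_sub_min_lt hpm (ε := ε / 4) (by positivity)] with n h1 h2 h3 h4 y hy
  have h1' := abs_le.1 (h1 y hy)
  have h2' := abs_lt.1 ((h2 y hy).trans_le (min_le_right _ _))
  have h5 : dist (p.eval (nu (base q n) (gammaSeq q M n) δ (y : ℝ)))
      (p.eval (mu q γ δ ((y : ℝ) / n))) < ε / 4 := by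
    refine hη' _ ⟨by linarith, by linarith⟩ _ ⟨by linarith, by linarith⟩ ?_
    rw [Real.dist_eq]
    exact (h2 y hy).trans_le (min_le_left _ _)
  rw [Real.dist_eq] at h5
  have h6 := hp (min ((y : ℝ) / n) L) ⟨le_min (by positivity) h.L_pos.le, min_le_right _ _⟩
  have h7 := h3 y hy
  have h8 := h4 y hy
  rw [abs_lt] at *
  constructor <;> linarith

theorem tendsto_average_of_continuous (h : Regime q α β γ δ L M)
    {y : (n : ℕ) → Fin n → Fin (M n + 1)}
    (hy : ∀ m : ℕ, Tendsto (fun n : ℕ => 1 / (n : ℝ) * ∑ i : Fin n,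
      nu (base q n) (gammaSeq q M n) δ ((y n i : ℕ) : ℝ) ^ m) atTop
      (𝓝 (∫ x in Set.Ioo 0 L, mu q γ δ x ^ m * density q α β γ δ x)))
    {f : ℝ → ℝ} (hf : Continuous f) :
    Tendsto (fun n : ℕ => 1 / (n : ℝ) * ∑ i : Fin n, f (((y n i : ℕ) : ℝ) / n)) atTop
      (𝓝 (∫ x in Set.Ioo 0 L, f x * density q α β γ δ x)) := by
  have hint : ∀ g : ℝ → ℝ, Continuous g →
      IntegrableOn (fun x => g x * density q α β γ δ x) (Set.Ioo 0 L) := by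
    intro g hg
    obtain ⟨B, hB⟩ := (isCompact_Icc (a := (0 : ℝ)) (b := L)).exists_bound_of_continuousOn
      hg.continuousOn
    refine h.integrableOn_density.bdd_mul (c := B) hg.aestronglyMeasurable ?_
    filter_upwards [ae_restrict_mem measurableSet_Ioo] with x hx
    exact hB x (Set.Ioo_subset_Icc_self hx)
  have hintp : ∀ p : Polynomial ℝ, IntegrableOn
      (fun x => p.eval (mu q γ δ x) * density q α β γ δ x) (Set.Ioo 0 L) :=
    fun p => hint _ (p.continuous.comp (continuous_mu h.pos γ δ))
  have hpoly : ∀ p : Polynomial ℝ, Tendsto (fun n : ℕ => 1 / (n : ℝ) * ∑ i : Fin n,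
      p.eval (nu (base q n) (gammaSeq q M n) δ ((y n i : ℕ) : ℝ))) atTop
      (𝓝 (∫ x in Set.Ioo 0 L, p.eval (mu q γ δ x) * density q α β γ δ x)) := by
    intro p
    induction p using Polynomial.induction_on' with
    | add p r hp hr =>
      simp only [Polynomial.eval_add, Finset.sum_add_distrib, mul_add, add_mul]
      rw [integral_add (hintp p) (hintp r)]
      exact hp.add hr
    | monomial m c =>
      simp only [Polynomial.eval_monomial, mul_assoc, integral_const_mul, ← Finset.mul_sum]
      refine ((hy m).const_mul c).congr fun n => ?_
      ring
  rw [Metric.tendsto_atTop']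
  intro ε hε
  obtain ⟨p, hp1, hp2⟩ := h.exists_polynomial_nu hf (ε := ε / 3) (by positivity)
  have h1 : |(∫ x in Set.Ioo 0 L, p.eval (mu q γ δ x) * density q α β γ δ x)
      - ∫ x in Set.Ioo 0 L, f x * density q α β γ δ x| ≤ ε / 3 := by
    rw [← integral_sub (hintp p) (hint _ hf)]
    calc _ ≤ ∫ x in Set.Ioo 0 L, ε / 3 * density q α β γ δ x := by
          rw [← Real.norm_eq_abs]
          refine norm_integral_le_of_norm_le (h.integrableOn_density.const_mul (ε / 3)) ?_
          filter_upwards [ae_restrict_mem measurableSet_Ioo] with x hx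
          rw [← sub_mul, norm_mul, Real.norm_of_nonneg (h.density_nonneg x)]
          exact mul_le_mul_of_nonneg_right (hp1 x (Set.Ioo_subset_Icc_self hx)).le
            (h.density_nonneg x)
      _ = ε / 3 := by rw [integral_const_mul, h.integral_density, mul_one]
  obtain ⟨N, hN⟩ := eventually_atTop.1 ((Metric.tendsto_nhds.1 (hpoly p) (ε / 3)
    (by positivity)).and (hp2.and (eventually_gt_atTop 0)))
  refine ⟨N, fun n hn => ?_⟩
  obtain ⟨h2, h3, h4⟩ := hN n hn.le
  have h4' : (0 : ℝ) < n := by exact_mod_cast h4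
  have h5 : |1 / (n : ℝ) * ∑ i : Fin n, f (((y n i : ℕ) : ℝ) / n) - 1 / (n : ℝ) * ∑ i : Fin n,
      p.eval (nu (base q n) (gammaSeq q M n) δ ((y n i : ℕ) : ℝ))| ≤ ε / 3 := by
    rw [← mul_sub, ← Finset.sum_sub_distrib, abs_mul, abs_of_pos (by positivity)]
    calc _ ≤ 1 / (n : ℝ) * ∑ i : Fin n, ε / 3 := by
          gcongr
          refine (Finset.abs_sum_le_sum_abs _ _).trans (Finset.sum_le_sum fun i _ => ?_)
          rw [abs_sub_comm]
          exact (h3 _ (Nat.lt_succ_iff.1 (y n i).2)).le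
      _ = ε / 3 := by
          simp
          field_simp
  rw [Real.dist_eq] at h2 ⊢
  have h6 := abs_le.1 h5
  have h7 := abs_lt.1 h2
  have h8 := abs_le.1 h1
  rw [abs_lt]
  constructor <;> linarith

end Regime

end

end QRacah

/-! ### The limit theorem -/

namespace QRacah

noncomputable section

namespace Regime

/-- The condition on logarithms turns into a comparison of `αβ` with `γ²`, whose direction depends
on whether `q < 1`. -/
theorem of_hypotheses {q α β γ δ : ℝ} {M : ℕ → ℕ} (hq0 : 0 < q) (hq1 : q ≠ 1)
    (hγ : Tendsto (fun n : ℕ => gammaSeq q M n) atTop (𝓝 γ)) (hγ1 : 1 < -Real.logb q γ)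
    (hw : ∀ᶠ n : ℕ in atTop, ∀ y : ℕ, y ≤ M n →
      0 < weight (base q n) α β (gammaSeq q M n) δ y)
    (hν : ∀ᶠ n : ℕ in atTop,
      StrictMonoOn (fun y : ℕ => nu (base q n) (gammaSeq q M n) δ (y : ℝ)) (Set.Iic (M n)) ∨
      StrictAntiOn (fun y : ℕ => nu (base q n) (gammaSeq q M n) δ (y : ℝ)) (Set.Iic (M n)))
    (hαβ : α * β ≤ 0 ∨ Real.logb q (α * β) < 2 * Real.logb q γ) :
    Regime q α β γ δ (-Real.logb q γ) M := by
  have hγ0 : 0 < γ := by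
    refine lt_of_le_of_ne (ge_of_tendsto' hγ fun n => (Real.rpow_pos_of_pos hq0 _).le) ?_
    rintro rfl
    norm_num at hγ1
  have hpow : γ ^ 2 = q ^ (2 * Real.logb q γ) := by
    rw [mul_comm, Real.rpow_mul hq0.le, Real.rpow_logb hq0 hq1 hγ0]
    norm_cast
  refine ⟨hq0, hq1, hγ1, ?_, hγ, hw, hν, ?_⟩
  · rw [neg_neg, Real.rpow_logb hq0 hq1 hγ0]
  · rcases hαβ with h' | h'
    · exact Or.inl h'
    · rcases le_or_gt (α * β) 0 with h0 | h0
      · exact Or.inl h0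
      · have e : α * β = q ^ Real.logb q (α * β) := (Real.rpow_logb hq0 hq1 h0).symm
        rcases lt_or_gt_of_ne hq1 with h1 | h1
        · refine Or.inr (Or.inl ⟨h1, ?_⟩)
          rw [hpow, e]
          exact Real.rpow_lt_rpow_of_exponent_gt hq0 h1 h'
        · refine Or.inr (Or.inr ⟨h1, h0, ?_⟩)
          rw [hpow, e]
          exact Real.rpow_lt_rpow_of_exponent_lt h1 h'

end Regime

end

end QRacah

theorem theorem3p1 (q α β γ δ : ℝ) (M : ℕ → ℕ) (hq0 : 0 < q) (hq1 : q ≠ 1)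
    (hγ : Tendsto (fun n : ℕ => QRacah.gammaSeq q M n) atTop (𝓝 γ))
    (hγ1 : 1 < -Real.logb q γ)
    (hw : ∀ᶠ n : ℕ in atTop, ∀ y : ℕ, y ≤ M n →
      0 < QRacah.weight (QRacah.base q n) α β (QRacah.gammaSeq q M n) δ y)
    (hν : ∀ᶠ n : ℕ in atTop,
      StrictMonoOn (fun y : ℕ => QRacah.nu (QRacah.base q n) (QRacah.gammaSeq q M n) δ (y : ℝ))
        (Set.Iic (M n)) ∨
      StrictAntiOn (fun y : ℕ => QRacah.nu (QRacah.base q n) (QRacah.gammaSeq q M n) δ (y : ℝ))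
        (Set.Iic (M n)))
    (hαβ : α * β ≤ 0 ∨ Real.logb q (α * β) < 2 * Real.logb q γ) :
    -- `μ`, `a`, `b` are the limits of the rescaled `ν_n` and of the recurrence coefficients
    (∀ x : ℝ, Tendsto
      (fun n : ℕ => QRacah.nu (QRacah.base q n) (QRacah.gammaSeq q M n) δ ((n : ℝ) * x))
      atTop (𝓝 (QRacah.mu q γ δ x))) ∧
    (∀ ξ ∈ Set.Icc 0 (-Real.logb q γ), ∀ j : ℕ → ℕ,
      Tendsto (fun n : ℕ => (j n : ℝ) / (n : ℝ)) atTop (𝓝 ξ) →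
      Tendsto (fun n : ℕ => QRacah.recOff (QRacah.base q n) α β (QRacah.gammaSeq q M n) δ (j n))
        atTop (𝓝 (QRacah.limOff q α β γ δ ξ)) ∧
      Tendsto (fun n : ℕ => QRacah.recDiag (QRacah.base q n) α β (QRacah.gammaSeq q M n) δ (j n))
        atTop (𝓝 (QRacah.limDiag q α β γ δ ξ))) ∧
    -- the two solutions, and the explicit form of the density
    (∃ ξm ξp : ℝ → ℝ,
      (∀ x ∈ Set.Icc 0 (-Real.logb q γ), deriv (QRacah.mu q γ δ) x ≠ 0 →
        ξm x ∈ Set.Icc 0 (-Real.logb q γ) ∧ ξp x ∈ Set.Icc 0 (-Real.logb q γ) ∧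
        ξm x ≤ ξp x ∧
        (∀ ξ ∈ Set.Icc 0 (-Real.logb q γ),
          4 * QRacah.limOff q α β γ δ ξ ^ 2
              - (QRacah.mu q γ δ x - QRacah.limDiag q α β γ δ ξ) ^ 2 = 0
            ↔ ξ = ξm x ∨ ξ = ξp x) ∧
        (ξm x < ξp x → ξp x ≤ 1 → QRacah.density q α β γ δ x = 1) ∧
        (ξm x < 1 → 1 < ξp x → QRacah.density q α β γ δ x =
          1 / Real.pi * Real.arccos (QRacah.ySign q α β *
            ((2 * QRacah.yFun q α β 1 - QRacah.yFun q α β (ξm x) - QRacah.yFun q α β (ξp x)) /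
              |QRacah.yFun q α β (ξm x) - QRacah.yFun q α β (ξp x)|))) ∧
        (1 ≤ ξm x → ξm x < ξp x → QRacah.density q α β γ δ x = 0)) ∧
      {x | x ∈ Set.Icc 0 (-Real.logb q γ) ∧ deriv (QRacah.mu q γ δ) x ≠ 0 ∧
        ξm x = ξp x}.Finite) ∧
    -- the density is the almost sure limiting density of the rescaled ensembles
    (∀ {Ω : Type*} [MeasurableSpace Ω] (P : Measure Ω) [IsProbabilityMeasure P]
      (Y : (n : ℕ) → Ω → Fin n → Fin (M n + 1)),
      (∀ᶠ n : ℕ in atTop, HasLaw (Y n)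
        (QRacah.ensemble n (M n) (QRacah.base q n) α β (QRacah.gammaSeq q M n) δ) P) →
      ∀ (f : ℝ → ℝ) (R : ℝ), -Real.logb q γ < R →
        (∃ K : ℝ, ∀ x ∈ Set.Icc 0 R, |f x| ≤ K) →
        (∀ᵐ x ∂(volume.restrict (Set.Icc 0 R)), ContinuousAt f x) →
        ∀ᵐ ω ∂P, Tendsto
          (fun n : ℕ => 1 / (n : ℝ) * ∑ i : Fin n, f (((Y n ω i : ℕ) : ℝ) / (n : ℝ)))
          atTop (𝓝 (∫ x in (0 : ℝ)..(-Real.logb q γ), f x * QRacah.density q α β γ δ x))) := by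
  have h := QRacah.Regime.of_hypotheses hq0 hq1 hγ hγ1 hw hν hαβ
  refine ⟨h.tendsto_nu_mul, fun ξ hξ j hj => ⟨h.tendsto_recOff hξ.2 hj, h.tendsto_recDiag hξ.2 hj⟩,
    h.exists_solutions, ?_⟩
  intro Ω _ P _ Y hY f R hR hf hc
  obtain ⟨K, hK⟩ := hf
  filter_upwards [h.ae_tendsto_moments hY] with ω hω
  rw [intervalIntegral.integral_of_le h.L_pos.le, integral_Ioc_eq_integral_Ioo]
  refine QRacah.tendsto_average_of_ae_continuous h.L_pos.le hR.le h.integrableOn_density ?_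
    (fun g hg => h.tendsto_average_of_continuous hω hg) hK hc
  -- the points lie in `[0, M_n / n]`, and `M_n / n` tends to `L < R`
  filter_upwards [h.tendsto_M.eventually (gt_mem_nhds hR)] with n hn i
  refine ⟨by positivity, le_trans ?_ hn.le⟩
  gcongr
  exact Nat.lt_succ_iff.1 (Y n ω i).2
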